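/- **Setting.** Let $d,n,k\ge 1$, let $\Omega\subset\mathbb R^d$ be compact with nonempty interior and smooth boundary, $Q=[0,1]\times\Omega$. $\mathbb M^n,\mathbb S^n,\mathbb S^n_+,\mathbb A^n$ are the real $n\times n$ matrices and the symmetric, positive semidefinite and antisymmetric ones, with $A\cdot B=\operatorname{tr}(A^{T}B)$ and the Frobenius norm; $\mathcal M(\mathcal X,V)$ is the space of $V$-valued finite Borel measures on $\mathcal X$, with total variation norm and pairing $\langle\mu,\varphi\rangle_{\mathcal X}=\int\varphi\cdot d\mu$; $\|\varphi\|_{m,\infty}=\sum_{|\alpha|\le m}\sup_\Omega\|\partial^\alpha\varphi\|$. Let $\mathsf D^*\Phi=B_0\Phi+\sum_i B_i\partial_i\Phi$ be a constant coefficient operator of order one from $\mathbb S^n$-valued to $\mathbb R^{n\times k}$-valued functions of $x$, with $\mathsf D^*I=0$. For $X\in\mathbb S^n_+$ and $\operatorname{Ran}[Y,Z]\subset\operatorname{Ran}X$ put $J(X,Y,Z)=\frac12 Y\cdot X^\dagger Y+\frac12 Z\cdot X^\dagger Z$, and $J=+\infty$ otherwise. For $\mu=(\mathsf G,\mathsf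 q,\mathsf R)\in\mathcal M(Q,\mathbb S^n\times\mathbb R^{n\times k}\times\mathbb M^n)$ put $\mathcal J_Q(\mu)=\int_Q J(\frac{d\mu}{d\lambda})\,d\lambda$, where $\lambda\ge 0$ is any finite measure with $|\mu|\ll\lambda$. For $\mathsf G\in\mathcal M(\Omega,\mathbb S^n)$ put $\mathcal J^*_\Omega(\mathsf G,u,W)=\frac12\int_\Omega u\cdot(d\mathsf G\,u)+W\cdot(d\mathsf G\,W)$. For $\mathsf G_0,\mathsf G_1\in\mathcal M(\Omega,\mathbb S^n_+)$, $\mathcal{CE}_\infty([0,1];\mathsf G_0,\mathsf G_1)$ is the set of such $\mu$ with $\mathcal J_Q(\mu)<\infty$ and $$\int_Q\partial_t\Phi\cdot d\mathsf G+\mathsf D^*\Phi\cdot d\mathsf q+\Phi\cdot d\mathsf R=\int_\Omega\Phi_1\cdot d\mathsf G_1-\int_\Omega\Phi_0\cdot d\mathsf G_0\qquad\forall\,\Phi\in C^1(Q,\mathbb S^n).$$ **Discrete objects.** Let $\Sigma\subset(0,\infty)$ have $0$ as an accumulation point. For $\sigma\in\Sigma$ let $\overline X_\sigma,Y_\sigma$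 be finite-dimensional inner product spaces, each with a further norm $\|\cdot\|_1$ (the discrete $L^1$ norm). A *family of reconstructions* is a family of linear maps $\mathcal R_\sigma$ from these spaces to $\mathcal M(\Omega,\mathbb M^n)$, resp. $\mathcal M(\Omega,\mathbb R^{n\times k})$, with $\|\mathcal R_\sigma f\|_{TV}\le C\|f\|_1$, $C$ independent of $\sigma$; $\mathcal R_\sigma^*$ is its adjoint, $\langle f,\mathcal R_\sigma^*\varphi\rangle=\langle\mathcal R_\sigma f,\varphi\rangle_\Omega$ for continuous $\varphi$. Two families are *equivalent* if there are $\varepsilon_\sigma>0$, $\varepsilon_\sigma\to0$ as $\sigma\to0$, with $\|(\mathcal R^*_\sigma-\widetilde{\mathcal R}^*_\sigma)\varphi\|_*\le\varepsilon_\sigma\|\varphi\|_{1,\infty}$ for all $C^1$ functions $\varphi$ on $\Omega$, where $\|f\|_*=\max\{\langle f,g\rangle:\|g\|_1\le1\}$. Given are: * quasi-isometric families $\widehat{\mathcal R}_{\overline X_\sigma},\widehat{\mathcal R}_{Y_\sigma}$, i.e. $C^{-1}\|f\|_1\le\|\widehat{\mathcal R}_\sigma f\|_{TV}\le C\|f\|_1$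 with $C>0$ independent of $\sigma$; subspaces $X_\sigma\subset\overline X_\sigma$ and cones $X_{\sigma,+}\subset X_\sigma$ such that $\widehat{\mathcal R}_{\overline X_\sigma}$ maps $X_\sigma$, $X_\sigma^\perp$, $X_{\sigma,+}$ to measures with values in $\mathbb S^n$, $\mathbb A^n$, $\mathbb S^n_+$. The *admissible* families on $\overline X_\sigma$ are those equivalent to $\widehat{\mathcal R}_{\overline X_\sigma}$ with the same mapping property; those on $X_\sigma$ are their restrictions; those on $Y_\sigma$ are the ones equivalent to $\widehat{\mathcal R}_{Y_\sigma}$. Write $\widehat{\mathcal R}_{X_\sigma}=\widehat{\mathcal R}_{\overline X_\sigma}|_{X_\sigma}$; * proper, lower semicontinuous, convex functions $\mathcal J_\sigma:X_\sigma\times Y_\sigma\times\overline X_\sigma\to[0,\infty]$, positively homogeneous of degree $-1$ in the first variable and homogeneous of degree $2$ in the last two jointly; $\mathcal J^*_\sigma(G,u,W)=\sup_{q,R}\langle q,u\rangle+\langle R,W\rangle-\mathcal J_\sigma(G,q,R)$; * linear maps $\mathsf D_\sigma:Y_\sigma\to X_\sigma$, and $\mathsf G^\sigma_0,\mathsf G^\sigma_1\in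 X_{\sigma,+}$ with $\lim_{\sigma\to0}\langle\widehat{\mathcal R}_{X_\sigma}\mathsf G^\sigma_i,\Phi\rangle_\Omega=\langle\mathsf G_i,\Phi\rangle_\Omega$ for all $\Phi\in C(\Omega,\mathbb S^n)$, $i=0,1$. For $\tau=1/N$, $N\ge2$, and $\mu^{\tau,\sigma}=(G,q,R)\in X_\sigma^{N+1}\times Y_\sigma^N\times\overline X_\sigma^N$ put $$\mathcal J_{\tau,\sigma}(\mu^{\tau,\sigma})=\tau\sum_{j=1}^N\mathcal J_\sigma\Big(\frac{G_{j-1}+G_j}2,q_j,R_j\Big),\qquad \|\mu^{\tau,\sigma}\|_1=\tau\sum_{j=0}^N\|G_j\|_1+\tau\sum_{j=1}^N\big(\|q_j\|_1+\|R_j\|_1\big);$$ $\mu^{\tau,\sigma}\in\mathcal{CE}_{\tau,\sigma}([0,1];\mathsf G^\sigma_0,\mathsf G^\sigma_1)$ means $\tau^{-1}(G_j-G_{j-1})=-\mathsf D_\sigma q_j+\mathbb P_{X_\sigma}R_j$ and $G_j\in X_{\sigma,+}$ for $j=1,\dots,N$, with $G_0=\mathsf G_0^\sigma$, $G_N=\mathsf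 G_1^\sigma$, where $\mathbb P_{X_\sigma}$ is the orthogonal projection onto $X_\sigma$. An *admissible reconstruction* of $\mu^{\tau,\sigma}$ is the triple of measures on $Q$ that, for some admissible spatial families on $X_\sigma,Y_\sigma,\overline X_\sigma$, is given on $((j-1)\tau,j\tau]$ by $dt\otimes\mathcal R_{Y_\sigma}q_j$, by $dt\otimes\mathcal R_{\overline X_\sigma}R_j$ and, for $G$, either by $dt$ times the linear interpolation in time of $\mathcal R_{X_\sigma}G_{j-1}$ and $\mathcal R_{X_\sigma}G_j$, or by $dt$ times their mean. The reconstructions are *consistent* if, with some $\varepsilon_\sigma\ge0$, $\varepsilon_\sigma\to0$ as $\sigma\to0$ (which may differ in 1 and 3): 1. for some admissible $\mathcal R_{Y_\sigma}$: $|\langle\mathcal R_{Y_\sigma}q,\mathsf D^*\phi\rangle_\Omega+\langle\widehat{\mathcal R}_{X_\sigma}\mathsf D_\sigma q,\phi\rangle_\Omega|\le\varepsilon_\sigma\|\phi\|_{2,\infty}\|q\|_1$ for all $q\in Y_\sigma$, $\phi\in C^2(\Omega,\mathbb S^n)$; 2. for some $C$ independent of $\sigma$: $\mathcal J^*_\sigma(G,\widehat{\mathcal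 R}^*_{Y_\sigma}u,\widehat{\mathcal R}^*_{\overline X_\sigma}W)\le C(\|u\|_\infty^2+\|W\|_\infty^2)\|G\|_1$ for all $G\in X_\sigma$ and continuous $u,W$; 3. for some admissible $\widetilde{\mathcal R}_{X_\sigma},\mathcal R_{Y_\sigma},\mathcal R_{\overline X_\sigma}$: for every bounded set $E$ of $C^1$ pairs $(u,W)$ there is $C_E>0$ with $\mathcal J^*_\sigma(G,\mathcal R^*_{Y_\sigma}u,\mathcal R^*_{\overline X_\sigma}W)\le\mathcal J^*_\Omega(\widetilde{\mathcal R}_{X_\sigma}G,u,W)+\varepsilon_\sigma C_E\|G\|_1$ for all $\sigma\in\Sigma$, $G\in X_\sigma$, $(u,W)\in E$. **Theorem (asymptotic lower bound).** Let the reconstructions be consistent and let $\mu^{\tau,\sigma}\in\mathcal{CE}_{\tau,\sigma}([0,1];\mathsf G_0^\sigma,\mathsf G_1^\sigma)$, for $\tau=1/N$, $N\ge2$, $\sigma\in\Sigma$, satisfy $\sup_{\tau,\sigma}\mathcal J_{\tau,\sigma}(\mu^{\tau,\sigma})<\infty$. Then: (a) The discrete $L^1$ norms are bounded: there are $\sigma_0>0$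 and $C$ with $\|\mu^{\tau,\sigma}\|_1\le C$ for all $\tau$ and all $\sigma\in\Sigma$ with $\sigma\le\sigma_0$; moreover, for every $S\subset\Sigma$ such that $S\cap[\delta,\infty)$ is finite for each $\delta>0$ (for instance $S=\Sigma$ if the mesh sizes form a sequence tending to $0$), $\|\mu^{\tau,\sigma}\|_1$ is bounded independently of $\tau$ and $\sigma\in S$. (b) There are a sequence $(\tau_i,\sigma_i)\to0$ and a measure $\mu\in\mathcal{CE}_\infty([0,1];\mathsf G_0,\mathsf G_1)$ such that for all admissible reconstructions $\mathcal R_{\tau,\sigma}$ (of both kinds), $\mathcal R_{\tau_i,\sigma_i}(\mu^{\tau_i,\sigma_i})$ converges weak* to $\mu$ as $i\to\infty$, and $$\mathcal J_Q(\mu)\le\liminf_{(\tau,\sigma)\to0}\mathcal J_{\tau,\sigma}(\mu^{\tau,\sigma}).$$ -/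

import Mathlib

open MeasureTheory Set Filter Topology
open scoped ENNReal NNReal Matrix InnerProductSpace

attribute [local instance] Matrix.frobeniusNormedAddCommGroup Matrix.frobeniusNormedSpace

noncomputable section

namespace MatrixOT

/-! ### Matrices and matrix-valued measures -/

/-- Euclidean space `ℝ^d`. -/
abbrev Eu (d : ℕ) : Type := EuclideanSpace ℝ (Fin d)

/-- Real `n × m` matrices, with the Frobenius norm. -/
abbrev Mat (n m : ℕ) : Type := Matrix (Fin n) (Fin m) ℝ

/-- The uniform structure of the Frobenius norm (it is the usual one). -/
@[reducible] def matUniformity (n m : ℕ) : UniformSpace (Mat n m) :=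
  (Matrix.frobeniusNormedAddCommGroup (m := Fin n) (n := Fin m)
    (α := ℝ)).toMetricSpace.toPseudoMetricSpace.toUniformSpace

/-- The topology of the Frobenius norm (it is the usual one). -/
@[reducible] def matTopology (n m : ℕ) : TopologicalSpace (Mat n m) :=
  (matUniformity n m).toTopologicalSpace

attribute [local instance] matUniformity matTopology

/-- The Frobenius inner product `A · B = tr (Aᵀ B)` as a continuous bilinear form. -/
def frob (n m : ℕ) : Mat n m →L[ℝ] Mat n m →L[ℝ] ℝ :=
  LinearMap.toContinuousLinearMap
    ((LinearMap.toContinuousLinearMap (𝕜 := ℝ) (E := Mat n m) (F' := ℝ)).toLinearMap ∘ₗ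
      LinearMap.mk₂ ℝ (fun A B : Mat n m => (Aᵀ * B).trace)
        (fun A A' B => by simp [Matrix.add_mul])
        (fun c A B => by simp)
        (fun A B B' => by simp [Matrix.mul_add])
        (fun c A B => by simp))

lemma frob_apply {n m : ℕ} (A B : Mat n m) : frob n m A B = (Aᵀ * B).trace := rfl

/-- Countably additive `n × m` matrix-valued Borel measures. -/
abbrev MatMeas (α : Type*) [MeasurableSpace α] (n m : ℕ) : Type _ := VectorMeasure α (Mat n m)

section Measures

variable {α : Type*} [MeasurableSpace α] {n m : ℕ}

/-- The `(i, j)` entry of a matrix-valued measure. -/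
def entry (μ : MatMeas α n m) (i : Fin n) (j : Fin m) : SignedMeasure α :=
  μ.mapRange (Matrix.entryAddMonoidHom ℝ i j) (continuous_id.matrix_elem i j)

/-- The pairing `⟨μ, φ⟩ = ∫ φ · dμ`. -/
def pairing (μ : MatMeas α n m) (φ : α → Mat n m) : ℝ :=
  VectorMeasure.integral μ φ (frob n m)

/-- The total variation norm (with respect to the Frobenius norm on matrices). -/
def tvNorm (μ : MatMeas α n m) : ℝ := (μ.variation univ).toReal

/-- Values in the symmetric matrices. -/
def SymmValued (μ : MatMeas α n n) : Prop := ∀ s, MeasurableSet s → (μ s).IsSymm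

/-- Values in the antisymmetric matrices. -/
def AntisymmValued (μ : MatMeas α n n) : Prop := ∀ s, MeasurableSet s → (μ s)ᵀ = -μ s

/-- Values in the (symmetric) positive semidefinite matrices. -/
def PSDValued (μ : MatMeas α n n) : Prop := ∀ s, MeasurableSet s → (μ s).PosSemidef

/-- The density of `μ` with respect to `ν`, entry by entry. -/
def density (μ : MatMeas α n m) (ν : Measure α) (x : α) : Mat n m :=
  Matrix.of fun i j => (entry μ i j).rnDeriv ν x

lemma norm_le_sum_entries (A : Mat n m) : ‖A‖ ≤ ∑ i, ∑ j, ‖A i j‖ := by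
  rw [Matrix.frobenius_norm_def]
  have h0 : 0 ≤ ∑ i, ∑ j, ‖A i j‖ :=
    Finset.sum_nonneg fun i _ => Finset.sum_nonneg fun j _ => norm_nonneg _
  have h : ∑ i, ∑ j, ‖A i j‖ ^ (2 : ℝ) ≤ (∑ i, ∑ j, ‖A i j‖) ^ 2 := by
    simp only [Real.rpow_two]
    rw [← Finset.sum_product', ← Finset.sum_product']
    exact Finset.sum_sq_le_sq_sum_of_nonneg fun _ _ => norm_nonneg _
  calc (∑ i, ∑ j, ‖A i j‖ ^ (2 : ℝ)) ^ (1 / 2 : ℝ)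
      ≤ ((∑ i, ∑ j, ‖A i j‖) ^ 2) ^ (1 / 2 : ℝ) := by
        apply Real.rpow_le_rpow _ h (by norm_num)
        exact Finset.sum_nonneg fun i _ => Finset.sum_nonneg fun j _ => by positivity
    _ = ∑ i, ∑ j, ‖A i j‖ := by
        rw [← Real.sqrt_eq_rpow, Real.sqrt_sq h0]

/-- Matrix-valued measures have finite total variation. -/
instance isFiniteMeasure_variation (μ : MatMeas α n m) : IsFiniteMeasure μ.variation := by
  have hle : μ.variation ≤ ∑ p : Fin n × Fin m, (entry μ p.1 p.2).variation := by
    apply VectorMeasure.variation_le_of_forall_enorm_le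
    intro s _
    rw [Measure.finsetSum_apply]
    calc ‖μ s‖ₑ ≤ ∑ p : Fin n × Fin m, ‖entry μ p.1 p.2 s‖ₑ := by
          rw [← ofReal_norm]
          simp only [← ofReal_norm]
          rw [← ENNReal.ofReal_sum_of_nonneg (fun _ _ => norm_nonneg _)]
          apply ENNReal.ofReal_le_ofReal
          refine (norm_le_sum_entries (μ s)).trans (le_of_eq ?_)
          rw [Fintype.sum_prod_type]
          rfl
      _ ≤ _ := Finset.sum_le_sum fun p _ => VectorMeasure.enorm_measure_le_variation _ _
  have hfin : ∀ p : Fin n × Fin m, IsFiniteMeasure (entry μ p.1 p.2).variation := by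
    intro p
    rw [← SignedMeasure.totalVariation_eq_variation]
    unfold SignedMeasure.totalVariation
    infer_instance
  exact isFiniteMeasure_of_le _ hle

variable [TopologicalSpace α] [CompactSpace α] [BorelSpace α]

lemma integrable_continuous (μ : MatMeas α n m) (φ : C(α, Mat n m)) : μ.Integrable φ := by
  apply Integrable.of_bound (C := ‖φ‖)
  · exact φ.continuous.stronglyMeasurable_of_hasCompactSupport
      (HasCompactSupport.of_compactSpace _) |>.aestronglyMeasurable
  · exact Eventually.of_forall fun x => φ.norm_coe_le_norm x

/-- The pairing against a fixed continuous function is linear in the measure. -/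
def pairingₗ (φ : C(α, Mat n m)) : MatMeas α n m →ₗ[ℝ] ℝ where
  toFun μ := pairing μ φ
  map_add' μ ν :=
    VectorMeasure.integral_add_vectorMeasure (integrable_continuous μ φ) (integrable_continuous ν φ)
  map_smul' c _ := VectorMeasure.integral_smul_vectorMeasure _ c

end Measures

/-! ### The continuous problem -/

section Continuous

variable {d n k m : ℕ}

/-- `∂Ω` is smooth: near each boundary point, `Ω` is the sublevel set `{g ≤ 0}` of a smooth
function with nonvanishing gradient. -/
def HasSmoothBoundary (Ω : Set (Eu d)) : Prop :=
  ∀ x ∈ frontier Ω, ∃ U : Set (Eu d), IsOpen U ∧ x ∈ U ∧ ∃ g : Eu d → ℝ,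
    ContDiffOn ℝ (⊤ : ℕ∞) g U ∧ (∀ y ∈ U, fderiv ℝ g y ≠ 0) ∧ Ω ∩ U = {y ∈ U | g y ≤ 0}

/-- The partial derivative `∂_i φ` of a function on `Ω`. -/
def pd {F : Type*} [NormedAddCommGroup F] [NormedSpace ℝ F] (Ω : Set (Eu d)) (i : Fin d)
    (φ : Eu d → F) (x : Eu d) : F :=
  fderivWithin ℝ φ Ω x (EuclideanSpace.single i 1)

/-- `sup_{x ∈ Ω} ‖φ x‖`. -/
def supNorm {F : Type*} [NormedAddCommGroup F] (Ω : Set (Eu d)) (φ : Eu d → F) : ℝ :=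
  ⨆ x : Ω, ‖φ x‖

/-- `‖φ‖_{1,∞}`, the sum over the multi-indices of order at most `1`. -/
def c1Norm {F : Type*} [NormedAddCommGroup F] [NormedSpace ℝ F] (Ω : Set (Eu d))
    (φ : Eu d → F) : ℝ :=
  supNorm Ω φ + ∑ i, supNorm Ω (pd Ω i φ)

/-- `‖φ‖_{2,∞}`, the sum over the multi-indices of order at most `2`. -/
def c2Norm {F : Type*} [NormedAddCommGroup F] [NormedSpace ℝ F] (Ω : Set (Eu d))
    (φ : Eu d → F) : ℝ :=
  c1Norm Ω φ + ∑ i, ∑ j ∈ Finset.Ici i, supNorm Ω (pd Ω i (pd Ω j φ))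

/-- The restriction to `S` of a function that is continuous on `S`. -/
def toC {V F : Type*} [TopologicalSpace V] [TopologicalSpace F] {S : Set V} (φ : V → F)
    (hφ : ContinuousOn φ S) : C(S, F) :=
  ⟨S.domRestrict φ, hφ.domRestrict⟩

/-- A first order linear differential operator with constant coefficients
`D* φ = B₀ φ + ∑ᵢ Bᵢ ∂ᵢ φ`, acting on functions with values in the symmetric `n × n` matrices,
with values in the `n × k` matrices, and such that `D* I = 0`. -/
structure FirstOrderOp (d n k : ℕ) where
  zeroth : Mat n n →ₗ[ℝ] Mat n k
  first : Fin d → Mat n n →ₗ[ℝ] Mat n k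
  zeroth_one : zeroth 1 = 0

/-- `D* φ` for a function `φ` on `Ω`. -/
def FirstOrderOp.apply (D : FirstOrderOp d n k) (Ω : Set (Eu d)) (φ : Eu d → Mat n n)
    (x : Eu d) : Mat n k :=
  D.zeroth (φ x) + ∑ i, D.first i (pd Ω i φ x)

/-- The pseudoinverse `O Σ† Oᵀ` of a symmetric matrix `O Σ Oᵀ`. (In `ℝ`, `0⁻¹ = 0`.) -/
def pinv (A : Mat n n) : Mat n n :=
  open Classical in
  if h : A.IsHermitian then
    (h.eigenvectorUnitary : Mat n n) * Matrix.diagonal (fun i => (h.eigenvalues i)⁻¹) *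
      (h.eigenvectorUnitary : Mat n n)ᵀ
  else 0

/-- The function `J(X, Y, Z) = ½ Y · (X† Y) + ½ Z · (X† Z)` if `X` is positive semidefinite and
`Ran [Y, Z] ⊆ Ran X`, and `+∞` otherwise. -/
def costDensity (X : Mat n n) (Y : Mat n k) (Z : Mat n n) : ℝ≥0∞ :=
  open Classical in
  if X.PosSemidef ∧ LinearMap.range Y.mulVecLin ≤ LinearMap.range X.mulVecLin ∧
      LinearMap.range Z.mulVecLin ≤ LinearMap.range X.mulVecLin then
    ENNReal.ofReal (frob n k Y (pinv X * Y) / 2 + frob n n Z (pinv X * Z) / 2)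
  else ⊤

/-- A triple `μ = (G, q, R)` of matrix-valued measures. -/
structure TripleMeas (α : Type*) [MeasurableSpace α] (n k : ℕ) where
  G : MatMeas α n n
  q : MatMeas α n k
  R : MatMeas α n n

/-- The action `∫ J(dμ/dν) dν`, for the reference measure `ν = |G| + |q| + |R|`. -/
def TripleMeas.action {α : Type*} [MeasurableSpace α] (μ : TripleMeas α n k) : ℝ≥0∞ :=
  let ν : Measure α := μ.G.variation + μ.q.variation + μ.R.variation
  ∫⁻ x, costDensity (density μ.G ν x) (density μ.q ν x) (density μ.R ν x) ∂ν

/-- `½ ‖(u, W)‖²_{L²_G} = ½ ∫ u · (dG u) + ½ ∫ W · (dG W)`, where `A · (B A) = B · (A Aᵀ)`. -/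
def dualAction {α : Type*} [MeasurableSpace α] (G : MatMeas α n n) (u : α → Mat n k)
    (W : α → Mat n n) : ℝ :=
  pairing G (fun x => u x * (u x)ᵀ) / 2 + pairing G (fun x => W x * (W x)ᵀ) / 2

/-- `μ ∈ CE([0,1]; G₀, G₁)`: the weak matricial continuity equation on `Q = [0,1] × Ω`. -/
def IsCE {Ω : Set (Eu d)} (D : FirstOrderOp d n k) (G₀ G₁ : MatMeas Ω n n)
    (μ : TripleMeas (unitInterval × Ω) n k) : Prop :=
  SymmValued μ.G ∧
  ∀ Φ : ℝ × Eu d → Mat n n, ContDiffOn ℝ 1 Φ (Icc 0 1 ×ˢ Ω) →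
    (∀ p ∈ Icc (0 : ℝ) 1 ×ˢ Ω, (Φ p).IsSymm) →
    pairing μ.G (fun p => derivWithin (fun s => Φ (s, p.2)) (Icc 0 1) p.1) +
        pairing μ.q (fun p => D.apply Ω (fun y => Φ (p.1, y)) p.2) +
        pairing μ.R (fun p => Φ (p.1, p.2)) =
      pairing G₁ (fun x => Φ (1, x)) - pairing G₀ (fun x => Φ (0, x))

/-- `μ ∈ CE_∞([0,1]; G₀, G₁)`: solutions of the continuity equation with finite action. -/
def IsCEInfty {Ω : Set (Eu d)} (D : FirstOrderOp d n k) (G₀ G₁ : MatMeas Ω n n)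
    (μ : TripleMeas (unitInterval × Ω) n k) : Prop :=
  IsCE D G₀ G₁ μ ∧ μ.action < ⊤

end Continuous

/-! ### Discrete approximations of measures -/

section Approximation

variable {d n m : ℕ} {Ω : Set (Eu d)} [CompactSpace Ω]

/-- The filter `σ → 0` on the parameter set. -/
def toZero (Sig : Set ℝ) : Filter Sig := comap (fun σ : Sig => (σ : ℝ)) (𝓝 0)

section OneSpace

variable {E : Type*} [NormedAddCommGroup E] [InnerProductSpace ℝ E]

/-- The norm dual to the (semi)norm `p` with respect to the inner product of `E`. -/
def dualNorm (p : Seminorm ℝ E) (f : E) : ℝ := ⨆ g : {g : E // p g ≤ 1}, ⟪f, (g : E)⟫_ℝ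

variable [FiniteDimensional ℝ E]

/-- The adjoint `R* φ` of a reconstruction: `⟨f, R* φ⟩ = ⟨R f, φ⟩` for all `f`. -/
def adj (R : E →ₗ[ℝ] MatMeas Ω n m) (φ : C(Ω, Mat n m)) : E :=
  (InnerProductSpace.toDual ℝ E).symm (LinearMap.toContinuousLinearMap (pairingₗ φ ∘ₗ R))

lemma inner_adj (R : E →ₗ[ℝ] MatMeas Ω n m) (φ : C(Ω, Mat n m)) (f : E) :
    ⟪f, adj R φ⟫_ℝ = pairing (R f) φ := by
  rw [real_inner_comm, adj, InnerProductSpace.toDual_symm_apply]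
  rfl

end OneSpace

variable {Sig : Set ℝ} {M : Sig → Type*} [∀ σ, NormedAddCommGroup (M σ)]
  [∀ σ, InnerProductSpace ℝ (M σ)] [∀ σ, FiniteDimensional ℝ (M σ)]

/-- The uniform bound `‖R_σ f‖_TV ≤ C ‖f‖_1` required of a family of reconstructions. -/
def IsReconstruction (p : ∀ σ, Seminorm ℝ (M σ)) (R : ∀ σ, M σ →ₗ[ℝ] MatMeas Ω n m) : Prop :=
  ∃ C : ℝ, ∀ σ f, tvNorm (R σ f) ≤ C * p σ f

/-- A quasi-isometric family of reconstructions. -/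
def IsQuasiIsometric (p : ∀ σ, Seminorm ℝ (M σ)) (R : ∀ σ, M σ →ₗ[ℝ] MatMeas Ω n m) : Prop :=
  ∃ C : ℝ, 0 < C ∧ ∀ σ f, C⁻¹ * p σ f ≤ tvNorm (R σ f) ∧ tvNorm (R σ f) ≤ C * p σ f

/-- Equivalence of two families of reconstructions. -/
def RecEquiv (p : ∀ σ, Seminorm ℝ (M σ)) (R R' : ∀ σ, M σ →ₗ[ℝ] MatMeas Ω n m) : Prop :=
  ∃ ε : Sig → ℝ, (∀ σ, 0 < ε σ) ∧ Tendsto ε (toZero Sig) (𝓝 0) ∧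
    ∀ σ (φ : Eu d → Mat n m) (hφ : ContDiffOn ℝ 1 φ Ω),
      dualNorm (p σ) (adj (R σ) (toC φ hφ.continuousOn) - adj (R' σ) (toC φ hφ.continuousOn)) ≤
        ε σ * c1Norm Ω φ

end Approximation

/-! ### The discrete transport model -/

section Discrete

variable {d : ℕ}

/-- The spatial discrete modules: the spaces `X̄_σ`, `Y_σ` (with inner products and `L¹` norms),
the subspace `X_σ ⊆ X̄_σ` with its cone `X_{σ,+}`, the quasi-isometric reconstructions, the
discrete action `J_σ` and the discrete derivation `D_σ`. -/
structure DiscreteModules (Ω : Set (Eu d)) [CompactSpace Ω] (n k : ℕ) (Sig : Set ℝ)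
    (Xbar Y : Sig → Type*)
    [∀ σ, NormedAddCommGroup (Xbar σ)] [∀ σ, InnerProductSpace ℝ (Xbar σ)]
    [∀ σ, FiniteDimensional ℝ (Xbar σ)]
    [∀ σ, NormedAddCommGroup (Y σ)] [∀ σ, InnerProductSpace ℝ (Y σ)]
    [∀ σ, FiniteDimensional ℝ (Y σ)] where
  /-- The norm `‖·‖_1` on `X̄_σ`. -/
  normX : ∀ σ, Seminorm ℝ (Xbar σ)
  normX_definite : ∀ σ x, normX σ x = 0 → x = 0
  /-- The norm `‖·‖_1` on `Y_σ`. -/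
  normY : ∀ σ, Seminorm ℝ (Y σ)
  normY_definite : ∀ σ y, normY σ y = 0 → y = 0
  recX : ∀ σ, Xbar σ →ₗ[ℝ] MatMeas Ω n n
  recY : ∀ σ, Y σ →ₗ[ℝ] MatMeas Ω n k
  recX_quasi : IsQuasiIsometric normX recX
  recY_quasi : IsQuasiIsometric normY recY
  X : ∀ σ, Submodule ℝ (Xbar σ)
  Xpos : ∀ σ, Set (X σ)
  Xpos_cone : ∀ σ, ∀ G ∈ Xpos σ, ∀ c : ℝ, 0 < c → c • G ∈ Xpos σ
  recX_symm : ∀ σ, ∀ x ∈ X σ, SymmValued (recX σ x)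
  recX_antisymm : ∀ σ, ∀ x ∈ (X σ)ᗮ, AntisymmValued (recX σ x)
  recX_psd : ∀ σ, ∀ x ∈ Xpos σ, PSDValued (recX σ x)
  J : ∀ σ, X σ → Y σ → Xbar σ → ℝ≥0∞
  J_proper : ∀ σ, ∃ G q R, J σ G q R ≠ ⊤
  J_lsc : ∀ σ, LowerSemicontinuous fun p : X σ × Y σ × Xbar σ => J σ p.1 p.2.1 p.2.2
  J_convex : ∀ σ G G' q q' R R' (a b : ℝ), 0 ≤ a → 0 ≤ b → a + b = 1 →
    J σ (a • G + b • G') (a • q + b • q') (a • R + b • R') ≤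
      ENNReal.ofReal a * J σ G q R + ENNReal.ofReal b * J σ G' q' R'
  J_homog_fst : ∀ σ G q R (c : ℝ), 0 < c → J σ (c • G) q R = ENNReal.ofReal c⁻¹ * J σ G q R
  J_homog_snd : ∀ σ G q R (c : ℝ), c ≠ 0 →
    J σ G (c • q) (c • R) = ENNReal.ofReal (c ^ 2) * J σ G q R
  D : ∀ σ, Y σ →ₗ[ℝ] X σ

/-- An element `(G, q, R)` of `X_σ^{N+1} × Y_σ^N × X̄_σ^N`; the entries `q j`, `R j` with
`j : Fin N` belong to the time interval `[jτ, (j+1)τ]`. -/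
structure DiscreteTriple (N : ℕ) (X Y Xbar : Type*) where
  G : Fin (N + 1) → X
  q : Fin N → Y
  R : Fin N → Xbar

namespace DiscreteModules

variable {Ω : Set (Eu d)} [CompactSpace Ω] {n k : ℕ} {Sig : Set ℝ} {Xbar Y : Sig → Type*}
  [∀ σ, NormedAddCommGroup (Xbar σ)] [∀ σ, InnerProductSpace ℝ (Xbar σ)]
  [∀ σ, FiniteDimensional ℝ (Xbar σ)]
  [∀ σ, NormedAddCommGroup (Y σ)] [∀ σ, InnerProductSpace ℝ (Y σ)]
  [∀ σ, FiniteDimensional ℝ (Y σ)]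
  (𝓜 : DiscreteModules Ω n k Sig Xbar Y)

/-- The set `[R̂_X̄]` of admissible families of reconstructions on `X̄_σ`. Its restrictions to `X_σ`
are the admissible reconstructions on `X_σ`. -/
def AdmissibleX (R : ∀ σ, Xbar σ →ₗ[ℝ] MatMeas Ω n n) : Prop :=
  IsReconstruction 𝓜.normX R ∧ RecEquiv 𝓜.normX R 𝓜.recX ∧
    (∀ σ, ∀ x ∈ 𝓜.X σ, SymmValued (R σ x)) ∧
    (∀ σ, ∀ x ∈ (𝓜.X σ)ᗮ, AntisymmValued (R σ x)) ∧
    ∀ σ, ∀ x ∈ 𝓜.Xpos σ, PSDValued (R σ x)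

/-- The set `[R̂_Y]` of admissible families of reconstructions on `Y_σ`. -/
def AdmissibleY (R : ∀ σ, Y σ →ₗ[ℝ] MatMeas Ω n k) : Prop :=
  IsReconstruction 𝓜.normY R ∧ RecEquiv 𝓜.normY R 𝓜.recY

/-- The conjugate `J*_σ(G, u, W)` of `J_σ(G, ·, ·)`. -/
def Jstar (σ : Sig) (G : 𝓜.X σ) (u : Y σ) (W : Xbar σ) : EReal :=
  ⨆ p : Y σ × Xbar σ,
    ((⟪p.1, u⟫_ℝ + ⟪p.2, W⟫_ℝ : ℝ) : EReal) - ((𝓜.J σ G p.1 p.2 : ℝ≥0∞) : EReal)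

/-- The discrete action functional `J_{τ,σ}`, `τ = 1 / N`. -/
def action (N : ℕ) (σ : Sig) (μ : DiscreteTriple N (𝓜.X σ) (Y σ) (Xbar σ)) : ℝ≥0∞ :=
  ENNReal.ofReal (1 / N) *
    ∑ j : Fin N, 𝓜.J σ ((1 / 2 : ℝ) • (μ.G j.castSucc + μ.G j.succ)) (μ.q j) (μ.R j)

/-- `μ ∈ CE_{τ,σ}([0,1]; G₀, G₁)`: the discrete continuity equation, `τ = 1 / N`. -/
def IsCE (N : ℕ) (σ : Sig) (G₀ G₁ : 𝓜.X σ)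
    (μ : DiscreteTriple N (𝓜.X σ) (Y σ) (Xbar σ)) : Prop :=
  (∀ j : Fin N, (1 / N : ℝ)⁻¹ • (μ.G j.succ - μ.G j.castSucc) =
    -𝓜.D σ (μ.q j) + (𝓜.X σ).orthogonalProjectionOnto (μ.R j)) ∧
  μ.G 0 = G₀ ∧ μ.G (Fin.last N) = G₁ ∧ ∀ j : Fin N, μ.G j.succ ∈ 𝓜.Xpos σ

/-- The discrete `L¹` norm of a discrete triple, `τ = 1 / N`. -/
def norm1 (N : ℕ) (σ : Sig) (μ : DiscreteTriple N (𝓜.X σ) (Y σ) (Xbar σ)) : ℝ :=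
  (∑ j, (1 / N : ℝ) * 𝓜.normX σ (μ.G j)) + (1 / N : ℝ) * (∑ j, 𝓜.normY σ (μ.q j)) +
    (1 / N : ℝ) * (∑ j, 𝓜.normX σ (μ.R j))

/-- Consistency of `D*` and `D*_σ`. -/
def ConsistentD (D : FirstOrderOp d n k) : Prop :=
  ∃ RY, 𝓜.AdmissibleY RY ∧
    ∃ ε : Sig → ℝ, (∀ σ, 0 ≤ ε σ) ∧ Tendsto ε (toZero Sig) (𝓝 0) ∧
      ∀ σ (q : Y σ) (φ : Eu d → Mat n n), ContDiffOn ℝ 2 φ Ω → (∀ x ∈ Ω, (φ x).IsSymm) →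
        |pairing (RY σ q) (fun x => D.apply Ω φ x) +
            pairing (𝓜.recX σ (𝓜.D σ q)) (fun x => φ x)| ≤
          ε σ * c2Norm Ω φ * 𝓜.normY σ q

/-- Stability and consistency of `J*_σ`. -/
def ConsistentJ : Prop :=
  (∃ C : ℝ, ∀ σ (G : 𝓜.X σ) (u : C(Ω, Mat n k)) (W : C(Ω, Mat n n)),
    𝓜.Jstar σ G (adj (𝓜.recY σ) u) (adj (𝓜.recX σ) W) ≤
      ((C * (‖u‖ ^ 2 + ‖W‖ ^ 2) * 𝓜.normX σ G : ℝ) : EReal)) ∧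
  ∃ RX RXbar RY, 𝓜.AdmissibleX RX ∧ 𝓜.AdmissibleX RXbar ∧ 𝓜.AdmissibleY RY ∧
    ∃ ε : Sig → ℝ, (∀ σ, 0 ≤ ε σ) ∧ Tendsto ε (toZero Sig) (𝓝 0) ∧
      ∀ r : ℝ, ∃ C : ℝ, 0 < C ∧ ∀ σ (G : 𝓜.X σ) (u : Eu d → Mat n k) (W : Eu d → Mat n n)
        (hu : ContDiffOn ℝ 1 u Ω) (hW : ContDiffOn ℝ 1 W Ω), c1Norm Ω u ≤ r → c1Norm Ω W ≤ r →
        𝓜.Jstar σ G (adj (RY σ) (toC u hu.continuousOn)) (adj (RXbar σ) (toC W hW.continuousOn)) ≤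
          ((dualAction (RX σ G) (fun x => u x) (fun x => W x) + ε σ * C * 𝓜.normX σ G : ℝ) :
            EReal)

/-- The reconstructions are consistent. -/
def Consistent (D : FirstOrderOp d n k) : Prop := 𝓜.ConsistentD D ∧ 𝓜.ConsistentJ

end DiscreteModules

/-! ### Time-space reconstructions

A time-space reconstruction is a measure on `Q = [0,1] × Ω`; as usual it is given through its
action on the continuous functions on `Q`. -/

variable {Ω : Set (Eu d)} {n m : ℕ}

/-- The slice `Φ_t = Φ(t, ·)`. -/
def slice (Φ : C(unitInterval × Ω, Mat n m)) (t : ℝ) : Ω → Mat n m :=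
  fun x => Φ (projIcc 0 1 zero_le_one t, x)

/-- The piecewise linear reconstruction `Φ ↦ ⟨R^l(G), Φ⟩_Q`, where `G j` stands for the
spatial reconstruction at time `j / N`. -/
def recLinear (N : ℕ) (G : Fin (N + 1) → MatMeas Ω n m) (Φ : C(unitInterval × Ω, Mat n m)) : ℝ :=
  let τ : ℝ := 1 / N
  ∑ j : Fin N, ∫ t in (j * τ)..((j + 1) * τ),
    pairing ((((j + 1) * τ - t) / τ) • G j.castSucc + ((t - j * τ) / τ) • G j.succ) (slice Φ t)

/-- The piecewise constant reconstruction `Φ ↦ ⟨R^a(G), Φ⟩_Q` by averages. -/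
def recAverage (N : ℕ) (G : Fin (N + 1) → MatMeas Ω n m)
    (Φ : C(unitInterval × Ω, Mat n m)) : ℝ :=
  let τ : ℝ := 1 / N
  ∑ j : Fin N, ∫ t in (j * τ)..((j + 1) * τ),
    pairing ((1 / 2 : ℝ) • G j.castSucc + (1 / 2 : ℝ) • G j.succ) (slice Φ t)

/-- The piecewise constant reconstruction `Φ ↦ ⟨R(q), Φ⟩_Q`. -/
def recConst (N : ℕ) (q : Fin N → MatMeas Ω n m) (Φ : C(unitInterval × Ω, Mat n m)) : ℝ :=
  let τ : ℝ := 1 / N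
  ∑ j : Fin N, ∫ t in (j * τ)..((j + 1) * τ), pairing (q j) (slice Φ t)

/-- Weak* convergence to `μ` of a sequence of measures on `Q`, given through their action on
continuous functions. -/
def WeakStarTendsto (F : ℕ → C(unitInterval × Ω, Mat n m) → ℝ)
    (μ : MatMeas (unitInterval × Ω) n m) : Prop :=
  ∀ Φ : C(unitInterval × Ω, Mat n m), Tendsto (fun i => F i Φ) atTop (𝓝 (pairing μ Φ))

end Discrete

end MatrixOT

end

attribute [local instance] MatrixOT.matUniformity MatrixOT.matTopology

open MatrixOT

/-! For symmetric `X` the cost density is a supremum of affine functions, `J(X, Y, Z) = sup_{u,W}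
u·Y + W·Z - ½ uuᵀ·X - ½ WWᵀ·X`. Lower semicontinuity of the action therefore reduces to passing to
the limit for one smooth pair `(u, W)` at a time, and smooth pairs are exactly what the consistency
assumptions allow on the discrete side.

Compactness. The Fenchel–Young inequality for the discrete action, applied to test functions of size
`s`, bounds `‖q‖₁ + ‖R‖₁` by a multiple of `J_σ / s + s ‖G‖₁` (`DiscreteModules.exists_flux_bound`).
Testing the discrete continuity equation with the identity matrix, for which `D* I = 0`, leaves only
the consistency error and the source, so the trace mass grows at a rate controlled by `‖q‖₁ + ‖R‖₁`.
For positive semidefinite measures the mass controls the total variation, and a small `s` absorbs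
the maximal mass (`DiscreteModules.exists_norm1_bound`). Bounded reconstructions have weak*
convergent subsequences; the limit functional is dominated by a limit of the variations and is
therefore a matrix-valued measure (`exists_subseq_weakStarTendsto`). All admissible reconstructions
share this limit: equivalent families differ by `ε_σ` on `C¹` functions, which are dense, and
interpolation and mean differ only through the oscillation of the test function in one time step.

Continuity equation. The piecewise linear reconstruction can be integrated by parts in time exactly,
so the discrete equation becomes the weak equation up to the consistency error of `D_σ`
(`DiscreteModules.exists_weakForm_error`). This needs smooth test functions. They are dense in
`C¹([0,1] × Ω)`: the domain is pushed into its interior along a smooth field, which gives functions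
that are `C¹` near the domain, and these are mollified (`exists_smooth_close`,
`TripleMeas.isCE_of_smooth`).

Action. Integrating the discrete dual inequality in time (`DiscreteModules.exists_energy_error`) and
passing to the limit gives the dual bound for smooth, then continuous, then bounded measurable `(u,
W)`; nearly optimal measurable choices and monotone convergence turn it into a bound on the integral
of `J` (`TripleMeas.action_le_of_dual_bound`). A finite pointwise dual bound itself forces the
density of `G` to be positive semidefinite and the range condition to hold
(`costDensity_le_of_dual_bound`), so only symmetry of the limit has to be carried along. -/

namespace MatrixOT

/-! ### Integration against vector measures with a density -/

section IntegralWithDensity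

variable {α E F : Type*} [MeasurableSpace α] [NormedAddCommGroup E] [NormedSpace ℝ E]
  [NormedAddCommGroup F] [NormedSpace ℝ F] [CompleteSpace F]

/-- Integration against a vector measure with a density. -/
theorem integral_withDensityᵥ (B : E →L[ℝ] F →L[ℝ] ℝ) {ρ : Measure α} {h : α → F}
    (hh : Integrable h ρ) {f : α → E} (hf : (ρ.withDensityᵥ h).Integrable f) :
    Integrable (fun x => B (f x) (h x)) ρ ∧
      VectorMeasure.integral (ρ.withDensityᵥ h) f B = ∫ x, B (f x) (h x) ∂ρ := by
  have hvar : (ρ.withDensityᵥ h).variation = ρ.withDensity (fun x => ‖h x‖ₑ) :=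
    Measure.variation_withDensityᵥ hh
  set w : α → ℝ≥0∞ := fun x => ‖h x‖ₑ with hw
  have hwm : AEMeasurable w ρ := hh.1.enorm
  have hfin : IsFiniteMeasure (ρ.withDensity w) := ⟨by simpa using! hh.2⟩
  -- the bilinear integrand depends only on the class of `f`
  have hcongr : ∀ f g : α → E, f =ᵐ[ρ.withDensity w] g →
      (fun x => B (f x) (h x)) =ᵐ[ρ] fun x => B (g x) (h x) := by
    intro f g hfg
    have := (ae_withDensity_iff' hwm).1 hfg
    filter_upwards [this] with x hx
    by_cases h0 : h x = 0
    · simp [h0]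
    · rw [hx (by simpa [hw] using h0)]
  have hint : ∀ f : α → E, Integrable f (ρ.withDensity w) →
      Integrable (fun x => B (f x) (h x)) ρ ∧
      ∫ x, ‖B (f x) (h x)‖ ∂ρ ≤ ‖B‖ * ∫ x, ‖f x‖ ∂(ρ.withDensity w) := by
    intro f hf
    have h1 : Integrable (fun x => (w x).toReal • ‖f x‖) ρ :=
      (integrable_withDensity_iff_integrable_smul₀' hwm (by simp [hw])).1 hf.norm
    have h2 : ∫ x, ‖f x‖ ∂(ρ.withDensity w) = ∫ x, (w x).toReal • ‖f x‖ ∂ρ :=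
      integral_withDensity_eq_integral_toReal_smul₀ hwm (by simp [hw]) _
    have hb : ∀ x, ‖B (f x) (h x)‖ ≤ ‖B‖ * ((w x).toReal • ‖f x‖) := by
      intro x
      refine (B.le_opNorm₂ _ _).trans (le_of_eq ?_)
      simp [hw]; ring
    have hm : AEStronglyMeasurable (fun x => B (f x) (h x)) ρ := by
      obtain ⟨g, hg, hfg⟩ := hf.1
      exact AEStronglyMeasurable.congr
        (B.aestronglyMeasurable_comp₂ hg.aestronglyMeasurable hh.1) (hcongr _ _ hfg).symm
    have hi := (h1.const_mul ‖B‖).mono' hm (Eventually.of_forall hb)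
    refine ⟨hi, ?_⟩
    rw [h2, ← integral_const_mul]
    exact integral_mono hi.norm (h1.const_mul _) hb
  have hf' : Integrable f (ρ.withDensity w) := by rwa [← hvar]
  refine ⟨(hint f hf').1, ?_⟩
  -- Both sides agree on constants times indicators, are additive, and are continuous for the L¹
  -- norm of `‖h‖ρ`, which is the variation of the measure.
  have key : ∀ ⦃f : α → E⦄, Integrable f (ρ.withDensity w) →
      VectorMeasure.integral (ρ.withDensityᵥ h) f B = ∫ x, B (f x) (h x) ∂ρ := by
    apply Integrable.induction
    · intro c s hs _
      have : IsFiniteMeasure ((ρ.withDensityᵥ h).variation.restrict s) := by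
        rw [hvar]; infer_instance
      rw [VectorMeasure.integral_indicator hs, VectorMeasure.setIntegral_const,
        withDensityᵥ_apply hh hs, ← ContinuousLinearMap.integral_comp_comm _ hh.integrableOn,
        ← integral_indicator hs]
      congr 1
      ext x
      by_cases hx : x ∈ s <;> simp [hx]
    · intro f g _ hf hg h1 h2
      rw [VectorMeasure.integral_add (by rwa [VectorMeasure.Integrable, hvar])
        (by rwa [VectorMeasure.Integrable, hvar]), h1, h2,
        ← integral_add (hint f hf).1 (hint g hg).1]
      simp
    · have c1 : Continuous fun f : α →₁[ρ.withDensity w] E =>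
          VectorMeasure.integral (ρ.withDensityᵥ h) f B := by
        rw [← hvar]; exact VectorMeasure.continuous_integral
      have c2 : Continuous fun f : α →₁[ρ.withDensity w] E => ∫ x, B (f x) (h x) ∂ρ := by
        refine (LipschitzWith.of_dist_le_mul (K := ‖B‖₊) fun f g => ?_).continuous
        rw [dist_eq_norm, dist_eq_norm, ← integral_sub (hint f (L1.integrable_coeFn f)).1
          (hint g (L1.integrable_coeFn g)).1, L1.norm_eq_integral_norm]
        have e1 : (fun x => B (f x) (h x) - B (g x) (h x)) =ᵐ[ρ]
            fun x => B ((f - g : α →₁[ρ.withDensity w] E) x) (h x) := by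
          refine EventuallyEq.trans ?_ (hcongr _ _ (Lp.coeFn_sub f g).symm)
          exact Eventually.of_forall fun x => by simp
        rw [integral_congr_ae e1]
        exact (norm_integral_le_integral_norm _).trans (hint _ (L1.integrable_coeFn _)).2
      exact isClosed_eq c1 c2
    · intro f g hfg _ h1
      have hfg' : f =ᵐ[(ρ.withDensityᵥ h).variation] g := by rwa [hvar]
      rw [← VectorMeasure.integral_congr_ae hfg', h1, integral_congr_ae (hcongr _ _ hfg)]
  exact key hf'

end IntegralWithDensity

/-! ### The Frobenius pairing through densities -/

section PairingBasics

variable {α : Type*} [MeasurableSpace α] {n m : ℕ}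

lemma abs_pairing_le_integral (μ : MatMeas α n m) (φ : α → Mat n m) :
    |pairing μ φ| ≤ ‖frob n m‖ * ∫ x, ‖φ x‖ ∂μ.variation := by
  rw [← Real.norm_eq_abs]
  exact VectorMeasure.norm_integral_le_integral_norm

lemma abs_pairing_le (μ : MatMeas α n m) {φ : α → Mat n m} {c : ℝ} (h : ∀ x, ‖φ x‖ ≤ c) :
    |pairing μ φ| ≤ c * ‖frob n m‖ * tvNorm μ := by
  rw [← Real.norm_eq_abs]
  exact VectorMeasure.norm_integral_le_of_norm_le_const (Eventually.of_forall h)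

lemma pairing_withDensityᵥ {ρ : Measure α} {h : α → Mat n m} (hh : Integrable h ρ)
    {φ : α → Mat n m} (hφ : (ρ.withDensityᵥ h).Integrable φ) :
    Integrable (fun x => frob n m (φ x) (h x)) ρ ∧
      pairing (ρ.withDensityᵥ h) φ = ∫ x, frob n m (φ x) (h x) ∂ρ :=
  integral_withDensityᵥ _ hh hφ

lemma frob_eq_sum (A B : Mat n m) : frob n m A B = ∑ i, ∑ j, A i j * B i j := by
  rw [frob_apply, Matrix.trace, Finset.sum_comm]
  simp [Matrix.mul_apply]

lemma frob_comm (A B : Mat n m) : frob n m A B = frob n m B A := by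
  simp [frob_eq_sum, mul_comm]

lemma abs_entry_le_norm (A : Mat n m) (i : Fin n) (j : Fin m) : |A i j| ≤ ‖A‖ := by
  rw [Matrix.frobenius_norm_def, ← Real.sqrt_eq_rpow]
  apply Real.le_sqrt_of_sq_le
  simp only [Real.rpow_two]
  refine le_trans ?_ (Finset.single_le_sum (f := fun i => ∑ j, ‖A i j‖ ^ 2)
    (fun _ _ => by positivity) (Finset.mem_univ i))
  refine le_trans ?_ (Finset.single_le_sum (f := fun j => ‖A i j‖ ^ 2)
    (fun _ _ => by positivity) (Finset.mem_univ j))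
  simp

/-- Integrability of a matrix-valued function, entry by entry. -/
lemma integrable_of_entries {ρ : Measure α} {h : α → Mat n m}
    (H : ∀ i j, Integrable (fun x => h x i j) ρ) : Integrable h ρ := by
  have : h = fun x => ∑ i, ∑ j, h x i j • Matrix.single i j (1 : ℝ) := by
    ext x : 1
    conv_lhs => rw [Matrix.matrix_eq_sum_single (h x)]
    simp [Matrix.smul_single]
  rw [this]
  refine integrable_finsetSum _ fun i _ => integrable_finsetSum _ fun j _ => (H i j).smul_const _

lemma integrable_entry {ρ : Measure α} {h : α → Mat n m} (H : Integrable h ρ) (i : Fin n)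
    (j : Fin m) : Integrable (fun x => h x i j) ρ := by
  have :=
    ((Matrix.entryLinearMap ℝ ℝ i j).toContinuousLinearMap : Mat n m →L[ℝ] ℝ).integrable_comp H
  exact this

lemma integrable_density (μ : MatMeas α n m) (ν : Measure α) : Integrable (density μ ν) ν :=
  integrable_of_entries fun _ _ => SignedMeasure.integrable_rnDeriv _ _

lemma withDensityᵥ_density (μ : MatMeas α n m) {ν : Measure α} [IsFiniteMeasure ν]
    (hμ : μ.variation ≪ ν) : ν.withDensityᵥ (density μ ν) = μ := by
  ext s hs i j
  rw [withDensityᵥ_apply (integrable_density μ ν) hs]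
  have hac : entry μ i j ≪ᵥ ν.toENNRealVectorMeasure := by
    refine VectorMeasure.AbsolutelyContinuous.mk fun t ht h0 => ?_
    rw [Measure.toENNRealVectorMeasure_apply_measurable ht] at h0
    have h1 := hμ h0
    have h2 : μ t = 0 := by
      have := VectorMeasure.enorm_measure_le_variation μ t
      rw [h1] at this
      simpa using this
    change (μ t) i j = 0
    simp [h2]
  have h3 := SignedMeasure.withDensityᵥ_rnDeriv_eq (entry μ i j) ν hac
  have h4 : (ν.withDensityᵥ ((entry μ i j).rnDeriv ν)) s = (μ s) i j := by rw [h3]; rfl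
  rw [withDensityᵥ_apply (SignedMeasure.integrable_rnDeriv _ _) hs] at h4
  rw [← h4]
  have := ((Matrix.entryLinearMap ℝ ℝ i j).toContinuousLinearMap :
    Mat n m →L[ℝ] ℝ).integral_comp_comm (integrable_density μ ν).integrableOn (μ := ν.restrict s)
  exact this.symm

/-- The pairing in terms of the density with respect to a dominating measure. -/
lemma pairing_eq_integral_density (μ : MatMeas α n m) {ν : Measure α} [IsFiniteMeasure ν]
    (hμ : μ.variation ≪ ν) {φ : α → Mat n m} (hφ : μ.Integrable φ) :
    Integrable (fun x => frob n m (φ x) (density μ ν x)) ν ∧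
      pairing μ φ = ∫ x, frob n m (φ x) (density μ ν x) ∂ν := by
  have h := withDensityᵥ_density μ hμ
  have := pairing_withDensityᵥ (integrable_density μ ν) (φ := φ) (by rwa [h])
  rwa [h] at this

end PairingBasics

/-! ### Almost everywhere approximation by continuous functions -/

section ContinuousApproximation

variable {α : Type*} [TopologicalSpace α] [NormalSpace α] [MeasurableSpace α] [BorelSpace α]

/-- A bounded measurable function is the almost everywhere limit of continuous functions with the
same bound. -/
theorem exists_continuous_tendsto_ae (μ : Measure α) [IsFiniteMeasure μ] [μ.WeaklyRegular]
    {f : α → ℝ} (hf : AEStronglyMeasurable f μ) {c : ℝ} (hc : ∀ x, |f x| ≤ c) :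
    ∃ φ : ℕ → C(α, ℝ), (∀ k x, |φ k x| ≤ c) ∧
      ∀ᵐ x ∂μ, Tendsto (fun k => φ k x) atTop (𝓝 (f x)) := by
  have hL : MemLp f 1 μ := by
    rw [memLp_one_iff_integrable]
    exact Integrable.of_bound hf c (Eventually.of_forall hc)
  have hex : ∀ k : ℕ, ∃ g : BoundedContinuousFunction α ℝ,
      eLpNorm (f - ⇑g) 1 μ ≤ ((k : ℝ≥0∞) + 1)⁻¹ ∧ MemLp ⇑g 1 μ := fun k =>
    hL.exists_boundedContinuous_eLpNorm_sub_le (by simp) (by simp)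
  choose g hg hgL using hex
  have hlim : Tendsto (fun k => eLpNorm (⇑(g k) - f) 1 μ) atTop (𝓝 0) := by
    refine tendsto_of_tendsto_of_tendsto_of_le_of_le tendsto_const_nhds
      (ENNReal.tendsto_inv_nat_nhds_zero.comp (tendsto_add_atTop_nat 1))
      (fun _ => zero_le) fun k => ?_
    rw [eLpNorm_sub_comm]
    simpa using hg k
  obtain ⟨ns, -, hns⟩ := (tendstoInMeasure_of_tendsto_eLpNorm one_ne_zero
    (fun k => (hgL k).1) hf hlim).exists_seq_tendsto_ae
  -- Truncation to `[-c, c]` supplies the uniform bound that L¹ approximation does not give. It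
  -- leaves the limit unchanged because `|f| ≤ c`.
  have hclamp : Continuous fun y : ℝ => max (-c) (min c y) := by fun_prop
  refine ⟨fun k => ⟨fun x => max (-c) (min c (g (ns k) x)), hclamp.comp (g (ns k)).continuous⟩,
    fun k x => ?_, ?_⟩
  · have h0 : 0 ≤ c := (abs_nonneg _).trans (hc x)
    exact abs_le.2 ⟨le_max_left _ _, max_le (by linarith) (min_le_left _ _)⟩
  · filter_upwards [hns] with x hx
    have h1 := (hclamp.tendsto (f x)).comp hx
    have h2 : max (-c) (min c (f x)) = f x := by
      rw [min_eq_right (abs_le.1 (hc x)).2, max_eq_right (abs_le.1 (hc x)).1]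
    rwa [h2] at h1

end ContinuousApproximation

/-! ### Total variation by duality and by the trace -/

section Duality

variable {α : Type*} [MeasurableSpace α] {n m : ℕ}

lemma continuous_of_entries {β : Type*} [TopologicalSpace β] {f : β → Mat n m}
    (h : ∀ i j, Continuous fun x => f x i j) : Continuous f :=
  continuous_matrix h

lemma frob_single_left (A : Mat n m) (i : Fin n) (j : Fin m) (c : ℝ) :
    frob n m (Matrix.single i j c) A = c * A i j := by
  simp [frob_eq_sum, Matrix.single_apply, ite_and]

lemma norm_single_le (i : Fin n) (j : Fin m) (c : ℝ) :
    ‖(Matrix.single i j c : Mat n m)‖ ≤ |c| := by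
  refine (norm_le_sum_entries _).trans (le_of_eq ?_)
  simp [Matrix.single_apply, ite_and, apply_ite]

lemma tvNorm_nonneg (μ : MatMeas α n m) : 0 ≤ tvNorm μ := ENNReal.toReal_nonneg

/-- The total variation norm is controlled by the pairings with continuous functions. -/
theorem tvNorm_le_of_pairing_le [TopologicalSpace α] [CompactSpace α]
    [TopologicalSpace.MetrizableSpace α]
    [BorelSpace α] (μ : MatMeas α n m) {b : ℝ}
    (hb : ∀ φ : C(α, Mat n m), (∀ x, ‖φ x‖ ≤ 1) → pairing μ φ ≤ b) :
    tvNorm μ ≤ n * m * b := by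
  let _ := TopologicalSpace.metrizableSpaceMetric α
  set ν := μ.variation with hν
  set h := density μ ν with hh
  have hint : Integrable h ν := integrable_density μ ν
  have hden : ν.withDensityᵥ h = μ := withDensityᵥ_density μ Measure.AbsolutelyContinuous.rfl
  have htv : tvNorm μ = ∫ x, ‖h x‖ ∂ν := by
    have h1 := Measure.variation_withDensityᵥ hint
    rw [hden] at h1
    rw [tvNorm, h1, withDensity_apply _ MeasurableSet.univ, Measure.restrict_univ,
      integral_norm_eq_lintegral_enorm hint.1]
  -- The optimal test function for one entry is its sign, placed in that entry. It is discontinuous,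
  -- so it is replaced by continuous functions with values in `[-1, 1]` that converge to it almost
  -- everywhere. Treating the entries one by one costs the factor `n * m`.
  have hentry : ∀ i j, ∫ x, |h x i j| ∂ν ≤ b := by
    intro i j
    have hij : Integrable (fun x => h x i j) ν := integrable_entry hint i j
    obtain ⟨f, hf⟩ : ∃ f : α → ℝ, f = fun x => (SignType.sign (h x i j) : ℝ) := ⟨_, rfl⟩
    have hfm : AEStronglyMeasurable f ν := by
      rw [hf]
      have : Measurable fun y : ℝ => (SignType.sign y : ℝ) := by
        have : (fun y : ℝ => (SignType.sign y : ℝ)) = fun y =>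
            if 0 < y then 1 else if y < 0 then -1 else 0 := by
          ext y
          rcases lt_trichotomy y 0 with hy | hy | hy
          · simp [hy, hy.not_gt]
          · simp [hy]
          · simp [hy]
        rw [this]
        exact Measurable.ite measurableSet_Ioi measurable_const
          (Measurable.ite measurableSet_Iio measurable_const measurable_const)
      exact (this.comp_aemeasurable hij.1.aemeasurable).aestronglyMeasurable
    obtain ⟨φ, hφ, hlim⟩ := exists_continuous_tendsto_ae ν hfm (c := 1) (fun x => by
      rw [hf]
      rcases lt_trichotomy (h x i j) 0 with hy | hy | hy <;> simp [hy])
    have hT : Tendsto (fun k => ∫ x, φ k x * h x i j ∂ν) atTop (𝓝 (∫ x, |h x i j| ∂ν)) := by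
      refine tendsto_integral_of_dominated_convergence (fun x => |h x i j|) (fun k => ?_)
        hij.abs (fun k => Eventually.of_forall fun x => ?_) ?_
      · exact (φ k).continuous.aestronglyMeasurable.mul hij.1
      · rw [Real.norm_eq_abs, abs_mul]
        exact mul_le_of_le_one_left (abs_nonneg _) (hφ k x)
      · filter_upwards [hlim] with x hx
        have := hx.mul_const (h x i j)
        simpa only [hf, sign_mul_self] using this
    refine le_of_tendsto hT (Eventually.of_forall fun k => ?_)
    have hcont : Continuous fun x => (Matrix.single i j (φ k x) : Mat n m) := by
      refine continuous_of_entries fun a c => ?_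
      simp only [Matrix.single_apply]
      split_ifs
      · exact (φ k).continuous
      · exact continuous_const
    have h1 := hb ⟨_, hcont⟩ (fun x => (norm_single_le i j _).trans (hφ k x))
    have h2 := (pairing_eq_integral_density μ (ν := ν) Measure.AbsolutelyContinuous.rfl
      (integrable_continuous μ ⟨_, hcont⟩)).2
    rw [h2] at h1
    simpa only [ContinuousMap.coe_mk, frob_single_left] using h1
  rw [htv]
  calc ∫ x, ‖h x‖ ∂ν ≤ ∫ x, ∑ i, ∑ j, |h x i j| ∂ν := by
        refine integral_mono hint.norm ?_ fun x => norm_le_sum_entries _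
        exact integrable_finsetSum _ fun i _ => integrable_finsetSum _ fun j _ =>
          (integrable_entry hint i j).abs
    _ = ∑ i, ∑ j, ∫ x, |h x i j| ∂ν := by
        rw [integral_finsetSum _ fun i _ => integrable_finsetSum _ fun j _ =>
          (integrable_entry hint i j).abs]
        exact Finset.sum_congr rfl fun i _ => integral_finsetSum _ fun j _ =>
          (integrable_entry hint i j).abs
    _ ≤ ∑ i : Fin n, ∑ j : Fin m, b :=
        Finset.sum_le_sum fun i _ => Finset.sum_le_sum fun j _ => hentry i j
    _ = n * m * b := by simp; ring

lemma pairing_const (μ : MatMeas α n m) (A : Mat n m) :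
    pairing μ (fun _ => A) = frob n m A (μ univ) :=
  VectorMeasure.integral_const A

/-- The `2 × 2` principal minors give `A i j ^ 2 ≤ A i i * A j j`, and the right-hand sides sum to
the square of the trace. -/
lemma norm_le_trace_of_posSemidef {A : Mat n n} (hA : A.PosSemidef) : ‖A‖ ≤ A.trace := by
  have h0 : 0 ≤ A.trace := hA.trace_nonneg
  rw [Matrix.frobenius_norm_def, ← Real.sqrt_eq_rpow]
  apply Real.sqrt_le_iff.2 ⟨h0, ?_⟩
  have hd : ∀ i, 0 ≤ A i i := fun i => hA.diag_nonneg
  have hij : ∀ i j, ‖A i j‖ ^ (2 : ℝ) ≤ A i i * A j j := by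
    intro i j
    have h1 := (hA.submatrix ![i, j]).det_nonneg
    have h2 : A j i = A i j := by simpa using hA.isHermitian.apply i j
    rw [Matrix.det_fin_two] at h1
    simp only [Matrix.submatrix_apply, Matrix.cons_val_zero, Matrix.cons_val_one, h2] at h1
    rw [Real.rpow_two, Real.norm_eq_abs, sq_abs, sq]
    linarith
  calc ∑ i, ∑ j, ‖A i j‖ ^ (2 : ℝ) ≤ ∑ i, ∑ j, A i i * A j j :=
        Finset.sum_le_sum fun i _ => Finset.sum_le_sum fun j _ => hij i j
    _ = A.trace ^ 2 := by
        rw [Matrix.trace, sq, Finset.sum_mul_sum]; rfl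

/-- For a positive semidefinite measure, the total variation is at most the total trace. -/
theorem tvNorm_le_trace {μ : MatMeas α n n} (hμ : PSDValued μ) :
    tvNorm μ ≤ pairing μ fun _ => 1 := by
  have h1 : pairing μ (fun _ => (1 : Mat n n)) = (μ univ).trace := by
    rw [pairing_const, frob_apply]; simp
  rw [h1]
  have h0 : 0 ≤ (μ univ).trace := (hμ _ MeasurableSet.univ).trace_nonneg
  apply ENNReal.toReal_le_of_le_ofReal h0
  -- The variation is a supremum over finite disjoint families. On such a family the traces add up,
  -- and what is left over has nonnegative trace.
  refine le_of_forall_lt fun a ha => ?_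
  obtain ⟨P, -, hdisj, hmeas, hlt⟩ :=
    VectorMeasure.exists_lt_sum_of_lt_variation μ MeasurableSet.univ ha
  refine hlt.trans_le ?_
  have hunion : ∑ t ∈ P, μ t = μ (⋃ t ∈ P, t) :=
    (μ.of_biUnion_finset hdisj fun t ht => hmeas t ht).symm
  have hUm : MeasurableSet (⋃ t ∈ P, t) := P.measurableSet_biUnion fun t ht => hmeas t ht
  have hcompl : μ (⋃ t ∈ P, t) + μ (⋃ t ∈ P, t)ᶜ = μ univ := by
    rw [← VectorMeasure.of_union disjoint_compl_right hUm hUm.compl, union_compl_self]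
  calc ∑ t ∈ P, ‖μ t‖ₑ ≤ ∑ t ∈ P, ENNReal.ofReal (μ t).trace := by
        refine Finset.sum_le_sum fun t ht => ?_
        rw [← ofReal_norm]
        exact ENNReal.ofReal_le_ofReal (norm_le_trace_of_posSemidef (hμ t (hmeas t ht)))
    _ = ENNReal.ofReal (∑ t ∈ P, (μ t).trace) :=
        (ENNReal.ofReal_sum_of_nonneg fun t ht => (hμ t (hmeas t ht)).trace_nonneg).symm
    _ ≤ ENNReal.ofReal (μ univ).trace := by
        apply ENNReal.ofReal_le_ofReal
        rw [← Matrix.trace_sum, hunion, ← hcompl, Matrix.trace_add]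
        have := (hμ _ hUm.compl).trace_nonneg
        linarith

end Duality

/-! ### The cost density as a pointwise dual problem -/

section CostDensity

variable {n m k : ℕ}

lemma frob_mul_transpose (u : Mat n m) (X : Mat n n) :
    frob n n (u * uᵀ) X = (uᵀ * X * u).trace := by
  rw [frob_apply, Matrix.transpose_mul, Matrix.transpose_transpose, Matrix.mul_assoc,
    Matrix.trace_mul_comm]

lemma frob_vecMulVec (v : Fin n → ℝ) (y : Fin m → ℝ) (Y : Mat n m) :
    frob n m (Matrix.vecMulVec v y) Y = v ⬝ᵥ Y *ᵥ y := by
  simp only [frob_eq_sum, Matrix.vecMulVec_apply, dotProduct, Matrix.mulVec, Finset.mul_sum]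
  exact Finset.sum_congr rfl fun i _ => Finset.sum_congr rfl fun j _ => by ring

/-- Rank-one matrices `v yᵀ` are the test directions along which the dual problem is explicit: the
quadratic part sees only `v ⬝ᵥ X *ᵥ v`. They detect negative directions of `X` and violations of the
range condition. -/
lemma frob_vecMulVec_mul_transpose (v : Fin n → ℝ) (y : Fin m → ℝ) (X : Mat n n) :
    frob n n (Matrix.vecMulVec v y * (Matrix.vecMulVec v y)ᵀ) X = (y ⬝ᵥ y) * (v ⬝ᵥ X *ᵥ v) := by
  rw [Matrix.transpose_vecMulVec, Matrix.vecMulVec_mul_vecMulVec]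
  rw [Matrix.vecMulVec_smul, map_smul, _root_.smul_apply, frob_vecMulVec, smul_eq_mul]

lemma pinv_eq {X : Mat n n} (h : X.IsHermitian) :
    pinv X = (h.eigenvectorUnitary : Mat n n) * Matrix.diagonal (fun i => (h.eigenvalues i)⁻¹) *
      (h.eigenvectorUnitary : Mat n n)ᵀ := dif_pos h

lemma pinv_transpose {X : Mat n n} (h : X.IsHermitian) : (pinv X)ᵀ = pinv X := by
  rw [pinv_eq h]
  simp [Matrix.transpose_mul, Matrix.mul_assoc]

lemma pinv_mul_self_mul_pinv {X : Mat n n} (h : X.IsHermitian) : pinv X * X * pinv X = pinv X := by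
  set O : Mat n n := (h.eigenvectorUnitary : Mat n n) with hO
  have hOO : Oᵀ * O = 1 := by
    have := Unitary.coe_star_mul_self h.eigenvectorUnitary
    rwa [Matrix.star_eq_conjTranspose, Matrix.conjTranspose_eq_transpose_of_trivial] at this
  have hX : X = O * Matrix.diagonal h.eigenvalues * Oᵀ := by
    conv_lhs => rw [h.spectral_theorem]
    rw [Unitary.conjStarAlgAut_apply]
    simp only [Matrix.star_eq_conjTranspose, Matrix.conjTranspose_eq_transpose_of_trivial]
    rfl
  rw [pinv_eq h, ← hO]
  have hD : Matrix.diagonal (fun i => (h.eigenvalues i)⁻¹) * Matrix.diagonal h.eigenvalues *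
      Matrix.diagonal (fun i => (h.eigenvalues i)⁻¹) =
      Matrix.diagonal (fun i => (h.eigenvalues i)⁻¹) := by
    rw [Matrix.diagonal_mul_diagonal, Matrix.diagonal_mul_diagonal]
    congr 1
    ext i
    by_cases h0 : h.eigenvalues i = 0
    · simp [h0]
    · field_simp
  set D := Matrix.diagonal (fun i => (h.eigenvalues i)⁻¹)
  set E := Matrix.diagonal h.eigenvalues
  calc O * D * Oᵀ * X * (O * D * Oᵀ)
      = O * D * Oᵀ * (O * E * Oᵀ) * (O * D * Oᵀ) := by rw [← hX]
    _ = O * (D * (Oᵀ * O) * E * (Oᵀ * O) * D) * Oᵀ := by simp only [Matrix.mul_assoc]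
    _ = O * D * Oᵀ := by rw [hOO, Matrix.mul_one, Matrix.mul_one, hD]

/-- Adding the bounds for `W = ±c v eᵢᵀ` cancels the linear term and leaves `-c² (v·Xv) ≤ 2K` for
every `c`. If `v·Xv` were negative, the choice `c² = (2K + 1) / (-v·Xv)` would contradict this. -/
lemma posSemidef_of_dual_bound {X Z : Mat n n} (hX : X.IsSymm) {K : ℝ}
    (h : ∀ W : Mat n n, frob n n W Z - frob n n (W * Wᵀ) X / 2 ≤ K) : X.PosSemidef := by
  refine Matrix.PosSemidef.of_dotProduct_mulVec_nonneg
    (by rwa [Matrix.IsHermitian, Matrix.conjTranspose_eq_transpose_of_trivial]) fun v => ?_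
  simp only [star_trivial]
  by_contra! hneg
  obtain ⟨i⟩ : Nonempty (Fin n) := by
    by_contra hne
    rw [not_nonempty_iff] at hne
    simp [dotProduct] at hneg
  set a := v ⬝ᵥ X *ᵥ v
  have hc : ∀ c : ℝ, -(c ^ 2 * a) ≤ 2 * K := by
    intro c
    have h1 := h (c • Matrix.vecMulVec v (Pi.single i 1))
    have h2 := h ((-c) • Matrix.vecMulVec v (Pi.single i 1))
    simp only [Matrix.transpose_smul, Matrix.smul_mul, Matrix.mul_smul, smul_smul, map_smul,
      _root_.smul_apply, frob_vecMulVec_mul_transpose, smul_eq_mul] at h1 h2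
    have h3 : (Pi.single i 1 : Fin n → ℝ) ⬝ᵥ Pi.single i 1 = 1 := by simp
    rw [h3] at h1 h2
    change _ - _ * (1 * a) / 2 ≤ _ at h1
    change _ - _ * (1 * a) / 2 ≤ _ at h2
    nlinarith
  have hK : 0 ≤ K := by simpa using hc 0
  have h4 := hc (Real.sqrt ((2 * K + 1) / (-a)))
  rw [Real.sq_sqrt (div_nonneg (by linarith) (by linarith))] at h4
  have h5 : (2 * K + 1) / (-a) * a = -(2 * K + 1) := by
    have : a ≠ 0 := hneg.ne
    field_simp
  linarith

/-- If `Yy` is not in the range of `X`, some vector `v` annihilates that range but not `Yy`. Along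
multiples of `v yᵀ` the quadratic term vanishes while the linear one is unbounded; the multiple used
below makes it equal to `K + 1`. -/
lemma range_le_of_dual_bound {X : Mat n n} {Y : Mat n m} {K : ℝ}
    (h : ∀ u : Mat n m, frob n m u Y - frob n n (u * uᵀ) X / 2 ≤ K) :
    LinearMap.range Y.mulVecLin ≤ LinearMap.range X.mulVecLin := by
  rintro _ ⟨y, rfl⟩
  by_contra hy
  obtain ⟨f, hf, hle⟩ := Submodule.exists_le_ker_of_notMem hy
  set v : Fin n → ℝ := fun i => f (Pi.single i 1) with hv
  have hfv : ∀ w, f w = v ⬝ᵥ w := by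
    intro w
    conv_lhs => rw [pi_eq_sum_univ' w]
    simp [dotProduct, hv, mul_comm]
  have h0 : v ⬝ᵥ X *ᵥ v = 0 := by
    rw [← hfv]
    exact hle ⟨v, rfl⟩
  have hβ : v ⬝ᵥ Y *ᵥ y ≠ 0 := by
    rw [← hfv]; exact hf
  have hc := h (((K + 1) / (v ⬝ᵥ Y *ᵥ y)) • Matrix.vecMulVec v y)
  simp only [Matrix.transpose_smul, Matrix.smul_mul, Matrix.mul_smul, map_smul,
    _root_.smul_apply, frob_vecMulVec_mul_transpose, h0, frob_vecMulVec,
    smul_eq_mul, mul_zero, zero_div, sub_zero] at hc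
  rw [div_mul_cancel₀ _ hβ] at hc
  linarith

/-- The dual bound on the cost density. -/
theorem costDensity_le_of_dual_bound {X : Mat n n} {Y : Mat n k} {Z : Mat n n} (hX : X.IsSymm)
    {K : ℝ}
    (h : ∀ (u : Mat n k) (W : Mat n n), frob n k u Y + frob n n W Z - frob n n (u * uᵀ) X / 2 -
      frob n n (W * Wᵀ) X / 2 ≤ K) :
    costDensity X Y Z ≤ ENNReal.ofReal K := by
  have hY : ∀ u : Mat n k, frob n k u Y - frob n n (u * uᵀ) X / 2 ≤ K := fun u => by
    simpa using h u 0
  have hZ : ∀ W : Mat n n, frob n n W Z - frob n n (W * Wᵀ) X / 2 ≤ K := fun W => by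
    simpa using h 0 W
  have hpsd := posSemidef_of_dual_bound hX hZ
  rw [costDensity, if_pos ⟨hpsd, range_le_of_dual_bound hY, range_le_of_dual_bound hZ⟩]
  apply ENNReal.ofReal_le_ofReal
  -- The concave quadratic is maximal at `u = X†Y`, `W = X†Z`. There `uuᵀ·X = Y·X†Y` by `X†XX† =
  -- X†`, so half of the linear term survives.
  refine le_trans (le_of_eq ?_) (h (pinv X * Y) (pinv X * Z))
  have hval : ∀ {l : ℕ} (A : Mat n l), frob n n ((pinv X * A) * (pinv X * A)ᵀ) X =
      frob n l A (pinv X * A) := by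
    intro l A
    rw [frob_mul_transpose, Matrix.transpose_mul, pinv_transpose hpsd.isHermitian, frob_apply]
    congr 1
    calc Aᵀ * pinv X * X * (pinv X * A) = Aᵀ * (pinv X * X * pinv X * A) := by
          simp only [Matrix.mul_assoc]
      _ = Aᵀ * (pinv X * A) := by rw [pinv_mul_self_mul_pinv hpsd.isHermitian]
  rw [hval, hval, frob_comm _ Y, frob_comm _ Z]
  ring

end CostDensity

/-! ### From the dual bound to the action -/

section ActionBound

variable {n m k : ℕ}

/-- The integrand of the dual formulation of the action. -/
noncomputable def dualIntegrand (X : Mat n n) (Y : Mat n k) (Z : Mat n n)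
    (p : Mat n k × Mat n n) : ℝ :=
  frob n k p.1 Y + frob n n p.2 Z - frob n n (p.1 * p.1ᵀ) X / 2 - frob n n (p.2 * p.2ᵀ) X / 2

lemma continuous_mul_transpose_self : Continuous fun u : Mat n m => u * uᵀ :=
  Continuous.matrix_mul continuous_id continuous_id.matrix_transpose

lemma norm_mul_transpose_self_le (u : Mat n m) : ‖u * uᵀ‖ ≤ ‖u‖ ^ 2 := by
  rw [sq]
  refine (Matrix.frobenius_norm_mul u uᵀ).trans (le_of_eq ?_)
  rw [Matrix.frobenius_norm_transpose]

lemma continuous_frob : Continuous fun q : Mat n m × Mat n m => frob n m q.1 q.2 :=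
  (frob n m).isBoundedBilinearMap.continuous

lemma continuous_dualIntegrand : Continuous fun a : (Mat n n × Mat n k × Mat n n) ×
    (Mat n k × Mat n n) => dualIntegrand a.1.1 a.1.2.1 a.1.2.2 a.2 := by
  have hc := @continuous_mul_transpose_self n k
  have hc' := @continuous_mul_transpose_self n n
  have h1 := (@continuous_frob n k).comp
    ((by fun_prop : Continuous fun a : (Mat n n × Mat n k × Mat n n) × (Mat n k × Mat n n) =>
      (a.2.1, a.1.2.1)))
  have h2 := (@continuous_frob n n).comp
    ((by fun_prop : Continuous fun a : (Mat n n × Mat n k × Mat n n) × (Mat n k × Mat n n) =>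
      (a.2.2, a.1.2.2)))
  have h3 := (@continuous_frob n n).comp
    ((by fun_prop : Continuous fun a : (Mat n n × Mat n k × Mat n n) × (Mat n k × Mat n n) =>
      (a.2.1 * a.2.1ᵀ, a.1.1)))
  have h4 := (@continuous_frob n n).comp
    ((by fun_prop : Continuous fun a : (Mat n n × Mat n k × Mat n n) × (Mat n k × Mat n n) =>
      (a.2.2 * a.2.2ᵀ, a.1.1)))
  exact ((h1.add h2).sub (h3.div_const 2)).sub (h4.div_const 2)

lemma abs_frob_le (A B : Mat n m) : |frob n m A B| ≤ ‖frob n m‖ * ‖A‖ * ‖B‖ :=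
  (frob n m).le_opNorm₂ A B

lemma abs_dualIntegrand_le (X : Mat n n) (Y : Mat n k) (Z : Mat n n) {p : Mat n k × Mat n n}
    {c : ℝ} (h1 : ‖p.1‖ ≤ c) (h2 : ‖p.2‖ ≤ c) : |dualIntegrand X Y Z p| ≤
      ‖frob n k‖ * c * ‖Y‖ + ‖frob n n‖ * c * ‖Z‖ + ‖frob n n‖ * c ^ 2 * ‖X‖ := by
  have h0 : 0 ≤ c := (norm_nonneg _).trans h1
  have e1 : |frob n k p.1 Y| ≤ ‖frob n k‖ * c * ‖Y‖ := (abs_frob_le _ _).trans (by gcongr)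
  have e2 : |frob n n p.2 Z| ≤ ‖frob n n‖ * c * ‖Z‖ := (abs_frob_le _ _).trans (by gcongr)
  have e3 : |frob n n (p.1 * p.1ᵀ) X| ≤ ‖frob n n‖ * c ^ 2 * ‖X‖ :=
    (abs_frob_le _ _).trans (by
      have := (norm_mul_transpose_self_le p.1).trans (pow_le_pow_left₀ (norm_nonneg _) h1 2)
      gcongr)
  have e4 : |frob n n (p.2 * p.2ᵀ) X| ≤ ‖frob n n‖ * c ^ 2 * ‖X‖ :=
    (abs_frob_le _ _).trans (by
      have := (norm_mul_transpose_self_le p.2).trans (pow_le_pow_left₀ (norm_nonneg _) h2 2)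
      gcongr)
  rw [abs_le] at *
  unfold dualIntegrand
  constructor <;> linarith [e1.1, e1.2, e2.1, e2.2, e3.1, e3.2, e4.1, e4.2]

variable {α : Type*} [MeasurableSpace α]

lemma stronglyMeasurable_of_entries {h : α → Mat n m}
    (H : ∀ i j, Measurable fun x => h x i j) : StronglyMeasurable h := by
  have : h = fun x => ∑ i, ∑ j, h x i j • Matrix.single i j (1 : ℝ) := by
    ext x : 1
    conv_lhs => rw [Matrix.matrix_eq_sum_single (h x)]
    simp [Matrix.smul_single]
  rw [this]
  refine Finset.stronglyMeasurable_fun_sum _ fun i _ =>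
    Finset.stronglyMeasurable_fun_sum _ fun j _ => ?_
  exact (H i j).stronglyMeasurable.smul_const _

lemma stronglyMeasurable_density (μ : MatMeas α n m) (ν : Measure α) :
    StronglyMeasurable (density μ ν) :=
  stronglyMeasurable_of_entries fun _ _ => SignedMeasure.measurable_rnDeriv _ _

/-- This holds at every point, not only almost everywhere, since the entries `(i, j)` and `(j, i)`
are the same signed measure and so have the same chosen density. -/
lemma density_isSymm {μ : MatMeas α n n} (hμ : SymmValued μ) (ν : Measure α) (x : α) :
    (density μ ν x).IsSymm := by
  ext i j
  have : entry μ j i = entry μ i j := by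
    ext s hs
    exact (hμ s hs).apply i j
  simp [density, this]

lemma stronglyMeasurable_dualIntegrand {X : α → Mat n n} {Y : α → Mat n k} {Z : α → Mat n n}
    (hX : StronglyMeasurable X) (hY : StronglyMeasurable Y) (hZ : StronglyMeasurable Z)
    {p : α → Mat n k × Mat n n} (hp : StronglyMeasurable p) :
    StronglyMeasurable fun x => dualIntegrand (X x) (Y x) (Z x) (p x) := by
  have h1 := (hX.prodMk (hY.prodMk hZ)).prodMk hp
  have h2 := continuous_dualIntegrand.comp_stronglyMeasurable h1
  exact h2

lemma continuous_dualIntegrand_right (X : Mat n n) (Y : Mat n k) (Z : Mat n n) :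
    Continuous (dualIntegrand X Y Z) := by
  have h1 : Continuous fun q : Mat n k × Mat n n => ((X, Y, Z), q) := by fun_prop
  have h2 := continuous_dualIntegrand.comp h1
  exact h2

lemma integrable_dualIntegrand_bound {lam : Measure α} {X : α → Mat n n} {Y : α → Mat n k}
    {Z : α → Mat n n} (hX : Integrable X lam) (hY : Integrable Y lam) (hZ : Integrable Z lam)
    (c : ℝ) : Integrable (fun x =>
      ‖frob n k‖ * c * ‖Y x‖ + ‖frob n n‖ * c * ‖Z x‖ + ‖frob n n‖ * c ^ 2 * ‖X x‖) lam :=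
  ((hY.norm.const_mul _).add (hZ.norm.const_mul _)).add (hX.norm.const_mul _)

lemma integrable_dualIntegrand {lam : Measure α} {X : α → Mat n n} {Y : α → Mat n k}
    {Z : α → Mat n n} (hX : Integrable X lam) (hY : Integrable Y lam) (hZ : Integrable Z lam)
    (hXm : StronglyMeasurable X) (hYm : StronglyMeasurable Y) (hZm : StronglyMeasurable Z)
    {p : α → Mat n k × Mat n n} (hp : StronglyMeasurable p) {c : ℝ} (hpc : ∀ x, ‖p x‖ ≤ c) :
    Integrable (fun x => dualIntegrand (X x) (Y x) (Z x) (p x)) lam :=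
  (integrable_dualIntegrand_bound hX hY hZ c).mono'
    (stronglyMeasurable_dualIntegrand hXm hYm hZm hp).aestronglyMeasurable
    (Eventually.of_forall fun x => abs_dualIntegrand_le _ _ _ ((norm_fst_le _).trans (hpc x))
      ((norm_snd_le _).trans (hpc x)))

variable [TopologicalSpace α] [CompactSpace α] [TopologicalSpace.MetrizableSpace α] [BorelSpace α]

/-- A bounded measurable matrix-valued function is an almost everywhere limit of uniformly bounded
continuous functions. -/
lemma exists_continuousMap_tendsto_ae (ν : Measure α) [IsFiniteMeasure ν] {u : α → Mat n m}
    (hu : StronglyMeasurable u) {c : ℝ} (hc : ∀ x, ‖u x‖ ≤ c) :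
    ∃ φ : ℕ → C(α, Mat n m), (∀ l x, ‖φ l x‖ ≤ n * m * c) ∧
      ∀ᵐ x ∂ν, Tendsto (fun l => φ l x) atTop (𝓝 (u x)) := by
  let _ := TopologicalSpace.metrizableSpaceMetric α
  have hent : ∀ i j, ∃ φ : ℕ → C(α, ℝ), (∀ k x, |φ k x| ≤ c) ∧
      ∀ᵐ x ∂ν, Tendsto (fun k => φ k x) atTop (𝓝 (u x i j)) := by
    intro i j
    refine exists_continuous_tendsto_ae ν ?_ fun x => (abs_entry_le_norm _ i j).trans (hc x)
    have hcont : Continuous fun A : Mat n m => A i j := continuous_id.matrix_elem i j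
    exact (hcont.comp_stronglyMeasurable hu).aestronglyMeasurable
  choose φ hφ hlim using hent
  refine ⟨fun l => ⟨fun x => Matrix.of fun i j => φ i j l x,
    continuous_of_entries fun i j => (φ i j l).continuous⟩, fun l x => ?_, ?_⟩
  · refine (norm_le_sum_entries _).trans ?_
    refine (Finset.sum_le_sum fun i _ => Finset.sum_le_sum fun j _ => hφ i j l x).trans
      (le_of_eq ?_)
    simp; ring
  · have : ∀ᵐ x ∂ν, ∀ i j, Tendsto (fun k => φ i j k x) atTop (𝓝 (u x i j)) :=
      ae_all_iff.2 fun i => ae_all_iff.2 fun j => hlim i j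
    filter_upwards [this] with x hx
    exact tendsto_pi_nhds.2 fun i => tendsto_pi_nhds.2 fun j => hx i j

/-- Monotone convergence along the optimal choices among finitely many values of the parameter. -/
theorem lintegral_le_of_parametrized_bound {α P : Type*} [MeasurableSpace α]
    [NormedAddCommGroup P] [TopologicalSpace.SeparableSpace P] {lam : Measure α} {F : α → P → ℝ}
    {g : α → ℝ≥0∞} {L : ℝ} (hF0 : ∀ x, F x 0 = 0) (hcF : ∀ x, Continuous (F x))
    (hmeas : ∀ p : α → P, StronglyMeasurable p → StronglyMeasurable fun x => F x (p x))
    (hbdd : ∀ (p : α → P) (c : ℝ), StronglyMeasurable p → (∀ x, ‖p x‖ ≤ c) →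
      Integrable (fun x => F x (p x)) lam ∧ ∫ x, F x (p x) ∂lam ≤ L)
    (hg : ∀ x K, (∀ p, F x p ≤ K) → g x ≤ ENNReal.ofReal K) :
    ∫⁻ x, g x ∂lam ≤ ENNReal.ofReal L := by
  obtain ⟨dseq, hdense⟩ := TopologicalSpace.exists_dense_seq P
  -- Greedy selection: `U M x` is a best parameter among `0` and the first `M` points of the dense
  -- sequence. It takes finitely many values, hence is bounded, and it is measurable. Starting at
  -- `0` makes the values `F x (U M x)` nonnegative.
  obtain ⟨U, hU0, hUs⟩ : ∃ U : ℕ → α → P, (∀ x, U 0 x = 0) ∧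
      ∀ M x, U (M + 1) x = if F x (U M x) < F x (dseq M) then dseq M else U M x :=
    ⟨fun M x => Nat.rec 0 (fun j r => if F x r < F x (dseq j) then dseq j else r) M,
      fun _ => rfl, fun _ _ => rfl⟩
  have hUm : ∀ M, StronglyMeasurable (U M) := by
    intro M
    induction M with
    | zero =>
      have : U 0 = fun _ => 0 := funext hU0
      rw [this]; exact stronglyMeasurable_const
    | succ M ih =>
      have : U (M + 1) = fun x => if F x (U M x) < F x (dseq M) then dseq M else U M x :=
        funext fun x => hUs M x
      rw [this]
      exact StronglyMeasurable.ite
        (StronglyMeasurable.measurableSet_lt (hmeas _ ih) (hmeas _ stronglyMeasurable_const))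
        stronglyMeasurable_const ih
  have hUb : ∀ M, ∃ c : ℝ, ∀ x, ‖U M x‖ ≤ c := by
    intro M
    induction M with
    | zero => exact ⟨0, fun x => by simp [hU0]⟩
    | succ M ih =>
      obtain ⟨c, hc⟩ := ih
      refine ⟨max c ‖dseq M‖, fun x => ?_⟩
      rw [hUs]
      split_ifs
      · exact le_max_right _ _
      · exact (hc x).trans (le_max_left _ _)
  have hmono : ∀ x, Monotone fun M => F x (U M x) := by
    intro x
    refine monotone_nat_of_le_succ fun M => ?_
    rw [hUs]
    split_ifs with hlt
    · exact hlt.le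
    · exact le_rfl
  have hge : ∀ x M, F x (dseq M) ≤ F x (U (M + 1) x) := by
    intro x M
    rw [hUs]
    split_ifs with hlt
    · exact le_rfl
    · exact not_lt.1 hlt
  have hpos : ∀ x M, 0 ≤ F x (U M x) := by
    intro x M
    refine le_trans (le_of_eq ?_) (hmono x (Nat.zero_le M))
    simp [hU0, hF0]
  -- When the supremum is finite it bounds `F x` on the dense sequence, hence everywhere by
  -- continuity, and then it bounds `g x` by hypothesis.
  have hcost : ∀ x, g x ≤ ⨆ M, ENNReal.ofReal (F x (U M x)) := by
    intro x
    by_cases htop : (⨆ M, ENNReal.ofReal (F x (U M x))) = ⊤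
    · rw [htop]; exact le_top
    · rw [← ENNReal.ofReal_toReal htop]
      apply hg
      have hcl : IsClosed {q | F x q ≤ (⨆ M, ENNReal.ofReal (F x (U M x))).toReal} :=
        isClosed_le (hcF x) continuous_const
      have hsub : range dseq ⊆ {q | F x q ≤ (⨆ M, ENNReal.ofReal (F x (U M x))).toReal} := by
        rintro _ ⟨M, rfl⟩
        refine (hge x M).trans ((ENNReal.ofReal_le_iff_le_toReal htop).1 ?_)
        exact le_iSup (fun M => ENNReal.ofReal (F x (U M x))) (M + 1)
      intro q
      have := hcl.closure_subset_iff.2 hsub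
      rw [hdense.closure_range] at this
      exact this (mem_univ q)
  calc ∫⁻ x, g x ∂lam ≤ ∫⁻ x, ⨆ M, ENNReal.ofReal (F x (U M x)) ∂lam := lintegral_mono hcost
    _ = ⨆ M, ∫⁻ x, ENNReal.ofReal (F x (U M x)) ∂lam :=
        lintegral_iSup (fun M => (hmeas _ (hUm M)).measurable.ennreal_ofReal)
          fun M M' hM x => ENNReal.ofReal_le_ofReal (hmono x hM)
    _ ≤ ENNReal.ofReal L := by
        refine iSup_le fun M => ?_
        obtain ⟨c, hc⟩ := hUb M
        have := hbdd (U M) c (hUm M) hc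
        rw [← ofReal_integral_eq_lintegral_ofReal this.1 (Eventually.of_forall fun x => hpos x M)]
        exact ENNReal.ofReal_le_ofReal this.2

/-- Bounds on the dual integrand extend from continuous to bounded measurable test functions. -/
lemma integral_dualIntegrand_le {lam : Measure α} [IsFiniteMeasure lam] {X : α → Mat n n}
    {Y : α → Mat n k} {Z : α → Mat n n} (hX : Integrable X lam) (hY : Integrable Y lam)
    (hZ : Integrable Z lam) (hXm : StronglyMeasurable X) (hYm : StronglyMeasurable Y)
    (hZm : StronglyMeasurable Z) {L : ℝ}
    (hcont : ∀ (u : C(α, Mat n k)) (W : C(α, Mat n n)),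
      ∫ x, dualIntegrand (X x) (Y x) (Z x) (u x, W x) ∂lam ≤ L)
    {p : α → Mat n k × Mat n n} (hp : StronglyMeasurable p) {c : ℝ} (hpc : ∀ x, ‖p x‖ ≤ c) :
    ∫ x, dualIntegrand (X x) (Y x) (Z x) (p x) ∂lam ≤ L := by
  have hp1 : ∀ x, ‖(p x).1‖ ≤ c := fun x => (norm_fst_le _).trans (hpc x)
  have hp2 : ∀ x, ‖(p x).2‖ ≤ c := fun x => (norm_snd_le _).trans (hpc x)
  obtain ⟨φ, hφ, hφl⟩ := exists_continuousMap_tendsto_ae lam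
    (continuous_fst.comp_stronglyMeasurable hp) hp1
  obtain ⟨ψ, hψ, hψl⟩ := exists_continuousMap_tendsto_ae lam
    (continuous_snd.comp_stronglyMeasurable hp) hp2
  obtain ⟨c', hc1, hc2⟩ : ∃ c' : ℝ, n * k * c ≤ c' ∧ n * n * c ≤ c' :=
    ⟨_, le_max_left _ _, le_max_right _ _⟩
  have hsm : ∀ l, StronglyMeasurable fun x => (φ l x, ψ l x) := fun l =>
    ((φ l).continuous.stronglyMeasurable_of_hasCompactSupport
      (HasCompactSupport.of_compactSpace _)).prodMk
      ((ψ l).continuous.stronglyMeasurable_of_hasCompactSupport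
      (HasCompactSupport.of_compactSpace _))
  have hT : Tendsto (fun l => ∫ x, dualIntegrand (X x) (Y x) (Z x) (φ l x, ψ l x) ∂lam) atTop
      (𝓝 (∫ x, dualIntegrand (X x) (Y x) (Z x) (p x) ∂lam)) := by
    refine tendsto_integral_of_dominated_convergence _
      (fun l => (stronglyMeasurable_dualIntegrand hXm hYm hZm (hsm l)).aestronglyMeasurable)
      (integrable_dualIntegrand_bound hX hY hZ c')
      (fun l => Eventually.of_forall fun x => abs_dualIntegrand_le _ _ _
        ((hφ l x).trans hc1) ((hψ l x).trans hc2)) ?_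
    filter_upwards [hφl, hψl] with x hx1 hx2
    exact ((continuous_dualIntegrand_right (X x) (Y x) (Z x)).tendsto (p x)).comp
      (hx1.prodMk_nhds hx2)
  exact le_of_tendsto hT (Eventually.of_forall fun l => hcont (φ l) (ψ l))

/-- The action is bounded by the supremum of the dual problem over continuous functions. -/
theorem TripleMeas.action_le_of_dual_bound (ν : TripleMeas α n k) (hsymm : SymmValued ν.G) {L : ℝ}
    (h : ∀ (u : C(α, Mat n k)) (W : C(α, Mat n n)), pairing ν.q u + pairing ν.R W -
      pairing ν.G (fun x => u x * (u x)ᵀ) / 2 - pairing ν.G (fun x => W x * (W x)ᵀ) / 2 ≤ L) :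
    ν.action ≤ ENNReal.ofReal L := by
  obtain ⟨lam, hlam⟩ : ∃ lam, lam = ν.G.variation + ν.q.variation + ν.R.variation := ⟨_, rfl⟩
  have : IsFiniteMeasure lam := by rw [hlam]; infer_instance
  have acG : ν.G.variation ≪ lam := hlam ▸ Measure.absolutelyContinuous_of_le
    ((Measure.le_add_right le_rfl).trans (Measure.le_add_right le_rfl))
  have acq : ν.q.variation ≪ lam := hlam ▸ Measure.absolutelyContinuous_of_le
    ((Measure.le_add_left le_rfl).trans (Measure.le_add_right le_rfl))
  have acR : ν.R.variation ≪ lam := hlam ▸ Measure.absolutelyContinuous_of_le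
    (Measure.le_add_left le_rfl)
  have hX : Integrable (density ν.G lam) lam := integrable_density _ _
  have hY : Integrable (density ν.q lam) lam := integrable_density _ _
  have hZ : Integrable (density ν.R lam) lam := integrable_density _ _
  have hXm : StronglyMeasurable (density ν.G lam) := stronglyMeasurable_density _ _
  have hYm : StronglyMeasurable (density ν.q lam) := stronglyMeasurable_density _ _
  have hZm : StronglyMeasurable (density ν.R lam) := stronglyMeasurable_density _ _
  -- Over the common reference measure `lam` the four pairings become one integral of a pointwise
  -- expression, which can then be maximized point by point.
  have hcont : ∀ (u : C(α, Mat n k)) (W : C(α, Mat n n)), ∫ x, dualIntegrand (density ν.G lam x)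
      (density ν.q lam x) (density ν.R lam x) (u x, W x) ∂lam ≤ L := by
    intro u W
    have h1 := pairing_eq_integral_density ν.q acq (integrable_continuous ν.q u)
    have h2 := pairing_eq_integral_density ν.R acR (integrable_continuous ν.R W)
    have h3 := pairing_eq_integral_density ν.G acG (integrable_continuous ν.G
      ⟨fun x => u x * (u x)ᵀ, continuous_mul_transpose_self.comp u.continuous⟩)
    have h4 := pairing_eq_integral_density ν.G acG (integrable_continuous ν.G
      ⟨fun x => W x * (W x)ᵀ, continuous_mul_transpose_self.comp W.continuous⟩)
    refine le_trans (le_of_eq ?_) (h u W)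
    simp only [ContinuousMap.coe_mk] at h3 h4
    have e3 := h3.1.div_const 2
    have e4 := h4.1.div_const 2
    have s1 := h1.1.add h2.1
    have s2 := s1.sub e3
    rw [h1.2, h2.2, h3.2, h4.2, ← integral_div, ← integral_div, ← integral_add' h1.1 h2.1,
      ← integral_sub' s1 e3, ← integral_sub' s2 e4]
    rfl
  have hact : ν.action = ∫⁻ x, costDensity (density ν.G lam x) (density ν.q lam x)
      (density ν.R lam x) ∂lam := by rw [hlam]; rfl
  rw [hact]
  refine lintegral_le_of_parametrized_bound
    (F := fun x => dualIntegrand (density ν.G lam x) (density ν.q lam x) (density ν.R lam x))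
    (fun x => by simp [dualIntegrand]) (fun x => continuous_dualIntegrand_right _ _ _)
    (fun p hp => stronglyMeasurable_dualIntegrand hXm hYm hZm hp)
    (fun p c hp hpc => ⟨integrable_dualIntegrand hX hY hZ hXm hYm hZm hp hpc,
      integral_dualIntegrand_le hX hY hZ hXm hYm hZm hcont hp hpc⟩) fun x K hK => ?_
  exact costDensity_le_of_dual_bound (density_isSymm hsymm _ x) fun u W => hK (u, W)

end ActionBound

/-! ### Inward directions and density of smooth functions in `C¹` -/

section SmoothFunctions

open scoped Manifold Convolution

section InwardCone

variable {E : Type*} [NormedAddCommGroup E] [NormedSpace ℝ E]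

/-- The vector `v` points strictly into `K` near `x`. -/
def InwardAt (K : Set E) (x v : E) : Prop :=
  ∃ r > 0, ∀ y ∈ K, dist y x < r → ∀ w, dist w v < r → ∀ s : ℝ, 0 < s → s < r → y + s • w ∈ K

lemma InwardAt.eventually {K : Set E} {x v : E} (h : InwardAt K x v) :
    ∀ᶠ y in 𝓝 x, InwardAt K y v := by
  obtain ⟨r, hr, h⟩ := h
  filter_upwards [Metric.ball_mem_nhds x (half_pos hr)] with y hy
  refine ⟨r / 2, half_pos hr, fun z hz hzy w hw s hs hsr => h z hz ?_ w (by linarith) s hs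
    (by linarith)⟩
  have := dist_triangle z y x
  rw [Metric.mem_ball] at hy
  linarith

/-- A small move along `a v + b w` is a move along `v` followed by one along `w`. The uniformity in
the base point, built into `InwardAt`, is what allows the second move to start from the displaced
point. -/
lemma convex_setOf_inwardAt (K : Set E) (x : E) : Convex ℝ {v | InwardAt K x v} := by
  rw [convex_iff_forall_pos]
  rintro v ⟨r, hr, hv⟩ w ⟨r', hr', hw⟩ a b ha hb hab
  -- After the first move the point is within `ρ * (‖v‖ + ρ) + ρ` of `x`; this has to stay below
  -- `r'` for the second move.
  obtain ⟨ρ, hρ, hρr, hρr', hρ1⟩ : ∃ ρ > 0, ρ ≤ r ∧ ρ ≤ r' ∧ ρ * (1 + ‖v‖ + ρ) < r' := by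
    have hlim : Tendsto (fun ρ : ℝ => ρ * (1 + ‖v‖ + ρ)) (𝓝[>] 0) (𝓝 0) := by
      have : Tendsto (fun ρ : ℝ => ρ * (1 + ‖v‖ + ρ)) (𝓝 0) (𝓝 (0 * (1 + ‖v‖ + 0))) :=
        (by fun_prop : Continuous fun ρ : ℝ => ρ * (1 + ‖v‖ + ρ)).tendsto 0
      rw [zero_mul] at this
      exact this.mono_left nhdsWithin_le_nhds
    have h1 : ∀ᶠ ρ : ℝ in 𝓝[>] 0, ρ < min r r' :=
      (eventually_lt_nhds (lt_min hr hr')).filter_mono nhdsWithin_le_nhds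
    obtain ⟨ρ, h2, h3, h4⟩ := ((hlim.eventually (gt_mem_nhds hr')).and
      (h1.and self_mem_nhdsWithin)).exists
    exact ⟨ρ, h4, h3.le.trans (min_le_left _ _), h3.le.trans (min_le_right _ _), h2⟩
  refine ⟨ρ, hρ, fun y hy hyx z hz s hs hsρ => ?_⟩
  set e := z - (a • v + b • w) with he
  have hen : ‖e‖ < ρ := by rwa [he, ← dist_eq_norm]
  -- Since `a + b = 1`, the perturbation `e` can be added to both directions without being rescaled.
  have hz' : y + s • z = (y + (s * a) • (v + e)) + (s * b) • (w + e) := by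
    have : z = a • (v + e) + b • (w + e) := by
      have h3 : a • e + b • e = e := by rw [← add_smul, hab, one_smul]
      calc z = (a • v + b • w) + e := by rw [he]; abel
        _ = (a • v + b • w) + (a • e + b • e) := by rw [h3]
        _ = _ := by rw [smul_add, smul_add]; abel
    conv_lhs => rw [this]
    rw [smul_add, smul_smul, smul_smul, add_assoc]
  have ha1 : a < 1 := by linarith
  have hb1 : b < 1 := by linarith
  have hsa : s * a < s := mul_lt_of_lt_one_right hs ha1
  have hsb : s * b < s := mul_lt_of_lt_one_right hs hb1
  rw [hz']
  refine hw _ (hv y hy (by linarith) _ (by simp [dist_eq_norm]; linarith) _ (by positivity)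
    (by linarith)) ?_ _ (by simp [dist_eq_norm]; linarith) _ (by positivity) (by linarith)
  calc dist (y + (s * a) • (v + e)) x ≤ dist (y + (s * a) • (v + e)) y + dist y x :=
        dist_triangle _ _ _
    _ < ρ * (‖v‖ + ρ) + ρ := by
        refine add_lt_add_of_le_of_lt ?_ hyx
        rw [dist_eq_norm, add_sub_cancel_left, norm_smul, Real.norm_of_nonneg (by positivity)]
        gcongr
        · linarith
        · exact (norm_add_le _ _).trans (by linarith)
    _ < r' := by linarith

/-- A set with an inward direction at each of its points has unique derivatives. -/
lemma uniqueDiffOn_of_inwardAt {K : Set E} (h : ∀ x ∈ K, ∃ v, InwardAt K x v) :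
    UniqueDiffOn ℝ K := by
  intro x hx
  obtain ⟨v, r, hr, hv⟩ := h x hx
  refine ⟨?_, subset_closure hx⟩
  have hmem : ∀ w, dist w v < r → w ∈ tangentConeAt ℝ K x := by
    intro w hw
    have hl : Tendsto (fun s : ℝ => s) (𝓝[>] 0) (𝓝[≠] 0) :=
      tendsto_id'.2 (nhdsWithin_mono _ fun s hs => ne_of_gt hs)
    refine mem_tangentConeAt_of_add_smul_mem hl ?_
    filter_upwards [Ioo_mem_nhdsGT hr] with s hs
    exact hv x hx (by simpa using hr) w hw s hs.1 hs.2
  -- The tangent cone contains a ball around `v`, and differences of points of a ball span the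
  -- space.
  have htop : Submodule.span ℝ (tangentConeAt ℝ K x) = ⊤ := by
    rw [eq_top_iff]
    intro z _
    have hv0 : v ∈ Submodule.span ℝ (tangentConeAt ℝ K x) :=
      Submodule.subset_span (hmem v (by simpa using hr))
    obtain ⟨c, hc, hcz⟩ : ∃ c : ℝ, 0 < c ∧ c * ‖z‖ < r := by
      refine ⟨r / (2 * (‖z‖ + 1)), by positivity, ?_⟩
      rw [div_mul_eq_mul_div, div_lt_iff₀ (by positivity)]
      nlinarith [norm_nonneg z]
    have hvz : v + c • z ∈ Submodule.span ℝ (tangentConeAt ℝ K x) :=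
      Submodule.subset_span (hmem _ (by simpa [dist_eq_norm, norm_smul, abs_of_pos hc] using hcz))
    have h1 : c • z ∈ Submodule.span ℝ (tangentConeAt ℝ K x) := by
      simpa using Submodule.sub_mem _ hvz hv0
    have h2 := Submodule.smul_mem _ c⁻¹ h1
    rwa [smul_smul, inv_mul_cancel₀ hc.ne', one_smul] at h2
  rw [htop]
  exact dense_univ

lemma InwardAt.prod {F : Type*} [NormedAddCommGroup F] [NormedSpace ℝ F] {K : Set E} {L : Set F}
    {x v : E} {y w : F} (h : InwardAt K x v) (h' : InwardAt L y w) :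
    InwardAt (K ×ˢ L) (x, y) (v, w) := by
  obtain ⟨r, hr, h⟩ := h
  obtain ⟨r', hr', h'⟩ := h'
  refine ⟨min r r', lt_min hr hr', fun z hz hzx u hu s hs hsr => ?_⟩
  rw [Prod.dist_eq, max_lt_iff] at hzx hu
  rw [lt_min_iff] at hsr
  exact ⟨h _ hz.1 (hzx.1.trans_le (min_le_left _ _)) _ (hu.1.trans_le (min_le_left _ _)) _ hs
    hsr.1, h' _ hz.2 (hzx.2.trans_le (min_le_right _ _)) _ (hu.2.trans_le (min_le_right _ _)) _ hs
    hsr.2⟩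

/-- The direction `1/2 - t` points to the midpoint. With tolerance `1/4` in both `y` and `w`, the
point `y + w` is within `1/2` of the midpoint, hence in the interval, and `y + s w` is a convex
combination of `y` and `y + w`. -/
lemma exists_inwardAt_Icc (t : ℝ) : ∃ v, InwardAt (Icc (0 : ℝ) 1) t v := by
  refine ⟨1 / 2 - t, 1 / 4, by norm_num, fun y hy hyt w hw s hs hsr => ?_⟩
  rw [Real.dist_eq, abs_lt] at hyt hw
  obtain ⟨h0, h1⟩ := hy
  have e : y + s • w = (1 - s) * y + s * (y + w) := by simp only [smul_eq_mul]; ring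
  have hw0 : 0 ≤ y + w := by linarith
  have hw1 : y + w ≤ 1 := by linarith
  rw [e]
  constructor
  · have : 0 ≤ 1 - s := by linarith
    positivity
  · nlinarith

lemma exists_inwardAt_of_notMem {K : Set E} (hK : IsClosed K) {x : E} (hx : x ∉ K) (v : E) :
    InwardAt K x v := by
  obtain ⟨r, hr, hball⟩ := Metric.isOpen_iff.1 hK.isOpen_compl x hx
  exact ⟨r, hr, fun y hy hyx => absurd hy (hball (Metric.mem_ball.2 hyx))⟩

/-- Smooth sublevel sets have inward directions. -/
lemma exists_inwardAt_of_hasSmoothBoundary {d : ℕ} {Ω : Set (Eu d)} (hcl : IsClosed Ω)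
    (h : HasSmoothBoundary Ω) (x : Eu d) : ∃ v, InwardAt Ω x v := by
  by_cases hx : x ∈ Ω
  swap
  · exact ⟨0, exists_inwardAt_of_notMem hcl hx 0⟩
  by_cases hint : x ∈ interior Ω
  · refine ⟨0, ?_⟩
    obtain ⟨r, hr, hball⟩ := Metric.isOpen_iff.1 isOpen_interior x hint
    refine ⟨min (r / 2) 1, by positivity, fun y hy hyx w hw s hs hsr => ?_⟩
    rw [lt_min_iff] at hyx hw hsr
    refine interior_subset (hball ?_)
    rw [Metric.mem_ball]
    rw [dist_zero_right] at hw
    calc dist (y + s • w) x ≤ dist (y + s • w) y + dist y x := dist_triangle _ _ _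
      _ < r / 2 + r / 2 := by
          refine add_lt_add_of_le_of_lt ?_ hyx.1
          rw [dist_eq_norm, add_sub_cancel_left, norm_smul, Real.norm_of_nonneg hs.le]
          nlinarith [norm_nonneg w]
      _ = r := by ring
  -- At a boundary point a direction along which `g` strictly decreases is inward. Strict
  -- differentiability is used because the increment of `g` must be controlled between two points
  -- near `x`, not from `x` itself.
  obtain ⟨U, hU, hxU, g, hg, hdg, hΩ⟩ := h x ⟨subset_closure hx, hint⟩
  have hgx : ContDiffAt ℝ 1 g x := (hg.contDiffAt (hU.mem_nhds hxU)).of_le (by simp)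
  have hstrict : HasStrictFDerivAt g (fderiv ℝ g x) x := hgx.hasStrictFDerivAt (by simp)
  obtain ⟨v, hv⟩ : ∃ v, fderiv ℝ g x v < 0 := by
    obtain ⟨v, hv⟩ : ∃ v, fderiv ℝ g x v ≠ 0 := by
      by_contra! hne
      exact hdg x hxU (ContinuousLinearMap.ext hne)
    rcases lt_or_gt_of_ne hv with h1 | h1
    · exact ⟨v, h1⟩
    · exact ⟨-v, by simpa using h1⟩
  refine ⟨v, ?_⟩
  set A := fderiv ℝ g x with hA
  set δ := -A v with hδ
  have hδ0 : 0 < δ := by simp [hδ, hv]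
  -- As `‖w‖ < ‖v‖ + 1`, this makes the linearization error at most `s δ / 4`. The choice of `r`
  -- below gives `A (w - v) ≤ δ / 4`, so `g` decreases by at least `s δ / 2`.
  set c := δ / (4 * (‖v‖ + 1)) with hc
  have hc0 : 0 < c := by positivity
  have hev := (hstrict.isLittleO.bound hc0)
  rw [Metric.eventually_nhds_iff] at hev
  obtain ⟨r₁, hr₁, hb⟩ := hev
  obtain ⟨r₂, hr₂, hball⟩ := Metric.isOpen_iff.1 hU x hxU
  set r₀ := min r₁ r₂ with hr₀
  have hr₀p : 0 < r₀ := lt_min hr₁ hr₂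
  set r := min (r₀ / (2 * (‖v‖ + 2))) (min 1 (δ / (4 * (‖A‖ + 1)))) with hr
  have hrp : 0 < r := by positivity
  have hr1 : r ≤ 1 := (min_le_right _ _).trans (min_le_left _ _)
  have hrA : r * (4 * (‖A‖ + 1)) ≤ δ := by
    rw [← le_div_iff₀ (by positivity)]
    exact (min_le_right _ _).trans (min_le_right _ _)
  have hrr : r * (2 * (‖v‖ + 2)) ≤ r₀ := by
    rw [← le_div_iff₀ (by positivity)]
    exact min_le_left _ _
  refine ⟨r, hrp, fun y hy hyx w hw s hs hsr => ?_⟩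
  have hwn : ‖w‖ < ‖v‖ + 1 := by
    have h1 : ‖w‖ ≤ ‖v‖ + ‖w - v‖ := by
      have := norm_add_le v (w - v); simpa using this
    rw [dist_eq_norm] at hw
    linarith
  have hyr : dist y x < r₀ := by
    refine hyx.trans_le (le_trans ?_ hrr)
    nlinarith [norm_nonneg v]
  have hzr : dist (y + s • w) x < r₀ := by
    calc dist (y + s • w) x ≤ dist (y + s • w) y + dist y x := dist_triangle _ _ _
      _ < r * (‖v‖ + 1) + r := by
          refine add_lt_add_of_le_of_lt ?_ hyx
          rw [dist_eq_norm, add_sub_cancel_left, norm_smul, Real.norm_of_nonneg hs.le]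
          exact mul_le_mul hsr.le hwn.le (norm_nonneg _) hrp.le
      _ ≤ r₀ := by nlinarith [norm_nonneg v]
  have hyU : y ∈ U := hball (hyr.trans_le (min_le_right _ _))
  have hzU : y + s • w ∈ U := hball (hzr.trans_le (min_le_right _ _))
  have hgy : g y ≤ 0 := by
    have : y ∈ Ω ∩ U := ⟨hy, hyU⟩
    rw [hΩ] at this
    exact this.2
  have hest := hb (show dist (y + s • w, y) (x, x) < r₁ by
    rw [Prod.dist_eq, max_lt_iff]
    exact ⟨hzr.trans_le (min_le_left _ _), hyr.trans_le (min_le_left _ _)⟩)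
  simp only [add_sub_cancel_left, map_smul, norm_smul, Real.norm_of_nonneg hs.le,
    smul_eq_mul] at hest
  have hAw : A w ≤ -δ + ‖A‖ * r := by
    have h1 : A w = A v + A (w - v) := by rw [map_sub]; ring
    have h2 : A (w - v) ≤ ‖A‖ * r := by
      refine (le_abs_self _).trans ((A.le_opNorm _).trans ?_)
      rw [dist_eq_norm] at hw
      gcongr
    rw [h1, hδ]; linarith
  have hgz : g (y + s • w) ≤ 0 := by
    have h1 := (le_abs_self _).trans hest
    have h2 : c * (s * ‖w‖) ≤ s * (δ / 4) := by
      have : c * ‖w‖ ≤ δ / 4 := by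
        rw [hc, div_mul_eq_mul_div, div_le_iff₀ (by positivity)]
        nlinarith
      calc c * (s * ‖w‖) = s * (c * ‖w‖) := by ring
        _ ≤ s * (δ / 4) := by gcongr
    have h3 : s * A w ≤ s * (-δ + ‖A‖ * r) := by gcongr
    have h4 : ‖A‖ * r ≤ δ / 4 := by nlinarith [norm_nonneg A]
    have h5 : s * (‖A‖ * r) ≤ s * (δ / 4) := by gcongr
    nlinarith
  have : y + s • w ∈ Ω ∩ U := by rw [hΩ]; exact ⟨hzU, hgz⟩
  exact this.1

variable [FiniteDimensional ℝ E]

/-- A compact set with inward directions can be pushed into its interior along a smooth vector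
field. -/
theorem exists_smooth_inward_field {K : Set E} (hK : IsCompact K)
    (h : ∀ x, ∃ v, InwardAt K x v) :
    ∃ v : E → E, ContDiff ℝ (⊤ : ℕ∞) v ∧ ∃ s₀ > 0, ∀ x ∈ K, ∀ s : ℝ, 0 < s → s < s₀ →
      x + s • v x ∈ interior K := by
  -- A direction inward at `x` is inward at nearby points, and the inward directions at each point
  -- form a convex set, so a partition of unity glues constant local choices.
  obtain ⟨v, hv⟩ := exists_contMDiffMap_forall_mem_convex_of_local_const (n := (⊤ : ℕ∞)) (𝓘(ℝ, E))
    (t := fun x => {v | InwardAt K x v}) (convex_setOf_inwardAt K)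
    (fun x => (h x).imp fun v hv => hv.eventually)
  refine ⟨v, v.contMDiff.contDiff, ?_⟩
  have hvc : Continuous v := v.contMDiff.contDiff.continuous
  refine hK.induction_on (p := fun S => ∃ s₀ > 0, ∀ x ∈ S, ∀ s : ℝ, 0 < s → s < s₀ →
      x + s • v x ∈ interior K) ⟨1, one_pos, by simp⟩ ?_ ?_ ?_
  · rintro S T hST ⟨s₀, hs₀, hT⟩
    exact ⟨s₀, hs₀, fun x hx => hT x (hST hx)⟩
  · rintro S T ⟨s₀, hs₀, hS⟩ ⟨s₁, hs₁, hT⟩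
    refine ⟨min s₀ s₁, lt_min hs₀ hs₁, fun x hx s hs hlt => ?_⟩
    rw [lt_min_iff] at hlt
    exact hx.elim (fun hx => hS x hx s hs hlt.1) (fun hx => hT x hx s hs hlt.2)
  · intro x hx
    obtain ⟨r, hr, hin⟩ := hv x
    have hN : {y | dist y x < r ∧ dist (v y) (v x) < r / 2} ∈ 𝓝 x := by
      have h1 : ∀ᶠ y in 𝓝 x, dist y x < r := Metric.ball_mem_nhds x hr
      have h2 : ∀ᶠ y in 𝓝 x, dist (v y) (v x) < r / 2 :=
        hvc.continuousAt.eventually (Metric.ball_mem_nhds _ (half_pos hr))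
      exact h1.and h2
    refine ⟨K ∩ {y | dist y x < r ∧ dist (v y) (v x) < r / 2}, inter_mem_nhdsWithin _ hN, r, hr,
      ?_⟩
    rintro y ⟨hyK, hyx, hvy⟩ s hs hsr
    rw [mem_interior]
    -- Points of this ball have the form `y + s w` with `w` within `r / 2` of `v y`, hence within
    -- `r` of `v x`.
    refine ⟨Metric.ball (y + s • v y) (s * (r / 2)), fun z hz => ?_, Metric.isOpen_ball,
      Metric.mem_ball_self (by positivity)⟩
    have hz' : z = y + s • (v y + s⁻¹ • (z - (y + s • v y))) := by
      rw [smul_add, smul_smul, mul_inv_cancel₀ hs.ne', one_smul]; abel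
    rw [hz']
    refine hin y hyK hyx _ ?_ s hs hsr
    rw [Metric.mem_ball, dist_eq_norm] at hz
    calc dist (v y + s⁻¹ • (z - (y + s • v y))) (v x)
        ≤ dist (v y + s⁻¹ • (z - (y + s • v y))) (v y) + dist (v y) (v x) := dist_triangle _ _ _
      _ < r / 2 + r / 2 := by
          refine add_lt_add ?_ hvy
          rw [dist_eq_norm, add_sub_cancel_left, norm_smul, norm_inv, Real.norm_of_nonneg hs.le,
            inv_mul_lt_iff₀ hs]
          exact hz
      _ = r := by ring

end InwardCone

/-! ### Pushing inwards and mollifying -/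

section SmoothApproximation

variable {E F : Type*} [NormedAddCommGroup E] [NormedSpace ℝ E] [FiniteDimensional ℝ E]
  [NormedAddCommGroup F] [NormedSpace ℝ F]

/-- Mollification of compactly supported `C¹` functions. -/
lemma exists_smooth_close_of_hasCompactSupport [CompleteSpace F] {g : E → F} (hg : ContDiff ℝ 1 g)
    (hc : HasCompactSupport g) {ε : ℝ} (hε : 0 < ε) :
    ∃ ψ : E → F, ContDiff ℝ (⊤ : ℕ∞) ψ ∧
      ∀ x, ‖ψ x - g x‖ ≤ ε ∧ ‖fderiv ℝ ψ x - fderiv ℝ g x‖ ≤ ε := by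
  borelize E
  let μ : Measure E := Measure.addHaar
  have hdc : Continuous (fderiv ℝ g) := hg.continuous_fderiv one_ne_zero
  have hdcs : HasCompactSupport (fderiv ℝ g) := hc.fderiv ℝ
  obtain ⟨δ₁, hδ₁, h1⟩ := Metric.uniformContinuous_iff.1
    (hg.continuous.uniformContinuous_of_tendsto_cocompact hc.is_zero_at_infty) ε hε
  obtain ⟨δ₂, hδ₂, h2⟩ := Metric.uniformContinuous_iff.1
    (hdc.uniformContinuous_of_tendsto_cocompact hdcs.is_zero_at_infty) ε hε
  obtain ⟨δ, hδ, hδ1, hδ2⟩ : ∃ δ > 0, δ ≤ δ₁ ∧ δ ≤ δ₂ :=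
    ⟨min δ₁ δ₂, lt_min hδ₁ hδ₂, min_le_left _ _, min_le_right _ _⟩
  let b : ContDiffBump (0 : E) := ⟨δ / 2, δ, half_pos hδ, half_lt_self hδ⟩
  have hbl : LocallyIntegrable (b.normed μ) μ := b.continuous_normed.locallyIntegrable
  refine ⟨b.normed μ ⋆[ContinuousLinearMap.lsmul ℝ ℝ, μ] g,
    b.hasCompactSupport_normed.contDiff_convolution_left _ b.contDiff_normed
      hg.continuous.locallyIntegrable, fun x => ⟨?_, ?_⟩⟩
  · rw [← dist_eq_norm]
    exact b.dist_normed_convolution_le hg.continuous.aestronglyMeasurable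
      fun y hy => (h1 (lt_of_lt_of_le (Metric.mem_ball.1 hy) hδ1)).le
  -- The derivative is placed on `g`, so the derivative of the mollification is the mollification of
  -- the derivative by the same bump.
  · have hd := (hc.hasFDerivAt_convolution_right (ContinuousLinearMap.lsmul ℝ ℝ) hbl hg x).fderiv
    have hL : (ContinuousLinearMap.lsmul ℝ ℝ : ℝ →L[ℝ] F →L[ℝ] F).precompR E =
        ContinuousLinearMap.lsmul ℝ ℝ := by
      ext a f y; simp
    rw [hd, hL, ← dist_eq_norm]
    exact b.dist_normed_convolution_le hdc.aestronglyMeasurable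
      fun y hy => (h2 (lt_of_lt_of_le (Metric.mem_ball.1 hy) hδ2)).le

/-- A function which is `C¹` near a compact set agrees near it with a compactly supported one. -/
lemma exists_hasCompactSupport_eq_nhds {K U : Set E} (hK : IsCompact K) (hU : IsOpen U)
    (hKU : K ⊆ U) {f : E → F} (hf : ContDiffOn ℝ 1 f U) :
    ∃ g : E → F, ContDiff ℝ 1 g ∧ HasCompactSupport g ∧ ∀ x ∈ K, g =ᶠ[𝓝 x] f := by
  obtain ⟨L, hL, hKL, hLU⟩ := exists_compact_between hK hU hKU
  obtain ⟨χ, hχ1, hχ0, -⟩ := exists_contMDiffMap_one_nhds_of_subset_interior (n := (⊤ : ℕ∞))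
    (𝓘(ℝ, E)) hK.isClosed hKL
  have hχ : ContDiff ℝ 1 χ := χ.contMDiff.contDiff.of_le (by simp)
  refine ⟨fun x => χ x • f x, contDiff_iff_contDiffAt.2 fun x => ?_,
    HasCompactSupport.intro hL fun x hx => by simp [hχ0 x hx], fun x hx => ?_⟩
  · by_cases hx : x ∈ U
    · exact hχ.contDiffAt.smul (hf.contDiffAt (hU.mem_nhds hx))
    · have : (fun x => χ x • f x) =ᶠ[𝓝 x] fun _ => 0 := by
        filter_upwards [hL.isClosed.isOpen_compl.mem_nhds fun h => hx (hLU h)] with y hy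
        rw [hχ0 y hy, zero_smul]
      exact contDiffAt_const.congr_of_eventuallyEq this
  · filter_upwards [eventually_nhdsSet_iff_forall.1 hχ1 x hx] with y hy
    rw [hy, one_smul]

/-- A function which is `C¹` on a compact set with inward directions is approximated, in `C¹` on
this set, by functions that are `C¹` in a neighborhood. -/
lemma exists_neighborhood_extension_close {K : Set E} (hK : IsCompact K)
    (hin : ∀ x, ∃ v, InwardAt K x v) {φ : E → F} (hφ : ContDiffOn ℝ 1 φ K) {ε : ℝ} (hε : 0 < ε) :
    ∃ (U : Set E) (f : E → F), IsOpen U ∧ K ⊆ U ∧ ContDiffOn ℝ 1 f U ∧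
      ∀ x ∈ K, ‖f x - φ x‖ ≤ ε ∧ ‖fderiv ℝ f x - fderivWithin ℝ φ K x‖ ≤ ε := by
  have huniq : UniqueDiffOn ℝ K := uniqueDiffOn_of_inwardAt fun x _ => hin x
  obtain ⟨v, hv, s₀, hs₀, hpush⟩ := exists_smooth_inward_field hK hin
  have hDc : ContinuousOn (fderivWithin ℝ φ K) K := hφ.continuousOn_fderivWithin huniq le_rfl
  have hDvc : Continuous (fderiv ℝ v) := hv.continuous_fderiv (by simp)
  obtain ⟨δ₁, hδ₁, h1⟩ := Metric.uniformContinuousOn_iff.1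
    (hK.uniformContinuousOn_of_continuous hφ.continuousOn) ε hε
  obtain ⟨δ₂, hδ₂, h2⟩ := Metric.uniformContinuousOn_iff.1
    (hK.uniformContinuousOn_of_continuous hDc) (ε / 2) (half_pos hε)
  obtain ⟨M, hM⟩ := hK.exists_bound_of_continuousOn hDc
  obtain ⟨V, hV⟩ := hK.exists_bound_of_continuousOn hv.continuous.continuousOn
  obtain ⟨V', hV'⟩ := hK.exists_bound_of_continuousOn hDvc.continuousOn
  -- The shift `s v` must stay within the moduli of continuity of `φ` and of its derivative; `s M
  -- V'` bounds the extra chain rule term `s Dφ ∘ Dv`.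
  obtain ⟨s, hs, hss, hsV, hsM⟩ : ∃ s > 0, s < s₀ ∧ s * V < min δ₁ δ₂ ∧ s * (M * V') < ε / 2 := by
    have l1 : Tendsto (fun s : ℝ => s * V) (𝓝[>] 0) (𝓝 0) := by
      have : Tendsto (fun s : ℝ => s * V) (𝓝 0) (𝓝 (0 * V)) :=
        (by fun_prop : Continuous fun s : ℝ => s * V).tendsto 0
      rw [zero_mul] at this
      exact this.mono_left nhdsWithin_le_nhds
    have l2 : Tendsto (fun s : ℝ => s * (M * V')) (𝓝[>] 0) (𝓝 0) := by
      have : Tendsto (fun s : ℝ => s * (M * V')) (𝓝 0) (𝓝 (0 * (M * V'))) :=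
        (by fun_prop : Continuous fun s : ℝ => s * (M * V')).tendsto 0
      rw [zero_mul] at this
      exact this.mono_left nhdsWithin_le_nhds
    have l3 : ∀ᶠ s : ℝ in 𝓝[>] 0, s < s₀ :=
      (eventually_lt_nhds hs₀).filter_mono nhdsWithin_le_nhds
    obtain ⟨s, a, b, c, e⟩ := ((l1.eventually (gt_mem_nhds (lt_min hδ₁ hδ₂))).and
      ((l2.eventually (gt_mem_nhds (half_pos hε))).and (l3.and self_mem_nhdsWithin))).exists
    exact ⟨s, e, c, a, b⟩
  have hTd : ContDiff ℝ 1 fun x => x + s • v x :=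
    contDiff_id.add ((hv.of_le (by simp)).const_smul s)
  have hTfd : ∀ x, HasFDerivAt (fun x => x + s • v x)
      (ContinuousLinearMap.id ℝ E + s • fderiv ℝ v x) x := fun x =>
    (hasFDerivAt_id x).add (((hv.differentiable (by simp)) x).hasFDerivAt.const_smul s)
  -- The shifted function `φ (x + s v x)` only evaluates `φ` in the interior of `K`, where it is
  -- differentiable in the ordinary sense, and it is defined this way on an open set containing `K`.
  refine ⟨(fun x => x + s • v x) ⁻¹' interior K, fun x => φ (x + s • v x),
    isOpen_interior.preimage hTd.continuous, fun x hx => hpush x hx s hs hss,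
    (hφ.mono interior_subset).comp hTd.contDiffOn fun x hx => hx, fun x hx => ?_⟩
  have hyi : x + s • v x ∈ interior K := hpush x hx s hs hss
  have hyK : x + s • v x ∈ K := interior_subset hyi
  have hdist : dist (x + s • v x) x < min δ₁ δ₂ := by
    rw [dist_eq_norm, add_sub_cancel_left, norm_smul, Real.norm_of_nonneg hs.le]
    exact (mul_le_mul_of_nonneg_left (hV x hx) hs.le).trans_lt hsV
  refine ⟨?_, ?_⟩
  · rw [← dist_eq_norm]
    exact (h1 _ hyK _ hx (hdist.trans_le (min_le_left _ _))).le
  · have hφd : HasFDerivAt φ (fderivWithin ℝ φ K (x + s • v x)) (x + s • v x) :=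
      ((hφ.differentiableOn one_ne_zero _ hyK).hasFDerivWithinAt).hasFDerivAt
        (mem_interior_iff_mem_nhds.1 hyi)
    have hcomp := (hφd.comp x (hTfd x)).fderiv
    have hcomp' : fderiv ℝ (fun x => φ (x + s • v x)) x =
        (fderivWithin ℝ φ K (x + s • v x)).comp (ContinuousLinearMap.id ℝ E + s • fderiv ℝ v x) :=
      hcomp
    rw [hcomp', ContinuousLinearMap.comp_add, ContinuousLinearMap.comp_id,
      ContinuousLinearMap.comp_smul]
    have e1 : ‖fderivWithin ℝ φ K (x + s • v x) - fderivWithin ℝ φ K x‖ ≤ ε / 2 := by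
      rw [← dist_eq_norm]
      exact (h2 _ hyK _ hx (hdist.trans_le (min_le_right _ _))).le
    have e2 : ‖s • (fderivWithin ℝ φ K (x + s • v x)).comp (fderiv ℝ v x)‖ ≤ ε / 2 := by
      rw [norm_smul, Real.norm_of_nonneg hs.le]
      refine le_trans ?_ hsM.le
      gcongr
      refine (ContinuousLinearMap.opNorm_comp_le _ _).trans ?_
      have := norm_nonneg (fderivWithin ℝ φ K (x + s • v x))
      exact mul_le_mul (hM _ hyK) (hV' x hx) (norm_nonneg _) (this.trans (hM _ hyK))
    calc _ = ‖(fderivWithin ℝ φ K (x + s • v x) - fderivWithin ℝ φ K x) +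
          s • (fderivWithin ℝ φ K (x + s • v x)).comp (fderiv ℝ v x)‖ := by congr 1; abel
      _ ≤ ε / 2 + ε / 2 := (norm_add_le _ _).trans (add_le_add e1 e2)
      _ = ε := by ring

/-- Smooth functions are dense in `C¹` of a compact set with inward directions. -/
theorem exists_smooth_close [CompleteSpace F] {K : Set E} (hK : IsCompact K)
    (hin : ∀ x, ∃ v, InwardAt K x v) {φ : E → F} (hφ : ContDiffOn ℝ 1 φ K) {ε : ℝ} (hε : 0 < ε) :
    ∃ ψ : E → F, ContDiff ℝ (⊤ : ℕ∞) ψ ∧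
      ∀ x ∈ K, ‖ψ x - φ x‖ ≤ ε ∧ ‖fderiv ℝ ψ x - fderivWithin ℝ φ K x‖ ≤ ε := by
  obtain ⟨U, f, hU, hKU, hf, hclose⟩ :=
    exists_neighborhood_extension_close hK hin hφ (half_pos hε)
  obtain ⟨g, hg, hgc, hgf⟩ := exists_hasCompactSupport_eq_nhds hK hU hKU hf
  obtain ⟨ψ, hψ, hψg⟩ := exists_smooth_close_of_hasCompactSupport hg hgc (half_pos hε)
  refine ⟨ψ, hψ, fun x hx => ⟨?_, ?_⟩⟩
  · have h1 := (hψg x).1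
    rw [(hgf x hx).eq_of_nhds] at h1
    have := norm_sub_le_norm_sub_add_norm_sub (ψ x) (f x) (φ x)
    linarith [(hclose x hx).1]
  · have h1 := (hψg x).2
    rw [(hgf x hx).fderiv_eq] at h1
    have := norm_sub_le_norm_sub_add_norm_sub (fderiv ℝ ψ x) (fderiv ℝ f x)
      (fderivWithin ℝ φ K x)
    linarith [(hclose x hx).2]

end SmoothApproximation

end SmoothFunctions

/-! ### The discrete dual norm -/

section DualNorm

variable {E : Type*} [NormedAddCommGroup E] [InnerProductSpace ℝ E] [FiniteDimensional ℝ E]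

/-- A seminorm on a finite-dimensional space is continuous, being convex, and so attains a minimum
on the unit sphere; definiteness makes it positive. -/
lemma exists_norm_le_mul_of_definite {p : Seminorm ℝ E} (hp : ∀ x, p x = 0 → x = 0) :
    ∃ C : ℝ, ∀ x, ‖x‖ ≤ C * p x := by
  have hpc : Continuous p := by
    rw [← continuousOn_univ]
    exact p.convexOn.continuousOn isOpen_univ
  rcases subsingleton_or_nontrivial E with h | h
  · exact ⟨0, fun x => by simp [Subsingleton.elim x 0]⟩
  · obtain ⟨x₀, hx₀, hmin⟩ := (isCompact_sphere (0 : E) 1).exists_isMinOn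
      (NormedSpace.sphere_nonempty.2 zero_le_one) hpc.continuousOn
    have hx0 : x₀ ≠ 0 := by
      rintro rfl; simp at hx₀
    have hpos : 0 < p x₀ := lt_of_le_of_ne (apply_nonneg p x₀) fun h0 => hx0 (hp _ h0.symm)
    refine ⟨(p x₀)⁻¹, fun x => ?_⟩
    by_cases hx : x = 0
    · simp [hx]
    have hn : 0 < ‖x‖ := norm_pos_iff.2 hx
    have h1 : p x₀ ≤ p (‖x‖⁻¹ • x) :=
      hmin (by simp [norm_smul, hn.ne'])
    rw [map_smul_eq_mul, norm_inv, norm_norm] at h1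
    rw [le_inv_mul_iff₀ hpos]
    rwa [inv_mul_eq_div, le_div_iff₀ hn] at h1

/-- The supremum in `dualNorm` is taken in `ℝ` and is meaningful only for a set bounded above.
Definiteness of `p` provides the bound, and normalizing `g` gives the inequality. -/
lemma abs_inner_le_dualNorm {p : Seminorm ℝ E} (hp : ∀ x, p x = 0 → x = 0) (f g : E) :
    |⟪f, g⟫_ℝ| ≤ dualNorm p f * p g := by
  obtain ⟨C, hC⟩ := exists_norm_le_mul_of_definite hp
  have hbdd : BddAbove (range fun g : {g : E // p g ≤ 1} => ⟪f, (g : E)⟫_ℝ) := by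
    refine ⟨‖f‖ * |C|, ?_⟩
    rintro _ ⟨g, rfl⟩
    refine (real_inner_le_norm _ _).trans ?_
    gcongr
    have h1 := hC g
    have h2 : C * p g ≤ |C| * p g := by
      gcongr
      exact le_abs_self C
    have h3 : |C| * p g ≤ |C| * 1 := by
      gcongr
      exact g.2
    linarith
  have key : ∀ g : E, ⟪f, g⟫_ℝ ≤ dualNorm p f * p g := by
    intro g
    by_cases hg : g = 0
    · simp [hg]
    have hpos : 0 < p g := lt_of_le_of_ne (apply_nonneg p g) fun h0 => hg (hp _ h0.symm)
    have hmem : p ((p g)⁻¹ • g) ≤ 1 := by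
      rw [map_smul_eq_mul, norm_inv, Real.norm_of_nonneg hpos.le, inv_mul_cancel₀ hpos.ne']
    have h1 := le_ciSup hbdd ⟨(p g)⁻¹ • g, hmem⟩
    simp only [inner_smul_right] at h1
    rwa [inv_mul_le_iff₀ hpos, mul_comm] at h1
  refine abs_le.2 ⟨?_, key g⟩
  have := key (-g)
  rw [inner_neg_right, map_neg_eq_map] at this
  linarith

end DualNorm

/-! ### Time slices of smooth space-time functions -/

section Slices

variable {d n m : ℕ} {F : Type*} [NormedAddCommGroup F] [NormedSpace ℝ F]

lemma supNorm_nonneg (Ω : Set (Eu d)) (φ : Eu d → F) : 0 ≤ supNorm Ω φ :=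
  Real.iSup_nonneg fun _ => norm_nonneg _

lemma supNorm_le {Ω : Set (Eu d)} {φ : Eu d → F} {c : ℝ} (hc : 0 ≤ c)
    (h : ∀ x ∈ Ω, ‖φ x‖ ≤ c) : supNorm Ω φ ≤ c :=
  Real.iSup_le (fun x => h x x.2) hc

lemma c1Norm_nonneg (Ω : Set (Eu d)) (φ : Eu d → F) : 0 ≤ c1Norm Ω φ :=
  add_nonneg (supNorm_nonneg _ _) (Finset.sum_nonneg fun _ _ => supNorm_nonneg _ _)

/-- The spatial partial derivative of a function on space-time. -/
noncomputable def spd (i : Fin d) (f : ℝ × Eu d → F) (p : ℝ × Eu d) : F :=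
  fderiv ℝ f p (0, EuclideanSpace.single i 1)

lemma contDiff_spd (i : Fin d) {f : ℝ × Eu d → F} (hf : ContDiff ℝ (⊤ : ℕ∞) f) :
    ContDiff ℝ (⊤ : ℕ∞) (spd i f) := by
  have h1 : ContDiff ℝ (⊤ : ℕ∞) (fderiv ℝ f) := hf.fderiv_right (by simp)
  exact h1.clm_apply contDiff_const

lemma pd_slice {Ω : Set (Eu d)} (hΩ : UniqueDiffOn ℝ Ω) {f : ℝ × Eu d → F}
    (hf : Differentiable ℝ f) (i : Fin d) (t : ℝ) {x : Eu d} (hx : x ∈ Ω) :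
    pd Ω i (fun y => f (t, y)) x = spd i f (t, x) := by
  have h1 : HasFDerivAt (fun y : Eu d => f (t, y))
      ((fderiv ℝ f (t, x)).comp (ContinuousLinearMap.inr ℝ ℝ (Eu d))) x :=
    (hf (t, x)).hasFDerivAt.comp x (hasFDerivAt_prodMk_right t x)
  rw [pd, h1.hasFDerivWithinAt.fderivWithin (hΩ x hx)]
  simp [spd]

lemma pd_pd_slice {Ω : Set (Eu d)} (hΩ : UniqueDiffOn ℝ Ω) {f : ℝ × Eu d → F}
    (hf : ContDiff ℝ (⊤ : ℕ∞) f) (i j : Fin d) (t : ℝ) {x : Eu d} (hx : x ∈ Ω) :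
    pd Ω i (pd Ω j fun y => f (t, y)) x = spd i (spd j f) (t, x) := by
  have h1 : pd Ω i (pd Ω j fun y => f (t, y)) x = pd Ω i (fun y => spd j f (t, y)) x := by
    rw [pd, pd, fderivWithin_congr (fun y hy => pd_slice hΩ (hf.differentiable (by simp)) j t hy)
      (pd_slice hΩ (hf.differentiable (by simp)) j t hx)]
  rw [h1, pd_slice hΩ ((contDiff_spd j hf).differentiable (by simp)) i t hx]

lemma exists_bound_slab {Ω : Set (Eu d)} (hΩ : IsCompact Ω) {f : ℝ × Eu d → F}
    (hf : Continuous f) : ∃ r : ℝ, 0 ≤ r ∧ ∀ t ∈ Icc (0 : ℝ) 1, ∀ x ∈ Ω, ‖f (t, x)‖ ≤ r := by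
  obtain ⟨C, hC⟩ := (isCompact_Icc.prod hΩ).exists_bound_of_continuousOn hf.continuousOn
    (s := Icc (0 : ℝ) 1 ×ˢ Ω)
  exact ⟨max C 0, le_max_right _ _, fun t ht x hx => (hC (t, x) ⟨ht, hx⟩).trans (le_max_left _ _)⟩

/-- All slices of a fixed smooth function lie in one ball of `C¹(Ω)`, by compactness of `[0,1] × Ω`.
Spatial consistency estimates thereby become uniform in time. -/
lemma exists_c1Norm_slice_le {Ω : Set (Eu d)} (hΩ : IsCompact Ω) (hΩu : UniqueDiffOn ℝ Ω)
    {f : ℝ × Eu d → F} (hf : ContDiff ℝ (⊤ : ℕ∞) f) :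
    ∃ r : ℝ, 0 ≤ r ∧ ∀ t ∈ Icc (0 : ℝ) 1, c1Norm Ω (fun y => f (t, y)) ≤ r := by
  obtain ⟨r, hr, h⟩ := exists_bound_slab hΩ hf.continuous
  choose s hs h' using fun i : Fin d => exists_bound_slab hΩ (contDiff_spd i hf).continuous
  refine ⟨r + ∑ i, s i, add_nonneg hr (Finset.sum_nonneg fun i _ => hs i), fun t ht => ?_⟩
  refine add_le_add (supNorm_le hr fun x hx => h t ht x hx)
    (Finset.sum_le_sum fun i _ => supNorm_le (hs i) fun x hx => ?_)
  rw [pd_slice hΩu (hf.differentiable (by simp)) i t hx]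
  exact h' i t ht x hx

lemma exists_c2Norm_slice_le {Ω : Set (Eu d)} (hΩ : IsCompact Ω) (hΩu : UniqueDiffOn ℝ Ω)
    {f : ℝ × Eu d → F} (hf : ContDiff ℝ (⊤ : ℕ∞) f) :
    ∃ r : ℝ, 0 ≤ r ∧ ∀ t ∈ Icc (0 : ℝ) 1, c2Norm Ω (fun y => f (t, y)) ≤ r := by
  obtain ⟨r, hr, h⟩ := exists_c1Norm_slice_le hΩ hΩu hf
  choose s hs h' using fun i j : Fin d =>
    exists_bound_slab hΩ (contDiff_spd i (contDiff_spd j hf)).continuous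
  refine ⟨r + ∑ i, ∑ j ∈ Finset.Ici i, s i j, add_nonneg hr (Finset.sum_nonneg fun i _ =>
    Finset.sum_nonneg fun j _ => hs i j), fun t ht => ?_⟩
  refine add_le_add (h t ht) (Finset.sum_le_sum fun i _ => Finset.sum_le_sum fun j _ =>
    supNorm_le (hs i j) fun x hx => ?_)
  rw [pd_pd_slice hΩu hf i j t hx]
  exact h' i j t ht x hx

/-- The restriction to `[0,1] × Ω` of a continuous function on space-time. -/
def resQ {Ω : Set (Eu d)} {f : ℝ × Eu d → F} (hf : Continuous f) : C(unitInterval × Ω, F) :=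
  ⟨fun p => f (p.1, p.2), by fun_prop⟩

/-- Stone–Weierstrass for the algebra of restrictions of smooth functions; the coordinates separate
points. -/
lemma exists_smooth_near_scalar {Ω : Set (Eu d)} [CompactSpace Ω] (φ : C(unitInterval × Ω, ℝ))
    {ε : ℝ} (hε : 0 < ε) : ∃ f : ℝ × Eu d → ℝ, ContDiff ℝ (⊤ : ℕ∞) f ∧
      ∀ p : unitInterval × Ω, |f (p.1, p.2) - φ p| < ε := by
  let A : Subalgebra ℝ C(unitInterval × Ω, ℝ) :=
    { carrier := {φ | ∃ f : ℝ × Eu d → ℝ, ContDiff ℝ (⊤ : ℕ∞) f ∧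
        ∀ p : unitInterval × Ω, φ p = f (p.1, p.2)}
      mul_mem' := by
        rintro a b ⟨f, hf, hfa⟩ ⟨g, hg, hgb⟩
        exact ⟨fun p => f p * g p, hf.mul hg, fun p => by simp [hfa, hgb]⟩
      add_mem' := by
        rintro a b ⟨f, hf, hfa⟩ ⟨g, hg, hgb⟩
        exact ⟨fun p => f p + g p, hf.add hg, fun p => by simp [hfa, hgb]⟩
      algebraMap_mem' := fun r => ⟨fun _ => r, contDiff_const, fun p => by simp⟩ }
  have hsep : A.SeparatesPoints := by
    rintro ⟨t, x⟩ ⟨s, y⟩ hne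
    by_cases hts : t = s
    · have hxy : (x : Eu d) ≠ y := by
        rintro h
        exact hne (by rw [hts, Subtype.ext h])
      obtain ⟨i, hi⟩ : ∃ i, (x : Eu d) i ≠ (y : Eu d) i := by
        by_contra! h
        exact hxy (by ext i; exact h i)
      have hsm : ContDiff ℝ (⊤ : ℕ∞) fun p : ℝ × Eu d => p.2 i :=
        (contDiff_euclidean.1 contDiff_snd) i
      exact ⟨_, ⟨resQ hsm.continuous, ⟨_, hsm, fun p => rfl⟩, rfl⟩, hi⟩
    · have hsm : ContDiff ℝ (⊤ : ℕ∞) fun p : ℝ × Eu d => p.1 := contDiff_fst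
      exact ⟨_, ⟨resQ hsm.continuous, ⟨_, hsm, fun p => rfl⟩, rfl⟩, fun h => hts (Subtype.ext h)⟩
  obtain ⟨⟨g, f, hf, hfg⟩, hg⟩ :=
    ContinuousMap.exists_mem_subalgebra_near_continuousMap_of_separatesPoints A hsep φ ε hε
  refine ⟨f, hf, fun p => ?_⟩
  rw [← hfg, ← Real.norm_eq_abs]
  exact (ContinuousMap.norm_lt_iff _ hε).1 hg p

lemma contDiff_of_entries {f : ℝ × Eu d → Mat n m}
    (h : ∀ i j, ContDiff ℝ (⊤ : ℕ∞) fun p => f p i j) : ContDiff ℝ (⊤ : ℕ∞) f := by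
  have : f = fun x => ∑ i, ∑ j, f x i j • Matrix.single i j (1 : ℝ) := by
    ext x : 1
    conv_lhs => rw [Matrix.matrix_eq_sum_single (f x)]
    simp [Matrix.smul_single]
  rw [this]
  exact ContDiff.sum fun i _ => ContDiff.sum fun j _ => (h i j).smul contDiff_const

/-- Smooth functions are dense in the continuous functions on `[0,1] × Ω`. -/
theorem exists_smooth_near {Ω : Set (Eu d)} [CompactSpace Ω] (φ : C(unitInterval × Ω, Mat n m))
    {ε : ℝ} (hε : 0 < ε) : ∃ f : ℝ × Eu d → Mat n m, ContDiff ℝ (⊤ : ℕ∞) f ∧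
      ∀ p : unitInterval × Ω, ‖f (p.1, p.2) - φ p‖ ≤ ε := by
  have hδ : 0 < ε / (n * m + 1) := by positivity
  choose f hf hfφ using fun (i : Fin n) (j : Fin m) => exists_smooth_near_scalar
    (⟨fun p => φ p i j, φ.continuous.matrix_elem i j⟩ : C(unitInterval × Ω, ℝ)) hδ
  refine ⟨fun p => Matrix.of fun i j => f i j p, contDiff_of_entries hf, fun p => ?_⟩
  refine (norm_le_sum_entries _).trans ?_
  calc _ ≤ ∑ i : Fin n, ∑ j : Fin m, ε / (n * m + 1) :=
        Finset.sum_le_sum fun i _ => Finset.sum_le_sum fun j _ => (hfφ i j p).le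
    _ = (n * m) * (ε / (n * m + 1)) := by simp; ring
    _ ≤ ε := by
        rw [mul_div_assoc', div_le_iff₀ (by positivity)]
        nlinarith

end Slices

/-! ### Equivalent reconstructions on `C¹` functions -/

section Equivalence

variable {d n m : ℕ} {Ω : Set (Eu d)} [CompactSpace Ω] {Sig : Set ℝ} {M : Sig → Type*}
  [∀ σ, NormedAddCommGroup (M σ)] [∀ σ, InnerProductSpace ℝ (M σ)]
  [∀ σ, FiniteDimensional ℝ (M σ)]

/-- Equivalence is stated for adjoints in the dual norm; moving the adjoints back gives the estimate
in terms of the measures themselves. -/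
lemma RecEquiv.exists_abs_sub_le {p : ∀ σ, Seminorm ℝ (M σ)}
    (hp : ∀ σ x, p σ x = 0 → x = 0) {R R' : ∀ σ, M σ →ₗ[ℝ] MatMeas Ω n m} (h : RecEquiv p R R') :
    ∃ ε : Sig → ℝ, (∀ σ, 0 < ε σ) ∧ Tendsto ε (toZero Sig) (𝓝 0) ∧
      ∀ σ (φ : Eu d → Mat n m), ContDiffOn ℝ 1 φ Ω → ∀ f : M σ,
        |pairing (R σ f) (fun x => φ x) - pairing (R' σ f) (fun x => φ x)| ≤
          ε σ * c1Norm Ω φ * p σ f := by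
  obtain ⟨ε, hε, hlim, h⟩ := h
  refine ⟨ε, hε, hlim, fun σ φ hφ f => ?_⟩
  have h1 : pairing (R σ f) (fun x => φ x) - pairing (R' σ f) (fun x => φ x) =
      ⟪adj (R σ) (toC φ hφ.continuousOn) - adj (R' σ) (toC φ hφ.continuousOn), f⟫_ℝ := by
    rw [real_inner_comm, inner_sub_right, inner_adj, inner_adj]
    rfl
  rw [h1]
  exact (abs_inner_le_dualNorm (hp σ) _ f).trans
    (mul_le_mul_of_nonneg_right (h σ φ hφ) (apply_nonneg _ _))

end Equivalence

/-! ### Linearity, transposition and symmetry of the pairing -/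

section PairingLinear

variable {α : Type*} [MeasurableSpace α] [TopologicalSpace α] [CompactSpace α] [BorelSpace α]
  {n m : ℕ}

/-- The pairing with a matrix-valued measure as a continuous linear form. -/
noncomputable def pairingCLM (μ : MatMeas α n m) : C(α, Mat n m) →L[ℝ] ℝ :=
  LinearMap.mkContinuous
    { toFun := fun φ => pairing μ φ
      map_add' := fun φ ψ =>
        VectorMeasure.integral_add (integrable_continuous μ φ) (integrable_continuous μ ψ)
      map_smul' := fun c φ => VectorMeasure.integral_smul φ μ (frob n m) c }
    (‖frob n m‖ * tvNorm μ) fun φ => by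
      rw [Real.norm_eq_abs]
      refine (abs_pairing_le μ fun x => φ.norm_coe_le_norm x).trans (le_of_eq ?_)
      ring

lemma pairing_add_measure (μ ν : MatMeas α n m) (φ : C(α, Mat n m)) :
    pairing (μ + ν) φ = pairing μ φ + pairing ν φ :=
  map_add (pairingₗ φ) μ ν

lemma pairing_smul_measure (c : ℝ) (μ : MatMeas α n m) (φ : C(α, Mat n m)) :
    pairing (c • μ) φ = c * pairing μ φ :=
  map_smul (pairingₗ φ) c μ

lemma pairing_sub_measure (μ ν : MatMeas α n m) (φ : C(α, Mat n m)) :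
    pairing (μ - ν) φ = pairing μ φ - pairing ν φ :=
  map_sub (pairingₗ φ) μ ν

lemma pairing_sub (μ : MatMeas α n m) (φ ψ : C(α, Mat n m)) :
    pairing μ (fun x => φ x - ψ x) = pairing μ φ - pairing μ ψ :=
  map_sub (pairingCLM μ) φ ψ

lemma abs_pairing_sub_le (μ : MatMeas α n m) {φ ψ : C(α, Mat n m)} {c : ℝ}
    (h : ∀ x, ‖φ x - ψ x‖ ≤ c) : |pairing μ φ - pairing μ ψ| ≤ c * ‖frob n m‖ * tvNorm μ := by
  rw [← pairing_sub]
  exact abs_pairing_le μ h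

end PairingLinear

section Transpose

variable {α : Type*} [MeasurableSpace α] {n m : ℕ}

/-- The transpose of a matrix-valued measure. -/
noncomputable def transposeMeas (μ : MatMeas α n m) : MatMeas α m n :=
  μ.mapRange (Matrix.transposeAddEquiv (Fin n) (Fin m) ℝ).toAddMonoidHom
    (continuous_of_entries fun i j => continuous_id.matrix_elem j i)

lemma transposeMeas_apply (μ : MatMeas α n m) (s : Set α) : transposeMeas μ s = (μ s)ᵀ := rfl

/-- Both measures are written with densities over one dominating measure, where transposition is the
exchange of the two sums in the Frobenius product. -/
lemma pairing_transposeMeas [TopologicalSpace α] [CompactSpace α] [BorelSpace α]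
    (μ : MatMeas α n m) (φ : C(α, Mat m n)) :
    pairing (transposeMeas μ) φ = pairing μ fun x => (φ x)ᵀ := by
  set ν := μ.variation + (transposeMeas μ).variation with hν
  have h1 : μ.variation ≪ ν := Measure.absolutelyContinuous_of_le (Measure.le_add_right le_rfl)
  have h2 : (transposeMeas μ).variation ≪ ν :=
    Measure.absolutelyContinuous_of_le (Measure.le_add_left le_rfl)
  let φt : C(α, Mat n m) :=
    ⟨fun x => (φ x)ᵀ, continuous_of_entries fun i j => φ.continuous.matrix_elem j i⟩
  rw [(pairing_eq_integral_density _ h2 (integrable_continuous _ φ)).2]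
  have h3 := (pairing_eq_integral_density _ h1 (integrable_continuous _ φt)).2
  refine Eq.trans ?_ h3.symm
  congr 1
  ext x
  have hd : ∀ i j, density (transposeMeas μ) ν x i j = density μ ν x j i := fun i j => rfl
  simp only [frob_eq_sum, hd]
  rw [Finset.sum_comm]
  rfl

lemma transposeMeas_of_symmValued {μ : MatMeas α n n} (h : SymmValued μ) : transposeMeas μ = μ := by
  ext1 s hs
  exact h s hs

lemma transposeMeas_of_antisymmValued {μ : MatMeas α n n} (h : AntisymmValued μ) :
    transposeMeas μ = -μ := by
  ext1 s hs
  exact h s hs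

lemma pairing_transpose_of_symmValued [TopologicalSpace α] [CompactSpace α] [BorelSpace α]
    {μ : MatMeas α n n} (h : SymmValued μ) (φ : C(α, Mat n n)) :
    (pairing μ fun x => (φ x)ᵀ) = pairing μ φ := by
  rw [← pairing_transposeMeas, transposeMeas_of_symmValued h]

/-- Transposing the measure and the test function shows that the pairing equals its own negative.
Symmetric test functions thus do not see the component of `R` orthogonal to `X_σ`. -/
lemma pairing_eq_zero_of_antisymmValued [TopologicalSpace α] [CompactSpace α] [BorelSpace α]
    {μ : MatMeas α n n} (h : AntisymmValued μ) {φ : C(α, Mat n n)} (hφ : ∀ x, (φ x).IsSymm) :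
    pairing μ φ = 0 := by
  have h1 : pairing μ φ = -pairing μ φ := by
    calc pairing μ φ = pairing μ fun x => (φ x)ᵀ := by
          congr 1
          ext x : 1
          exact (hφ x).eq.symm
      _ = pairing (-μ) φ := by rw [← pairing_transposeMeas, transposeMeas_of_antisymmValued h]
      _ = -pairing μ φ := map_neg (pairingₗ φ) μ
  linarith

/-- The difference has zero total variation by the dual estimate. -/
lemma eq_of_pairing_eq [TopologicalSpace α] [CompactSpace α] [TopologicalSpace.MetrizableSpace α]
    [BorelSpace α] {μ ν : MatMeas α n m} (h : ∀ φ : C(α, Mat n m), pairing μ φ = pairing ν φ) :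
    μ = ν := by
  have h1 : tvNorm (μ - ν) ≤ n * m * 0 := by
    refine tvNorm_le_of_pairing_le _ fun φ _ => ?_
    rw [pairing_sub_measure, h φ, sub_self]
  have h2 : (μ - ν).variation univ = 0 := by
    have := le_antisymm (by simpa using h1) (tvNorm_nonneg (μ - ν))
    exact ((ENNReal.toReal_eq_zero_iff _).1 this).resolve_right (measure_ne_top _ _)
  rw [← sub_eq_zero]
  ext1 s _
  have h3 := VectorMeasure.enorm_measure_le_variation (μ - ν) s
  rw [measure_mono_null (subset_univ s) h2] at h3
  simpa using h3

lemma symmValued_of_pairing_transpose [TopologicalSpace α] [CompactSpace α]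
    [TopologicalSpace.MetrizableSpace α] [BorelSpace α] {μ : MatMeas α n n}
    (h : ∀ φ : C(α, Mat n n), (pairing μ fun x => (φ x)ᵀ) = pairing μ φ) : SymmValued μ := by
  have h1 : transposeMeas μ = μ := eq_of_pairing_eq fun φ => by rw [pairing_transposeMeas, h]
  intro s _
  rw [Matrix.IsSymm, ← transposeMeas_apply, h1]

end Transpose

/-! ### Piecewise constant and piecewise linear reconstructions in time -/

section TimeSpace

variable {d n m : ℕ} {Ω : Set (Eu d)} [CompactSpace Ω]

/-- The slice of a continuous function on `[0,1] × Ω` as a continuous function on `Ω`. -/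
noncomputable def sliceC (Φ : C(unitInterval × Ω, Mat n m)) (t : ℝ) : C(Ω, Mat n m) :=
  Φ.curry (projIcc 0 1 zero_le_one t)

lemma coe_sliceC (Φ : C(unitInterval × Ω, Mat n m)) (t : ℝ) : ⇑(sliceC Φ t) = slice Φ t := rfl

lemma continuous_sliceC (Φ : C(unitInterval × Ω, Mat n m)) : Continuous (sliceC Φ) :=
  Φ.curry.continuous.comp continuous_projIcc

lemma continuous_pairing_slice (μ : MatMeas Ω n m) (Φ : C(unitInterval × Ω, Mat n m)) :
    Continuous fun t => pairing μ (slice Φ t) := by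
  have h := (pairingCLM μ).continuous.comp (continuous_sliceC Φ)
  exact h

lemma slice_resQ {f : ℝ × Eu d → Mat n m} (hf : Continuous f) {t : ℝ} (ht : t ∈ Icc (0 : ℝ) 1) :
    slice (resQ (Ω := Ω) hf) t = fun x : Ω => f (t, x) := by
  ext x : 1
  simp [slice, resQ, projIcc_of_mem _ ht]

lemma Icc_subset_unit {N : ℕ} (j : Fin N) :
    Icc ((j : ℝ) * (1 / N)) ((j + 1) * (1 / N)) ⊆ Icc 0 1 := by
  have hN : (0 : ℝ) < N := by exact_mod_cast j.pos
  have hj : (j : ℝ) + 1 ≤ N := by exact_mod_cast j.2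
  refine Icc_subset_Icc (by positivity) ?_
  rw [mul_one_div, div_le_one hN]
  exact hj

lemma step_le {N : ℕ} (j : Fin N) : (j : ℝ) * (1 / N) ≤ (j + 1) * (1 / N) := by
  gcongr
  linarith

/-- A bound for sums over the time steps of integrals. -/
lemma abs_sum_integral_le {N : ℕ} {g : Fin N → ℝ → ℝ} {b : Fin N → ℝ}
    (h : ∀ j : Fin N, ∀ t ∈ Icc ((j : ℝ) * (1 / N)) ((j + 1) * (1 / N)), |g j t| ≤ b j) :
    |∑ j : Fin N, ∫ t in ((j : ℝ) * (1 / N))..((j + 1) * (1 / N)), g j t| ≤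
      (1 / N : ℝ) * ∑ j, b j := by
  refine (Finset.abs_sum_le_sum_abs _ _).trans ?_
  rw [Finset.mul_sum]
  refine Finset.sum_le_sum fun j _ => ?_
  have h1 := intervalIntegral.norm_integral_le_of_norm_le_const (f := g j) (C := b j)
    (a := (j : ℝ) * (1 / N)) (b := (j + 1) * (1 / N)) fun t ht => by
      rw [uIoc_of_le (step_le j)] at ht
      exact h j t (Ioc_subset_Icc_self ht)
  rw [Real.norm_eq_abs] at h1
  refine h1.trans (le_of_eq ?_)
  have h2 : ((j : ℝ) + 1) * (1 / N) - j * (1 / N) = 1 / N := by ring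
  rw [h2, abs_of_nonneg (by positivity)]
  ring

lemma abs_recConst_le (N : ℕ) (q : Fin N → MatMeas Ω n m) {Φ : C(unitInterval × Ω, Mat n m)}
    {c : ℝ} (h : ∀ p, ‖Φ p‖ ≤ c) :
    |recConst N q Φ| ≤ c * ‖frob n m‖ * ((1 / N : ℝ) * ∑ j, tvNorm (q j)) := by
  refine (abs_sum_integral_le (b := fun j => c * ‖frob n m‖ * tvNorm (q j))
    fun j t _ => abs_pairing_le _ fun x => h _).trans (le_of_eq ?_)
  rw [← Finset.mul_sum]
  ring

/-- The piecewise constant reconstruction as a linear form. -/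
noncomputable def recConstₗ (N : ℕ) (q : Fin N → MatMeas Ω n m) :
    C(unitInterval × Ω, Mat n m) →ₗ[ℝ] ℝ where
  toFun := recConst N q
  map_add' Φ Ψ := by
    simp only [recConst]
    rw [← Finset.sum_add_distrib]
    refine Finset.sum_congr rfl fun j _ => ?_
    rw [← intervalIntegral.integral_add
      ((continuous_pairing_slice _ _).intervalIntegrable _ _)
      ((continuous_pairing_slice _ _).intervalIntegrable _ _)]
    congr 1
    ext t
    exact map_add (pairingCLM (q j)) (sliceC Φ t) (sliceC Ψ t)
  map_smul' c Φ := by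
    simp only [recConst, smul_eq_mul, RingHom.id_apply]
    rw [Finset.mul_sum]
    refine Finset.sum_congr rfl fun j _ => ?_
    rw [← intervalIntegral.integral_const_mul]
    congr 1
    ext t
    exact map_smul (pairingCLM (q j)) c (sliceC Φ t)

/-- The piecewise constant reconstruction as a continuous linear form. -/
noncomputable def recConstCLM (N : ℕ) (q : Fin N → MatMeas Ω n m) :
    C(unitInterval × Ω, Mat n m) →L[ℝ] ℝ :=
  (recConstₗ N q).mkContinuous (‖frob n m‖ * ((1 / N : ℝ) * ∑ j, tvNorm (q j))) fun Φ => by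
    rw [Real.norm_eq_abs]
    refine (abs_recConst_le N q fun p => Φ.norm_coe_le_norm p).trans (le_of_eq ?_)
    ring

lemma norm_recConstCLM_le (N : ℕ) (q : Fin N → MatMeas Ω n m) :
    ‖recConstCLM N q‖ ≤ ‖frob n m‖ * ((1 / N : ℝ) * ∑ j, tvNorm (q j)) := by
  apply LinearMap.mkContinuous_norm_le
  have := Finset.sum_nonneg fun (j : Fin N) (_ : j ∈ Finset.univ) => tvNorm_nonneg (q j)
  positivity

lemma recAverage_eq_recConst (N : ℕ) (G : Fin (N + 1) → MatMeas Ω n m) :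
    recAverage N G =
      recConst N fun j => (1 / 2 : ℝ) • G j.castSucc + (1 / 2 : ℝ) • G j.succ := rfl

/-- The two integrands differ by the weight `(t - jτ)/τ - 1/2` times the jump of the pairing. This
weight has mean zero on each step, so the jump at the left endpoint may be subtracted, and only the
oscillation of `Φ` within one step remains. -/
lemma recLinear_sub_recAverage (N : ℕ) (G : Fin (N + 1) → MatMeas Ω n m)
    (Φ : C(unitInterval × Ω, Mat n m)) :
    recLinear N G Φ - recAverage N G Φ =
      ∑ j : Fin N, ∫ t in ((j : ℝ) * (1 / N))..((j + 1) * (1 / N)),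
        ((t - j * (1 / N)) / (1 / N) - 1 / 2) *
          ((pairing (G j.succ) (slice Φ t) - pairing (G j.succ) (slice Φ (j * (1 / N)))) -
          (pairing (G j.castSucc) (slice Φ t) -
            pairing (G j.castSucc) (slice Φ (j * (1 / N))))) := by
  simp only [recLinear, recAverage]
  rw [← Finset.sum_sub_distrib]
  refine Finset.sum_congr rfl fun j _ => ?_
  have hN : (0 : ℝ) < N := by exact_mod_cast j.pos
  set τ : ℝ := 1 / N with hτ
  have hτ0 : 0 < τ := by positivity
  set P : ℝ → ℝ := fun t => pairing (G j.castSucc) (slice Φ t) with hP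
  set S : ℝ → ℝ := fun t => pairing (G j.succ) (slice Φ t) with hS
  have cP : Continuous P := continuous_pairing_slice _ _
  have cS : Continuous S := continuous_pairing_slice _ _
  have e1 : ∀ t, pairing ((((j + 1) * τ - t) / τ) • G j.castSucc + ((t - j * τ) / τ) • G j.succ)
      (slice Φ t) = ((j + 1) * τ - t) / τ * P t + (t - j * τ) / τ * S t := by
    intro t
    rw [← coe_sliceC, pairing_add_measure, pairing_smul_measure, pairing_smul_measure]
    rfl
  have e2 : ∀ t, pairing ((1 / 2 : ℝ) • G j.castSucc + (1 / 2 : ℝ) • G j.succ)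
      (slice Φ t) = 1 / 2 * P t + 1 / 2 * S t := by
    intro t
    rw [← coe_sliceC, pairing_add_measure, pairing_smul_measure, pairing_smul_measure]
    rfl
  simp only [e1, e2]
  have h0 : ∫ t in (j * τ)..((j + 1) * τ), ((t - j * τ) / τ - 1 / 2) = 0 := by
    rw [intervalIntegral.integral_sub (by apply Continuous.intervalIntegrable; fun_prop)
      (by apply Continuous.intervalIntegrable; fun_prop),
      intervalIntegral.integral_div,
      intervalIntegral.integral_sub (by apply Continuous.intervalIntegrable; fun_prop)
      (by apply Continuous.intervalIntegrable; fun_prop)]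
    simp
    field_simp
    ring
  have h1 : ∫ t in (j * τ)..((j + 1) * τ),
      ((t - j * τ) / τ - 1 / 2) * (S (j * τ) - P (j * τ)) = 0 := by
    rw [intervalIntegral.integral_mul_const, h0, zero_mul]
  rw [← intervalIntegral.integral_sub (by apply Continuous.intervalIntegrable; fun_prop)
    (by apply Continuous.intervalIntegrable; fun_prop)]
  rw [← sub_zero (∫ t in (j * τ)..((j + 1) * τ), _), ← h1,
    ← intervalIntegral.integral_sub (by apply Continuous.intervalIntegrable; fun_prop)
    (by apply Continuous.intervalIntegrable; fun_prop)]
  congr 1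
  ext t
  field_simp
  ring

/-- Both reconstructions of the densities are asymptotically the same. -/
lemma exists_abs_recLinear_sub_recAverage_le (Φ : C(unitInterval × Ω, Mat n m)) {η : ℝ}
    (hη : 0 < η) : ∃ N₀ : ℕ, ∀ N, N₀ ≤ N → ∀ G : Fin (N + 1) → MatMeas Ω n m,
      |recLinear N G Φ - recAverage N G Φ| ≤
        η * ((1 / N : ℝ) * ∑ j : Fin N, (tvNorm (G j.succ) + tvNorm (G j.castSucc))) := by
  have hK : 0 < ‖frob n m‖ + 1 := by positivity
  have huc : UniformContinuous Φ.curry :=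
    CompactSpace.uniformContinuous_of_continuous Φ.curry.continuous
  -- The curve of slices is uniformly continuous in the sup norm. Taking `N₀ > 1/δ` makes a time
  -- step shorter than `δ`, and the division compensates the norm of the pairing.
  obtain ⟨δ, hδ, hΦ⟩ := Metric.uniformContinuous_iff.1 huc (η / (‖frob n m‖ + 1)) (by positivity)
  obtain ⟨N₀, hN₀⟩ := exists_nat_gt (1 / δ)
  refine ⟨N₀, fun N hN G => ?_⟩
  rw [recLinear_sub_recAverage]
  refine (abs_sum_integral_le (b := fun j => η * (tvNorm (G j.succ) + tvNorm (G j.castSucc)))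
    fun j t ht => ?_).trans (le_of_eq (by rw [← Finset.mul_sum]; ring))
  have hNpos : (0 : ℝ) < N := by exact_mod_cast j.pos
  have hτ : (1 / N : ℝ) < δ := by
    rw [div_lt_iff₀ hNpos]
    rw [div_lt_iff₀ hδ] at hN₀
    have : (N₀ : ℝ) ≤ N := by exact_mod_cast hN
    nlinarith
  have hτ0 : (0 : ℝ) < 1 / N := by positivity
  set τ : ℝ := 1 / N
  have hw0 : 0 ≤ (t - j * τ) / τ := div_nonneg (by linarith [ht.1]) hτ0.le
  have hw1 : (t - j * τ) / τ ≤ 1 := (div_le_one hτ0).2 (by linarith [ht.2])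
  have hsl : ∀ x : Ω, ‖slice Φ t x - slice Φ (j * τ) x‖ ≤ η / (‖frob n m‖ + 1) := by
    intro x
    have h1 : dist (projIcc (0 : ℝ) 1 zero_le_one t) (projIcc 0 1 zero_le_one (j * τ)) < δ := by
      rw [projIcc_of_mem _ (Icc_subset_unit j ht),
        projIcc_of_mem _ (Icc_subset_unit j (left_mem_Icc.2 (step_le j)))]
      rw [Subtype.dist_eq, Real.dist_eq, abs_lt]
      constructor <;> linarith [ht.1, ht.2]
    have h2 := (hΦ h1).le
    rw [dist_eq_norm] at h2
    exact (ContinuousMap.norm_coe_le_norm _ x).trans h2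
  have hb : ∀ μ : MatMeas Ω n m,
      |pairing μ (slice Φ t) - pairing μ (slice Φ (j * τ))| ≤ η * tvNorm μ := by
    intro μ
    refine (abs_pairing_sub_le μ (φ := sliceC Φ t) (ψ := sliceC Φ (j * τ)) hsl).trans ?_
    apply mul_le_mul_of_nonneg_right _ (tvNorm_nonneg μ)
    rw [div_mul_eq_mul_div, div_le_iff₀ hK]
    nlinarith
  rw [abs_mul, mul_add]
  have h1 : |(t - j * τ) / τ - 1 / 2| ≤ 1 := by
    rw [abs_le]
    constructor <;> linarith
  refine (mul_le_of_le_one_left (abs_nonneg _) h1).trans ?_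
  exact (abs_sub _ _).trans (add_le_add (hb _) (hb _))

end TimeSpace

/-! ### Representation of dominated linear forms -/

section Riesz

variable {α : Type*} [MeasurableSpace α] [TopologicalSpace α] [CompactSpace α]
  [TopologicalSpace.MetrizableSpace α] [BorelSpace α] {n m : ℕ}

/-- A linear form dominated by a finite measure has an integrable density. -/
lemma exists_density_of_abs_le (F : C(α, ℝ) →ₗ[ℝ] ℝ) (ρ : Measure α) [IsFiniteMeasure ρ] {K : ℝ}
    (hK : 0 ≤ K) (h : ∀ φ : C(α, ℝ), |F φ| ≤ K * ∫ x, |φ x| ∂ρ) :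
    ∃ g : α → ℝ, Integrable g ρ ∧ ∀ φ : C(α, ℝ), F φ = ∫ x, φ x * g x ∂ρ := by
  let _ := TopologicalSpace.metrizableSpaceMetric α
  let e : C(α, ℝ) →ₗ[ℝ] Lp ℝ 2 ρ := (ContinuousMap.toLp 2 ρ ℝ).toLinearMap
  have hd : DenseRange e := ContinuousMap.toLp_denseRange ℝ ρ ℝ (by simp)
  -- On a finite measure the L¹ norm is bounded by the L² norm, so `F` extends from the dense image
  -- of `C(α)` to the Hilbert space `L²(ρ)`, whose Riesz representative is the density.
  have hn : ∀ φ, ‖F φ‖ ≤ (K * (ρ univ ^ (1 / 1 - 1 / 2 : ℝ)).toReal) * ‖e φ‖ := by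
    intro φ
    rw [Real.norm_eq_abs, mul_assoc]
    refine (h φ).trans (mul_le_mul_of_nonneg_left ?_ hK)
    have hmeas : AEStronglyMeasurable φ ρ := φ.continuous.aestronglyMeasurable
    have h1 := eLpNorm_le_eLpNorm_mul_rpow_measure_univ (p := 1) (q := 2) (by norm_num) hmeas
    have h2 : ‖e φ‖ = (eLpNorm φ 2 ρ).toReal := by
      rw [Lp.norm_def]
      congr 1
      exact eLpNorm_congr_ae (ContinuousMap.coeFn_toLp (p := 2) (𝕜 := ℝ) ρ φ)
    have h3 : ∫ x, |φ x| ∂ρ = (eLpNorm φ 1 ρ).toReal := by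
      rw [eLpNorm_one_eq_lintegral_enorm, ← integral_norm_eq_lintegral_enorm hmeas]
      rfl
    have hfin : eLpNorm φ 2 ρ ≠ ⊤ := by
      rw [← eLpNorm_congr_ae (ContinuousMap.coeFn_toLp (p := 2) (𝕜 := ℝ) ρ φ)]
      exact Lp.eLpNorm_ne_top _
    have hfin' : ρ univ ^ (1 / 1 - 1 / 2 : ℝ) ≠ ⊤ :=
      ENNReal.rpow_ne_top_of_nonneg (by norm_num) (measure_ne_top _ _)
    rw [h2, h3, mul_comm, ← ENNReal.toReal_mul]
    apply ENNReal.toReal_mono (ENNReal.mul_ne_top hfin hfin')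
    simpa using h1
  let g : Lp ℝ 2 ρ := (InnerProductSpace.toDual ℝ (Lp ℝ 2 ρ)).symm (F.extendOfNorm e)
  refine ⟨g, (Lp.memLp g).integrable (by norm_num), fun φ => ?_⟩
  rw [← LinearMap.extendOfNorm_eq hd ⟨_, hn⟩ φ, ← InnerProductSpace.toDual_symm_apply, L2.inner_def]
  apply integral_congr_ae
  filter_upwards [ContinuousMap.coeFn_toLp (p := 2) (𝕜 := ℝ) ρ φ] with x hx
  change ⟪g x, (ContinuousMap.toLp 2 ρ ℝ φ) x⟫_ℝ = _
  rw [hx]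
  simp

/-- A linear form dominated by a finite measure is represented by a matrix-valued measure. -/
theorem exists_matMeas_of_abs_le (F : C(α, Mat n m) →ₗ[ℝ] ℝ) (ρ : Measure α) [IsFiniteMeasure ρ]
    {K : ℝ} (hK : 0 ≤ K) (h : ∀ φ : C(α, Mat n m), |F φ| ≤ K * ∫ x, ‖φ x‖ ∂ρ) :
    ∃ ν : MatMeas α n m, ∀ φ : C(α, Mat n m), F φ = pairing ν φ := by
  have hc : ∀ (i : Fin n) (j : Fin m) (φ : C(α, ℝ)),
      Continuous fun x => (Matrix.single i j (φ x) : Mat n m) := fun i j φ =>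
    continuous_of_entries fun i' j' => by
      simp only [Matrix.single_apply]
      split_ifs
      · exact φ.continuous
      · exact continuous_const
  let S : Fin n → Fin m → C(α, ℝ) →ₗ[ℝ] C(α, Mat n m) := fun i j =>
    { toFun := fun φ => ⟨fun x => Matrix.single i j (φ x), hc i j φ⟩
      map_add' := fun φ ψ => by
        ext1 x
        exact Matrix.single_add i j (φ x) (ψ x)
      map_smul' := fun c φ => by
        ext1 x
        exact (Matrix.smul_single c i j (φ x)).symm }
  have hS : ∀ i j φ, |(F ∘ₗ S i j) φ| ≤ K * ∫ x, |φ x| ∂ρ := by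
    intro i j φ
    refine (h _).trans (mul_le_mul_of_nonneg_left ?_ hK)
    refine integral_mono ?_ ?_ fun x => norm_single_le i j (φ x)
    · exact (ContinuousMap.continuous (S i j φ)).norm.integrable_of_hasCompactSupport
        (HasCompactSupport.of_compactSpace _)
    · exact φ.continuous.abs.integrable_of_hasCompactSupport (HasCompactSupport.of_compactSpace _)
  choose g hg hFg using fun i j => exists_density_of_abs_le (F ∘ₗ S i j) ρ hK (hS i j)
  have hgi : Integrable (fun x => (Matrix.of fun i j => g i j x : Mat n m)) ρ :=
    integrable_of_entries hg
  refine ⟨ρ.withDensityᵥ fun x => Matrix.of fun i j => g i j x, fun φ => ?_⟩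
  rw [(pairing_withDensityᵥ hgi (integrable_continuous _ φ)).2]
  let φe : Fin n → Fin m → C(α, ℝ) := fun i j => ⟨fun x => φ x i j, φ.continuous.matrix_elem i j⟩
  have e1 : φ = ∑ i, ∑ j, S i j (φe i j) := by
    ext1 x
    conv_lhs => rw [Matrix.matrix_eq_sum_single (φ x)]
    simp only [ContinuousMap.coe_sum, Finset.sum_apply]
    rfl
  have e2 : F φ = ∑ i, ∑ j, ∫ x, φ x i j * g i j x ∂ρ := by
    conv_lhs => rw [e1]
    simp only [map_sum]
    exact Finset.sum_congr rfl fun i _ => Finset.sum_congr rfl fun j _ => hFg i j (φe i j)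
  have hint : ∀ i j, Integrable (fun x => φ x i j * g i j x) ρ := fun i j =>
    (hg i j).bdd_mul (φe i j).continuous.aestronglyMeasurable
      (Eventually.of_forall fun x => (φe i j).norm_coe_le_norm x)
  rw [e2]
  simp only [frob_eq_sum, Matrix.of_apply]
  rw [integral_finsetSum _ fun i _ => integrable_finsetSum _ fun j _ => hint i j]
  exact Finset.sum_congr rfl fun i _ => (integral_finsetSum _ fun j _ => hint i j).symm

end Riesz

/-! ### Weak* compactness and independence of the reconstruction -/

section Extraction

variable {d n m : ℕ} {Ω : Set (Eu d)} [CompactSpace Ω]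

/-- The total variation of the piecewise constant reconstruction. -/
noncomputable def recVariation (N : ℕ) (q : Fin N → MatMeas Ω n m) : Measure (unitInterval × Ω) :=
  ∑ j : Fin N, (((volume : Measure ℝ).restrict
    (Ioc ((j : ℝ) * (1 / N)) ((j + 1) * (1 / N)))).map (projIcc 0 1 zero_le_one)).prod
      (q j).variation

instance (N : ℕ) (q : Fin N → MatMeas Ω n m) : IsFiniteMeasure (recVariation N q) := by
  unfold recVariation
  infer_instance

lemma measurable_projIcc_unit : Measurable (projIcc (0 : ℝ) 1 zero_le_one) :=
  continuous_projIcc.measurable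

lemma recVariation_univ (N : ℕ) (q : Fin N → MatMeas Ω n m) :
    recVariation N q univ = ENNReal.ofReal ((1 / N : ℝ) * ∑ j, tvNorm (q j)) := by
  rw [recVariation, Measure.finsetSum_apply, Finset.mul_sum, ENNReal.ofReal_sum_of_nonneg fun j _ =>
    mul_nonneg (by positivity) (tvNorm_nonneg _)]
  refine Finset.sum_congr rfl fun j _ => ?_
  rw [← univ_prod_univ, Measure.prod_prod, Measure.map_apply measurable_projIcc_unit
    MeasurableSet.univ, preimage_univ, Measure.restrict_apply_univ, Real.volume_Ioc,
    ENNReal.ofReal_mul (by positivity), tvNorm, ENNReal.ofReal_toReal (measure_ne_top _ _)]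
  congr 2
  ring

/-- A bound by the integral of `‖Φ‖` against a measure is finer than one by its sup norm. It
survives in the limit, and it is what makes the limit functional a measure. -/
lemma abs_recConst_le_integral (N : ℕ) (q : Fin N → MatMeas Ω n m)
    (Φ : C(unitInterval × Ω, Mat n m)) :
    |recConst N q Φ| ≤ ‖frob n m‖ * ∫ p, ‖Φ p‖ ∂(recVariation N q) := by
  have hi : ∀ μ : Measure (unitInterval × Ω), IsFiniteMeasure μ →
      Integrable (fun p => ‖Φ p‖) μ := by
    intro μ _
    exact Φ.continuous.norm.integrable_of_hasCompactSupport (HasCompactSupport.of_compactSpace _)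
  rw [recVariation, integral_finsetSum_measure fun j _ => hi _ inferInstance, Finset.mul_sum]
  refine (Finset.abs_sum_le_sum_abs _ _).trans (Finset.sum_le_sum fun j _ => ?_)
  rw [integral_prod _ (hi _ inferInstance)]
  have hsm : StronglyMeasurable fun t : unitInterval => ∫ x, ‖Φ (t, x)‖ ∂(q j).variation := by
    have h : StronglyMeasurable fun p : unitInterval × Ω => ‖Φ p‖ :=
      Φ.continuous.norm.stronglyMeasurable
    exact h.integral_prod_right
  rw [integral_map measurable_projIcc_unit.aemeasurable hsm.aestronglyMeasurable,
    intervalIntegral.integral_of_le (step_le j), ← integral_const_mul]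
  have hb : ∀ t : ℝ, |pairing (q j) (slice Φ t)| ≤
      ‖frob n m‖ * ∫ x, ‖Φ (projIcc 0 1 zero_le_one t, x)‖ ∂(q j).variation := fun t =>
    abs_pairing_le_integral (q j) (slice Φ t)
  rw [← Real.norm_eq_abs]
  refine norm_integral_le_of_norm_le ?_ (Eventually.of_forall hb)
  apply Integrable.const_mul
  refine Integrable.of_bound (C := ‖Φ‖ * (q j).variation.real univ)
    (hsm.comp_measurable measurable_projIcc_unit).aestronglyMeasurable
    (Eventually.of_forall fun t => ?_)
  exact norm_integral_le_of_norm_le_const (Eventually.of_forall fun x => by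
    rw [norm_norm]
    exact Φ.norm_coe_le_norm _)

/-- Weak* sequential compactness of piecewise constant reconstructions. -/
theorem exists_subseq_weakStarTendsto {N : ℕ → ℕ} {q : ∀ i, Fin (N i) → MatMeas Ω n m} {B : ℝ}
    (hB : ∀ i, (1 / N i : ℝ) * ∑ j, tvNorm (q i j) ≤ B) :
    ∃ φ : ℕ → ℕ, StrictMono φ ∧ ∃ ν : MatMeas (unitInterval × Ω) n m,
      WeakStarTendsto (fun i => recConst (N (φ i)) (q (φ i))) ν := by
  have hK : 0 ≤ ‖frob n m‖ := by positivity
  -- Sequential Banach–Alaoglu, available because the space of continuous functions is separable.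
  obtain ⟨F, -, φ, hφ, hF⟩ := WeakDual.isSeqCompact_closedBall ℝ C(unitInterval × Ω, Mat n m) 0
    (‖frob n m‖ * B) (x := fun i => StrongDual.toWeakDual (recConstCLM (N i) (q i))) fun i => by
      rw [mem_preimage, mem_closedBall_zero_iff]
      exact (norm_recConstCLM_le _ _).trans (mul_le_mul_of_nonneg_left (hB i) hK)
  have hF' : ∀ Φ, Tendsto (fun i => recConst (N (φ i)) (q (φ i)) Φ) atTop (𝓝 (F Φ)) := fun Φ =>
    (WeakDual.eval_continuous Φ).tendsto F |>.comp hF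
  let ρ : ℕ → FiniteMeasure (unitInterval × Ω) := fun i =>
    ⟨recVariation (N (φ i)) (q (φ i)), inferInstance⟩
  have hρ : ∀ i, ρ i ∈ {μ : FiniteMeasure (unitInterval × Ω) | μ.mass ≤ B.toNNReal} := by
    intro i
    rw [mem_ofPred_eq, ← ENNReal.coe_le_coe, FiniteMeasure.ennreal_mass]
    change recVariation (N (φ i)) (q (φ i)) univ ≤ _
    rw [recVariation_univ]
    exact ENNReal.ofReal_le_ofReal (hB _)
  -- The variations have bounded mass. An ultrafilter limit `ρ₀` of them is enough, since it serves
  -- only to dominate the functional `F` found above.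
  let U : Ultrafilter ℕ := Ultrafilter.of atTop
  obtain ⟨ρ₀, -, hρ₀⟩ := (isCompact_setOfPred_finiteMeasure_le_of_compactSpace
    (unitInterval × Ω) B.toNNReal).ultrafilter_le_nhds' (U.map ρ)
      (Eventually.of_forall hρ : ∀ᶠ i in (U : Filter ℕ), _)
  have hbound : ∀ Φ : C(unitInterval × Ω, Mat n m),
      |F Φ| ≤ ‖frob n m‖ * ∫ p, ‖Φ p‖ ∂(ρ₀ : Measure (unitInterval × Ω)) := by
    intro Φ
    have h1 : Tendsto (fun i => |recConst (N (φ i)) (q (φ i)) Φ|) U (𝓝 |F Φ|) :=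
      ((hF' Φ).mono_left (Ultrafilter.of_le atTop)).abs
    have h2 := FiniteMeasure.tendsto_iff_forall_integral_tendsto.1
      (show Tendsto ρ U (𝓝 ρ₀) from hρ₀)
      (BoundedContinuousFunction.mkOfCompact ⟨fun p => ‖Φ p‖, Φ.continuous.norm⟩)
    exact le_of_tendsto_of_tendsto' h1 (h2.const_mul _) fun i => abs_recConst_le_integral _ _ Φ
  obtain ⟨ν, hν⟩ := exists_matMeas_of_abs_le
    (WeakDual.toStrongDual F).toLinearMap (ρ₀ : Measure (unitInterval × Ω)) hK hbound
  refine ⟨φ, hφ, ν, fun Φ => ?_⟩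
  rw [← hν Φ]
  exact hF' Φ

lemma WeakStarTendsto.comp {F : ℕ → C(unitInterval × Ω, Mat n m) → ℝ}
    {ν : MatMeas (unitInterval × Ω) n m} (h : WeakStarTendsto F ν) {φ : ℕ → ℕ}
    (hφ : Tendsto φ atTop atTop) : WeakStarTendsto (fun i => F (φ i)) ν :=
  fun Φ => (h Φ).comp hφ

lemma recConst_transpose (N : ℕ) {q : Fin N → MatMeas Ω n n} (hq : ∀ j, SymmValued (q j))
    (Φ : C(unitInterval × Ω, Mat n n)) :
    recConst N q ⟨fun p => (Φ p)ᵀ, continuous_of_entries fun i j => Φ.continuous.matrix_elem j i⟩ =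
      recConst N q Φ := by
  refine Finset.sum_congr rfl fun j _ => ?_
  congr 1
  ext t
  exact pairing_transpose_of_symmValued (hq j) (sliceC Φ t)

/-- Symmetry is invariance of the pairing under transposing the test function, which is stable under
weak* limits. -/
lemma symmValued_of_weakStarTendsto {N : ℕ → ℕ} {q : ∀ i, Fin (N i) → MatMeas Ω n n}
    (hq : ∀ i j, SymmValued (q i j)) {ν : MatMeas (unitInterval × Ω) n n}
    (h : WeakStarTendsto (fun i => recConst (N i) (q i)) ν) : SymmValued ν := by
  refine symmValued_of_pairing_transpose fun φ => ?_
  have h1 := h ⟨fun p => (φ p)ᵀ, continuous_of_entries fun i j => φ.continuous.matrix_elem j i⟩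
  refine tendsto_nhds_unique h1 ?_
  simp only [recConst_transpose _ (hq _)]
  exact h φ

/-- Linear forms that are equi-Lipschitz in the uniform norm and tend to `0` on smooth functions
tend to `0` on all continuous functions. -/
lemma tendsto_zero_of_smooth {D : ℕ → C(unitInterval × Ω, Mat n m) → ℝ} {B : ℝ}
    (hD : ∀ i Φ Ψ (c : ℝ), 0 ≤ c → (∀ p, ‖Φ p - Ψ p‖ ≤ c) → |D i Φ - D i Ψ| ≤ B * c)
    (h : ∀ (f : ℝ × Eu d → Mat n m) (hf : ContDiff ℝ (⊤ : ℕ∞) f),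
      Tendsto (fun i => D i (resQ hf.continuous)) atTop (𝓝 0))
    (Φ : C(unitInterval × Ω, Mat n m)) : Tendsto (fun i => D i Φ) atTop (𝓝 0) := by
  rw [Metric.tendsto_atTop]
  intro η hη
  -- With this accuracy the replacement of `Φ` costs at most `η / 2`, uniformly in `i`.
  obtain ⟨f, hf, hfΦ⟩ := exists_smooth_near Φ (ε := η / (2 * (|B| + 1))) (by positivity)
  obtain ⟨N, hN⟩ := Metric.tendsto_atTop.1 (h f hf) (η / 2) (by positivity)
  refine ⟨N, fun i hi => ?_⟩
  have h1 := hN i hi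
  have h2 := hD i (resQ hf.continuous) Φ _ (by positivity) hfΦ
  rw [Real.dist_eq, sub_zero] at h1 ⊢
  have h3 : B * (η / (2 * (|B| + 1))) ≤ η / 2 := by
    rw [mul_div_assoc', div_le_iff₀ (by positivity)]
    nlinarith [le_abs_self B, abs_nonneg B]
  have h4 := abs_sub_abs_le_abs_sub (D i Φ) (D i (resQ hf.continuous))
  rw [abs_sub_comm] at h4
  linarith

lemma recConst_sub (N : ℕ) (q : Fin N → MatMeas Ω n m) (Φ Ψ : C(unitInterval × Ω, Mat n m)) :
    recConst N q (Φ - Ψ) = recConst N q Φ - recConst N q Ψ :=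
  map_sub (recConstₗ N q) Φ Ψ

lemma abs_recConst_sub_le (N : ℕ) (q : Fin N → MatMeas Ω n m)
    {Φ Ψ : C(unitInterval × Ω, Mat n m)} {c : ℝ} (h : ∀ p, ‖Φ p - Ψ p‖ ≤ c) :
    |recConst N q Φ - recConst N q Ψ| ≤ c * ‖frob n m‖ * ((1 / N : ℝ) * ∑ j, tvNorm (q j)) := by
  rw [← recConst_sub]
  exact abs_recConst_le N q h

variable {Sig : Set ℝ} {M : Sig → Type*}
  [∀ σ, NormedAddCommGroup (M σ)] [∀ σ, InnerProductSpace ℝ (M σ)]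
  [∀ σ, FiniteDimensional ℝ (M σ)]

lemma IsReconstruction.sum_tvNorm_le {p : ∀ σ, Seminorm ℝ (M σ)}
    {R : ∀ σ, M σ →ₗ[ℝ] MatMeas Ω n m} (hR : IsReconstruction p R) :
    ∃ C : ℝ, 0 ≤ C ∧ ∀ σ (N : ℕ) (q : Fin N → M σ),
      (1 / N : ℝ) * ∑ j, tvNorm (R σ (q j)) ≤ C * ((1 / N : ℝ) * ∑ j, p σ (q j)) := by
  obtain ⟨C, hC⟩ := hR
  refine ⟨max C 0, le_max_right _ _, fun σ N q => ?_⟩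
  rw [mul_left_comm]
  refine mul_le_mul_of_nonneg_left ?_ (by positivity)
  rw [Finset.mul_sum]
  exact Finset.sum_le_sum fun j _ => (hC σ _).trans
    (mul_le_mul_of_nonneg_right (le_max_left _ _) (apply_nonneg _ _))

/-- Equivalent reconstructions have the same action on slices of smooth functions, up to a
small error. -/
lemma RecEquiv.exists_abs_recConst_sub_le (hΩ : UniqueDiffOn ℝ Ω) {p : ∀ σ, Seminorm ℝ (M σ)}
    (hp : ∀ σ x, p σ x = 0 → x = 0) {R R' : ∀ σ, M σ →ₗ[ℝ] MatMeas Ω n m} (h : RecEquiv p R R')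
    {f : ℝ × Eu d → Mat n m} (hf : ContDiff ℝ (⊤ : ℕ∞) f) :
    ∃ ε : Sig → ℝ, (∀ σ, 0 ≤ ε σ) ∧ Tendsto ε (toZero Sig) (𝓝 0) ∧
      ∀ σ (N : ℕ) (q : Fin N → M σ),
        |recConst N (fun j => R σ (q j)) (resQ hf.continuous) -
          recConst N (fun j => R' σ (q j)) (resQ hf.continuous)| ≤
            ε σ * ((1 / N : ℝ) * ∑ j, p σ (q j)) := by
  obtain ⟨ε, hε, hlim, h⟩ := h.exists_abs_sub_le hp
  obtain ⟨r, hr, hfr⟩ := exists_c1Norm_slice_le (isCompact_iff_compactSpace.2 ‹_›) hΩ hf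
  refine ⟨fun σ => ε σ * r, fun σ => mul_nonneg (hε σ).le hr, by simpa using hlim.mul_const r,
    fun σ N q => ?_⟩
  rw [recConst, recConst, ← Finset.sum_sub_distrib]
  have e1 : ∀ j : Fin N, (∫ t in ((j : ℝ) * (1 / N))..((j + 1) * (1 / N)),
      pairing (R σ (q j)) (slice (resQ hf.continuous) t)) -
      (∫ t in ((j : ℝ) * (1 / N))..((j + 1) * (1 / N)),
        pairing (R' σ (q j)) (slice (resQ hf.continuous) t)) =
      ∫ t in ((j : ℝ) * (1 / N))..((j + 1) * (1 / N)),
        (pairing (R σ (q j)) (slice (resQ hf.continuous) t) -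
          pairing (R' σ (q j)) (slice (resQ hf.continuous) t)) := fun j =>
    (intervalIntegral.integral_sub
      ((continuous_pairing_slice _ _).intervalIntegrable _ _)
      ((continuous_pairing_slice _ _).intervalIntegrable _ _)).symm
  simp only [e1]
  refine (abs_sum_integral_le (b := fun j => ε σ * r * p σ (q j)) fun j t ht => ?_).trans
    (le_of_eq (by rw [← Finset.mul_sum]; ring))
  have ht' := Icc_subset_unit j ht
  rw [slice_resQ hf.continuous ht']
  refine (h σ (fun y => f (t, y))
    ((hf.of_le (by exact_mod_cast le_top)).comp (contDiff_prodMk_right t)).contDiffOn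
      (q j)).trans ?_
  exact mul_le_mul_of_nonneg_right (mul_le_mul_of_nonneg_left (hfr t ht') (hε σ).le)
    (apply_nonneg _ _)

/-- Equivalent reconstructions have the same weak* limits. -/
theorem WeakStarTendsto.of_recEquiv (hΩ : UniqueDiffOn ℝ Ω) {p : ∀ σ, Seminorm ℝ (M σ)}
    (hp : ∀ σ x, p σ x = 0 → x = 0) {R R' : ∀ σ, M σ →ₗ[ℝ] MatMeas Ω n m}
    (hR : IsReconstruction p R) (hR' : IsReconstruction p R') (h : RecEquiv p R R')
    {N : ℕ → ℕ} {s : ℕ → Sig} (hs : Tendsto s atTop (toZero Sig)) {q : ∀ i, Fin (N i) → M (s i)}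
    {B : ℝ} (hB : ∀ i, (1 / N i : ℝ) * ∑ j, p (s i) (q i j) ≤ B)
    {ν : MatMeas (unitInterval × Ω) n m}
    (hν : WeakStarTendsto (fun i => recConst (N i) fun j => R' (s i) (q i j)) ν) :
    WeakStarTendsto (fun i => recConst (N i) fun j => R (s i) (q i j)) ν := by
  obtain ⟨C, hC0, hC⟩ := hR.sum_tvNorm_le
  obtain ⟨C', hC0', hC'⟩ := hR'.sum_tvNorm_le
  intro Φ
  have key : Tendsto (fun i => recConst (N i) (fun j => R (s i) (q i j)) Φ -
      recConst (N i) (fun j => R' (s i) (q i j)) Φ) atTop (𝓝 0) := by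
    -- Both families have uniformly bounded total variation, so smooth `Φ` suffice; for these the
    -- equivalence error applies slice by slice.
    refine tendsto_zero_of_smooth (D := fun i Φ => recConst (N i) (fun j => R (s i) (q i j)) Φ -
      recConst (N i) (fun j => R' (s i) (q i j)) Φ) (B := ‖frob n m‖ * (C * B) +
        ‖frob n m‖ * (C' * B)) ?_ ?_ Φ
    · intro i Φ Ψ c hc0 hc
      have h1 := abs_recConst_sub_le (N i) (fun j => R (s i) (q i j)) hc
      have h2 := abs_recConst_sub_le (N i) (fun j => R' (s i) (q i j)) hc
      have h3 := (hC (s i) (N i) (q i)).trans (mul_le_mul_of_nonneg_left (hB i) hC0)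
      have h4 := (hC' (s i) (N i) (q i)).trans (mul_le_mul_of_nonneg_left (hB i) hC0')
      have h5 := h1.trans (mul_le_mul_of_nonneg_left h3 (by positivity))
      have h6 := h2.trans (mul_le_mul_of_nonneg_left h4 (by positivity))
      rw [sub_sub_sub_comm]
      refine (abs_sub _ _).trans ((add_le_add h5 h6).trans (le_of_eq (by ring)))
    · intro f hf
      obtain ⟨ε, hε, hlim, hb⟩ := h.exists_abs_recConst_sub_le hΩ hp hf
      refine squeeze_zero_norm (fun i => (hb (s i) (N i) (q i)).trans
        (mul_le_mul_of_nonneg_left (hB i) (hε _))) ?_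
      simpa using (hlim.comp hs).mul_const B
  simpa using key.add (hν Φ)

/-- The piecewise linear and piecewise constant reconstructions have the same weak* limits. -/
theorem WeakStarTendsto.recLinear {N : ℕ → ℕ} (hN : Tendsto N atTop atTop)
    {G : ∀ i, Fin (N i + 1) → MatMeas Ω n m} {B : ℝ}
    (hB : ∀ i, (1 / N i : ℝ) * ∑ j : Fin (N i), (tvNorm (G i j.succ) + tvNorm (G i j.castSucc)) ≤ B)
    {ν : MatMeas (unitInterval × Ω) n m}
    (h : WeakStarTendsto (fun i => recAverage (N i) (G i)) ν) :
    WeakStarTendsto (fun i => MatrixOT.recLinear (N i) (G i)) ν := by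
  intro Φ
  have key : Tendsto (fun i => MatrixOT.recLinear (N i) (G i) Φ - recAverage (N i) (G i) Φ)
      atTop (𝓝 0) := by
    rw [Metric.tendsto_atTop]
    intro η hη
    obtain ⟨N₀, hN₀⟩ := exists_abs_recLinear_sub_recAverage_le Φ (η := η / (|B| + 1))
      (by positivity)
    obtain ⟨i₀, hi₀⟩ := eventually_atTop.1 (hN.eventually_ge_atTop N₀)
    refine ⟨i₀, fun i hi => ?_⟩
    rw [Real.dist_eq, sub_zero]
    refine (hN₀ _ (hi₀ i hi) (G i)).trans_lt ?_
    have h1 : η / (|B| + 1) * ((1 / N i : ℝ) *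
        ∑ j : Fin (N i), (tvNorm (G i j.succ) + tvNorm (G i j.castSucc))) ≤ η / (|B| + 1) * |B| :=
      mul_le_mul_of_nonneg_left ((hB i).trans (le_abs_self B)) (by positivity)
    refine h1.trans_lt ?_
    rw [div_mul_eq_mul_div, div_lt_iff₀ (by positivity)]
    nlinarith [abs_nonneg B]
  simpa using key.add (h Φ)

end Extraction

/-! ### A priori bounds from the discrete action -/

section Bound

variable {d : ℕ} {Ω : Set (Eu d)} [CompactSpace Ω] {n k : ℕ} {Sig : Set ℝ} {Xbar Y : Sig → Type*}
  [∀ σ, NormedAddCommGroup (Xbar σ)] [∀ σ, InnerProductSpace ℝ (Xbar σ)]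
  [∀ σ, FiniteDimensional ℝ (Xbar σ)]
  [∀ σ, NormedAddCommGroup (Y σ)] [∀ σ, InnerProductSpace ℝ (Y σ)]
  [∀ σ, FiniteDimensional ℝ (Y σ)]
  {𝓜 : DiscreteModules Ω n k Sig Xbar Y}

lemma EReal.le_add_toReal_of_sub_le {a b : ℝ} {J : ℝ≥0∞} (hJ : J ≠ ⊤)
    (h : (a : EReal) - ((J : ℝ≥0∞) : EReal) ≤ (b : EReal)) : a ≤ b + J.toReal := by
  lift J to ℝ≥0 using hJ
  have h1 : (a : EReal) - ((J : ℝ) : EReal) ≤ (b : EReal) := h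
  rw [← EReal.coe_sub, EReal.coe_le_coe_iff] at h1
  simp only [ENNReal.coe_toReal]
  linarith

/-- The Fenchel–Young inequality for the discrete action. -/
lemma DiscreteModules.inner_add_inner_le {σ : Sig} {G : 𝓜.X σ} {q : Y σ} {R : Xbar σ}
    (hJ : 𝓜.J σ G q R ≠ ⊤) {u : Y σ} {W : Xbar σ} {b : ℝ} (h : 𝓜.Jstar σ G u W ≤ (b : EReal)) :
    ⟪q, u⟫_ℝ + ⟪R, W⟫_ℝ ≤ b + (𝓜.J σ G q R).toReal :=
  EReal.le_add_toReal_of_sub_le hJ ((le_iSup (fun p : Y σ × Xbar σ =>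
    ((⟪p.1, u⟫_ℝ + ⟪p.2, W⟫_ℝ : ℝ) : EReal) - ((𝓜.J σ G p.1 p.2 : ℝ≥0∞) : EReal)) (q, R)).trans h)

lemma IsQuasiIsometric.exists_le {n m : ℕ} {M : Sig → Type*} [∀ σ, NormedAddCommGroup (M σ)]
    [∀ σ, InnerProductSpace ℝ (M σ)] {p : ∀ σ, Seminorm ℝ (M σ)}
    {R : ∀ σ, M σ →ₗ[ℝ] MatMeas Ω n m} (h : IsQuasiIsometric p R) :
    ∃ C : ℝ, 0 < C ∧ (∀ σ f, p σ f ≤ C * tvNorm (R σ f)) ∧ ∀ σ f, tvNorm (R σ f) ≤ C * p σ f := by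
  obtain ⟨C, hC, h⟩ := h
  refine ⟨C, hC, fun σ f => ?_, fun σ f => (h σ f).2⟩
  have := (h σ f).1
  rwa [inv_mul_le_iff₀ hC] at this

/-- The discrete action controls the `L¹` norms of the fluxes. -/
lemma DiscreteModules.exists_flux_bound (h : 𝓜.ConsistentJ) :
    ∃ A : ℝ, 0 ≤ A ∧ ∀ σ (G : 𝓜.X σ) (q : Y σ) (R : Xbar σ), 𝓜.J σ G q R ≠ ⊤ → ∀ s : ℝ, 0 < s →
      𝓜.normY σ q + 𝓜.normX σ R ≤ A * ((𝓜.J σ G q R).toReal / s + s * 𝓜.normX σ G) := by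
  obtain ⟨⟨C, hC⟩, -⟩ := h
  obtain ⟨C₁, hC₁, hX, -⟩ := 𝓜.recX_quasi.exists_le
  obtain ⟨C₂, hC₂, hY, -⟩ := 𝓜.recY_quasi.exists_le
  -- The factors `n * k` and `n * n` come from `tvNorm_le_of_pairing_le`. In `max C 1`, the `1`
  -- makes the constant positive and lets it absorb the coefficient of the action.
  refine ⟨(C₂ * (n * k) + C₁ * (n * n)) * max C 1, by positivity, fun σ G q R hJ s hs => ?_⟩
  have hg : 0 ≤ 𝓜.normX σ G := apply_nonneg _ _
  have hj : 0 ≤ (𝓜.J σ G q R).toReal := ENNReal.toReal_nonneg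
  set b : ℝ := max C 1 * ((𝓜.J σ G q R).toReal / s + s * 𝓜.normX σ G) with hb
  have key : ∀ (u : C(Ω, Mat n k)) (W : C(Ω, Mat n n)), ‖u‖ ^ 2 + ‖W‖ ^ 2 ≤ 1 →
      pairing (𝓜.recY σ q) u + pairing (𝓜.recX σ R) W ≤ b := by
    intro u W huW
    -- Fenchel–Young with test functions scaled by `s`: the linear part scales with `s`, the
    -- stability bound with `s²`, and dividing by `s` leaves `J / s + s ‖G‖₁`.
    have h1 := 𝓜.inner_add_inner_le hJ (hC σ G (s • u) (s • W))
    rw [inner_adj, inner_adj] at h1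
    have e1 : pairing (𝓜.recY σ q) (s • u : C(Ω, Mat n k)) = s * pairing (𝓜.recY σ q) u :=
      map_smul (pairingCLM (𝓜.recY σ q)) s u
    have e2 : pairing (𝓜.recX σ R) (s • W : C(Ω, Mat n n)) = s * pairing (𝓜.recX σ R) W :=
      map_smul (pairingCLM (𝓜.recX σ R)) s W
    rw [e1, e2, norm_smul, norm_smul, Real.norm_of_nonneg hs.le] at h1
    have h2 : C * ((s * ‖u‖) ^ 2 + (s * ‖W‖) ^ 2) * 𝓜.normX σ G ≤
        max C 1 * s ^ 2 * 𝓜.normX σ G := by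
      have e3 : C * ((s * ‖u‖) ^ 2 + (s * ‖W‖) ^ 2) = C * (s ^ 2 * (‖u‖ ^ 2 + ‖W‖ ^ 2)) := by ring
      rw [e3]
      apply mul_le_mul_of_nonneg_right _ hg
      have h3 : s ^ 2 * (‖u‖ ^ 2 + ‖W‖ ^ 2) ≤ s ^ 2 := mul_le_of_le_one_right (by positivity) huW
      calc C * (s ^ 2 * (‖u‖ ^ 2 + ‖W‖ ^ 2))
          ≤ max C 1 * (s ^ 2 * (‖u‖ ^ 2 + ‖W‖ ^ 2)) :=
            mul_le_mul_of_nonneg_right (le_max_left _ _) (by positivity)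
        _ ≤ max C 1 * s ^ 2 := mul_le_mul_of_nonneg_left h3 (by positivity)
    have h4 : (𝓜.J σ G q R).toReal ≤ max C 1 * (𝓜.J σ G q R).toReal :=
      le_mul_of_one_le_left hj (le_max_right _ _)
    have h5 : s * (pairing (𝓜.recY σ q) u + pairing (𝓜.recX σ R) W) ≤ s * b := by
      have e4 : s * b = max C 1 * s ^ 2 * 𝓜.normX σ G + max C 1 * (𝓜.J σ G q R).toReal := by
        rw [hb]
        field_simp
        ring
      rw [e4]
      linarith
    exact le_of_mul_le_mul_left h5 hs
  have h0 : ∀ {l m : ℕ} (μ : MatMeas Ω l m), pairing μ (0 : C(Ω, Mat l m)) = 0 := fun μ =>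
    map_zero (pairingCLM μ)
  have hq : tvNorm (𝓜.recY σ q) ≤ n * k * b := by
    refine tvNorm_le_of_pairing_le _ fun u hu => ?_
    have hu1 : ‖u‖ ≤ 1 := (ContinuousMap.norm_le _ zero_le_one).2 hu
    have h1 := key u 0 (by rw [norm_zero]; nlinarith [norm_nonneg u])
    rwa [h0, add_zero] at h1
  have hR : tvNorm (𝓜.recX σ R) ≤ n * n * b := by
    refine tvNorm_le_of_pairing_le _ fun W hW => ?_
    have hW1 : ‖W‖ ≤ 1 := (ContinuousMap.norm_le _ zero_le_one).2 hW
    have h1 := key 0 W (by rw [norm_zero]; nlinarith [norm_nonneg W])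
    rwa [h0, zero_add] at h1
  calc 𝓜.normY σ q + 𝓜.normX σ R ≤ C₂ * (n * k * b) + C₁ * (n * n * b) :=
        add_le_add ((hY σ q).trans (mul_le_mul_of_nonneg_left hq hC₂.le))
          ((hX σ R).trans (mul_le_mul_of_nonneg_left hR hC₁.le))
    _ = _ := by rw [hb]; ring

/-- This is what excludes transport from the mass balance: tested with the identity, the flux enters
only through the consistency error of `D_σ`. -/
lemma FirstOrderOp.apply_one (D : FirstOrderOp d n k) (Ω : Set (Eu d)) (x : Eu d) :
    D.apply Ω (fun _ => (1 : Mat n n)) x = 0 := by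
  simp [FirstOrderOp.apply, pd, D.zeroth_one]

/-- The identity as a constant continuous function. -/
noncomputable def oneC (α : Type*) [TopologicalSpace α] (n : ℕ) : C(α, Mat n n) :=
  ⟨fun _ => 1, continuous_const⟩

/-- Only the symmetric part of a reconstruction acts on symmetric functions. -/
lemma DiscreteModules.pairing_rec_projection {RX : ∀ σ, Xbar σ →ₗ[ℝ] MatMeas Ω n n}
    (hRX : ∀ σ, ∀ x ∈ (𝓜.X σ)ᗮ, AntisymmValued (RX σ x)) {σ : Sig} (R : Xbar σ)
    {φ : C(Ω, Mat n n)} (hφ : ∀ x, (φ x).IsSymm) :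
    pairing (RX σ ((𝓜.X σ).orthogonalProjectionOnto R)) φ = pairing (RX σ R) φ := by
  have h0 : R - ((𝓜.X σ).orthogonalProjectionOnto R : Xbar σ) ∈ (𝓜.X σ)ᗮ :=
    Submodule.sub_starProjection_mem_orthogonal R
  have h1 := pairing_eq_zero_of_antisymmValued (hRX σ _ h0) hφ
  rw [map_sub, pairing_sub_measure] at h1
  linarith

/-- The increments of the discrete mass. -/
lemma DiscreteModules.pairing_step {N : ℕ} (hN : 0 < N) {σ : Sig} {G₀ G₁ : 𝓜.X σ}
    {μ : DiscreteTriple N (𝓜.X σ) (Y σ) (Xbar σ)} (h : 𝓜.IsCE N σ G₀ G₁ μ) (j : Fin N)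
    {φ : C(Ω, Mat n n)} (hφ : ∀ x, (φ x).IsSymm) :
    pairing (𝓜.recX σ (μ.G j.succ)) φ - pairing (𝓜.recX σ (μ.G j.castSucc)) φ =
      (1 / N : ℝ) * (-pairing (𝓜.recX σ (𝓜.D σ (μ.q j))) φ + pairing (𝓜.recX σ (μ.R j)) φ) := by
  have hN' : (0 : ℝ) < N := by exact_mod_cast hN
  have h1 : μ.G j.succ - μ.G j.castSucc =
      (1 / N : ℝ) • (-𝓜.D σ (μ.q j) + (𝓜.X σ).orthogonalProjectionOnto (μ.R j)) := by
    rw [← h.1 j, smul_smul, mul_inv_cancel₀ (by positivity), one_smul]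
  have h2 := congrArg (fun x : 𝓜.X σ => pairing (𝓜.recX σ (x : Xbar σ)) φ) h1
  simp only [Submodule.coe_sub, map_sub, Submodule.coe_smul, map_smul, Submodule.coe_add, map_add,
    Submodule.coe_neg, map_neg, pairing_sub_measure, pairing_smul_measure,
    pairing_add_measure] at h2
  rw [h2, DiscreteModules.pairing_rec_projection 𝓜.recX_antisymm _ hφ]
  congr 2
  exact map_neg (pairingₗ φ) _

/-- Finiteness of each term needs a positive time step, because `0 * ⊤ = 0` in `ℝ≥0∞`. -/
lemma DiscreteModules.action_le_iff {N : ℕ} (hN : 0 < N) {σ : Sig}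
    {μ : DiscreteTriple N (𝓜.X σ) (Y σ) (Xbar σ)} {J : ℝ≥0∞} (hJ : J ≠ ⊤)
    (h : 𝓜.action N σ μ ≤ J) :
    (∀ j : Fin N, 𝓜.J σ ((1 / 2 : ℝ) • (μ.G j.castSucc + μ.G j.succ)) (μ.q j) (μ.R j) ≠ ⊤) ∧
    (1 / N : ℝ) * ∑ j : Fin N,
      (𝓜.J σ ((1 / 2 : ℝ) • (μ.G j.castSucc + μ.G j.succ)) (μ.q j) (μ.R j)).toReal ≤ J.toReal := by
  have hN' : (0 : ℝ) < N := by exact_mod_cast hN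
  have h0 : ENNReal.ofReal (1 / N) ≠ 0 := by
    rw [Ne, ENNReal.ofReal_eq_zero, not_le]
    positivity
  have h1 : 𝓜.action N σ μ ≠ ⊤ := ne_top_of_le_ne_top hJ h
  have h2 : ∑ j : Fin N,
      𝓜.J σ ((1 / 2 : ℝ) • (μ.G j.castSucc + μ.G j.succ)) (μ.q j) (μ.R j) ≠ ⊤ := fun ht =>
    h1 (by rw [action, ht, ENNReal.mul_top h0])
  have h3 := fun j => (ENNReal.sum_ne_top.1 h2) j (Finset.mem_univ j)
  refine ⟨h3, ?_⟩
  have h4 := ENNReal.toReal_mono hJ h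
  rwa [action, ENNReal.toReal_mul, ENNReal.toReal_ofReal (by positivity),
    ENNReal.toReal_sum fun j _ => h3 j] at h4

/-- The a priori bound on the discrete `L¹` norm. -/
theorem DiscreteModules.exists_norm1_bound {D : FirstOrderOp d n k} (h : 𝓜.Consistent D) :
    ∃ ε : Sig → ℝ, Tendsto ε (toZero Sig) (𝓝 0) ∧ ∀ (E m₀ : ℝ) (J : ℝ≥0), ∃ C : ℝ,
      ∀ (N : ℕ) σ (G₀ G₁ : 𝓜.X σ) (μ : DiscreteTriple N (𝓜.X σ) (Y σ) (Xbar σ)), 0 < N →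
        ε σ ≤ E → 𝓜.IsCE N σ G₀ G₁ μ → G₀ ∈ 𝓜.Xpos σ → pairing (𝓜.recX σ G₀) (oneC Ω n) ≤ m₀ →
        𝓜.action N σ μ ≤ J → 𝓜.norm1 N σ μ ≤ C := by
  obtain ⟨⟨RY, -, ε, hε, hεlim, hD⟩, hcJ⟩ := h
  refine ⟨ε, hεlim, fun E m₀ J => ?_⟩
  obtain ⟨A, hA, hflux⟩ := 𝓜.exists_flux_bound hcJ
  obtain ⟨C₁, hC₁, hX, hX'⟩ := 𝓜.recX_quasi.exists_le
  set c := c2Norm Ω (fun _ => (1 : Mat n n)) with hc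
  have hc0 : 0 ≤ c := add_nonneg (c1Norm_nonneg _ _)
    (Finset.sum_nonneg fun _ _ => Finset.sum_nonneg fun _ _ => supNorm_nonneg _ _)
  set K := ‖(1 : Mat n n)‖ * ‖frob n n‖ * C₁ with hK
  have hK0 : 0 ≤ K := by positivity
  set A' := |E| * c + K with hA'
  have hA'0 : 0 ≤ A' := by positivity
  -- If `M` is the maximal mass, the balance below reads `M ≤ m₀ + A' * A * (J / s + s * C₁ * M)`.
  -- This `s` makes the coefficient of `M` on the right at most `1/2`, and solving for `M` gives
  -- `m₁`.
  set s : ℝ := 1 / (2 * (A' * A * C₁) + 1) with hs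
  have hs0 : 0 < s := by positivity
  have hs1 : A' * A * C₁ * s ≤ 1 / 2 := by
    rw [hs, mul_one_div, div_le_iff₀ (by positivity)]
    linarith
  set m₁ : ℝ := 2 * m₀ + 2 * (A' * A * (J / s)) with hm₁
  refine ⟨2 * (C₁ * m₁) + A * (J / s + s * (C₁ * m₁)), fun N σ G₀ G₁ μ hN hεE hCE hG₀ hm hJ => ?_⟩
  have hN' : (0 : ℝ) < N := by exact_mod_cast hN
  obtain ⟨hfin, hsum⟩ := 𝓜.action_le_iff hN ENNReal.coe_ne_top hJ
  rw [ENNReal.coe_toReal] at hsum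
  set a : Fin N → ℝ := fun j =>
    (𝓜.J σ ((1 / 2 : ℝ) • (μ.G j.castSucc + μ.G j.succ)) (μ.q j) (μ.R j)).toReal with ha
  have ha0 : ∀ j, 0 ≤ a j := fun j => ENNReal.toReal_nonneg
  set mass : Fin (N + 1) → ℝ := fun j => pairing (𝓜.recX σ (μ.G j)) (oneC Ω n) with hmass
  have hpos : ∀ j, μ.G j ∈ 𝓜.Xpos σ := by
    intro j
    refine Fin.cases ?_ (fun i => hCE.2.2.2 i) j
    rw [hCE.2.1]
    exact hG₀
  have hGm : ∀ j, 𝓜.normX σ (μ.G j) ≤ C₁ * mass j := fun j =>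
    (hX σ _).trans (mul_le_mul_of_nonneg_left (tvNorm_le_trace (𝓜.recX_psd σ _ (hpos j))) hC₁.le)
  obtain ⟨j₀, -, hj₀⟩ := Finset.exists_max_image Finset.univ mass Finset.univ_nonempty
  set M := mass j₀ with hM
  have hM0 : 0 ≤ M := by
    have h1 := (apply_nonneg (𝓜.normX σ) _).trans (hGm j₀)
    exact nonneg_of_mul_nonneg_right h1 hC₁
  have hGM : ∀ j, 𝓜.normX σ (μ.G j) ≤ C₁ * M := fun j =>
    (hGm j).trans (mul_le_mul_of_nonneg_left (hj₀ j (Finset.mem_univ j)) hC₁.le)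
  have hfl : ∀ j : Fin N, 𝓜.normY σ (μ.q j) + 𝓜.normX σ (μ.R j) ≤
      A * (a j / s + s * (C₁ * M)) := by
    intro j
    refine (hflux σ _ _ _ (hfin j) s hs0).trans ?_
    refine mul_le_mul_of_nonneg_left (add_le_add le_rfl (mul_le_mul_of_nonneg_left ?_ hs0.le)) hA
    rw [Submodule.coe_smul, Submodule.coe_add, map_smul_eq_mul, Real.norm_of_nonneg (by norm_num)]
    have h1 := map_add_le_add (𝓜.normX σ) (μ.G j.castSucc : Xbar σ) (μ.G j.succ)
    linarith [hGM j.castSucc, hGM j.succ]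
  have hflsum : (1 / N : ℝ) * ∑ j : Fin N, (𝓜.normY σ (μ.q j) + 𝓜.normX σ (μ.R j)) ≤
      A * (J / s + s * (C₁ * M)) := by
    calc (1 / N : ℝ) * ∑ j : Fin N, (𝓜.normY σ (μ.q j) + 𝓜.normX σ (μ.R j))
        ≤ (1 / N : ℝ) * ∑ j : Fin N, A * (a j / s + s * (C₁ * M)) :=
          mul_le_mul_of_nonneg_left (Finset.sum_le_sum fun j _ => hfl j) (by positivity)
      _ = A * (((1 / N : ℝ) * ∑ j, a j) / s + s * (C₁ * M)) := by
          rw [← Finset.mul_sum, Finset.sum_add_distrib, ← Finset.sum_div]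
          simp
          field_simp
      _ ≤ _ := by gcongr
  -- The equation is tested with the identity: the flux contributes at most `|E| c ‖q‖₁` by
  -- consistency, the source at most `K ‖R‖₁`, and `A'` bounds both coefficients.
  have hstep : ∀ j : Fin N, mass j.succ ≤ mass j.castSucc +
      (1 / N : ℝ) * (A' * (𝓜.normY σ (μ.q j) + 𝓜.normX σ (μ.R j))) := by
    intro j
    have h1 := 𝓜.pairing_step hN hCE j (φ := oneC Ω n) fun x => Matrix.isSymm_one
    have h2 := hD σ (μ.q j) (fun _ => 1) contDiffOn_const fun x _ => Matrix.isSymm_one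
    have h3 : pairing (RY σ (μ.q j)) (fun x : Ω => D.apply Ω (fun _ => (1 : Mat n n)) x) = 0 := by
      simp only [FirstOrderOp.apply_one]
      exact map_zero (pairingCLM (RY σ (μ.q j)))
    rw [h3, zero_add] at h2
    have h4 : |pairing (𝓜.recX σ (μ.R j)) (oneC Ω n)| ≤ K * 𝓜.normX σ (μ.R j) := by
      refine (abs_pairing_le _ (φ := oneC Ω n) (c := ‖(1 : Mat n n)‖) fun x => le_rfl).trans ?_
      rw [hK, mul_assoc _ C₁]
      exact mul_le_mul_of_nonneg_left (hX' σ _) (by positivity)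
    have h5 : |pairing (𝓜.recX σ (𝓜.D σ (μ.q j))) (oneC Ω n)| ≤ |E| * c * 𝓜.normY σ (μ.q j) := by
      refine h2.trans (mul_le_mul_of_nonneg_right (mul_le_mul_of_nonneg_right
        (hεE.trans (le_abs_self E)) hc0) (apply_nonneg _ _))
    have h6 : mass j.succ - mass j.castSucc ≤
        (1 / N : ℝ) * (A' * (𝓜.normY σ (μ.q j) + 𝓜.normX σ (μ.R j))) := by
      refine h1.le.trans (mul_le_mul_of_nonneg_left ?_ (by positivity))
      have hq0 : 0 ≤ 𝓜.normY σ (μ.q j) := apply_nonneg _ _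
      have hR0 : 0 ≤ 𝓜.normX σ (μ.R j) := apply_nonneg _ _
      have e1 : A' * (𝓜.normY σ (μ.q j) + 𝓜.normX σ (μ.R j)) = |E| * c * 𝓜.normY σ (μ.q j) +
        K * 𝓜.normX σ (μ.R j) + (K * 𝓜.normY σ (μ.q j) + |E| * c * 𝓜.normX σ (μ.R j)) := by
        rw [hA']; ring
      have e2 : 0 ≤ K * 𝓜.normY σ (μ.q j) + |E| * c * 𝓜.normX σ (μ.R j) := by positivity
      rw [e1]
      linarith [(abs_le.1 h5).1, (abs_le.1 h4).2]
    linarith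
  have hmassle : ∀ i : Fin (N + 1), mass i ≤ m₀ +
      (1 / N : ℝ) * ∑ j : Fin N, A' * (𝓜.normY σ (μ.q j) + 𝓜.normX σ (μ.R j)) := by
    have hn0 : ∀ j : Fin N, 0 ≤ A' * (𝓜.normY σ (μ.q j) + 𝓜.normX σ (μ.R j)) := fun j =>
      mul_nonneg hA'0 (add_nonneg (apply_nonneg _ _) (apply_nonneg _ _))
    have h1 : ∀ i : Fin (N + 1), mass i ≤ m₀ + (1 / N : ℝ) * ∑ j : Fin N with j.castSucc < i,
        A' * (𝓜.normY σ (μ.q j) + 𝓜.normX σ (μ.R j)) := by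
      intro i
      induction i using Fin.induction with
      | zero =>
        simp only [Fin.not_lt_zero, Finset.filter_false, Finset.sum_empty, mul_zero, add_zero]
        rw [hmass]
        simp only [hCE.2.1]
        exact hm
      | succ i ih =>
        have e1 : Finset.univ.filter (fun j : Fin N => j.castSucc < i.succ) =
            insert i (Finset.univ.filter fun j : Fin N => j.castSucc < i.castSucc) := by
          ext j
          simp only [Finset.mem_filter, Finset.mem_univ, true_and, Finset.mem_insert,
            Fin.castSucc_lt_castSucc_iff, Fin.castSucc_lt_succ_iff]
          exact le_iff_eq_or_lt
        rw [e1, Finset.sum_insert (by simp), mul_add]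
        linarith [hstep i]
    intro i
    refine (h1 i).trans (add_le_add le_rfl (mul_le_mul_of_nonneg_left ?_ (by positivity)))
    exact Finset.sum_le_sum_of_subset_of_nonneg (Finset.filter_subset _ _) fun j _ _ => hn0 j
  have hMle : M ≤ m₁ := by
    have h1 := hmassle j₀
    rw [← Finset.mul_sum, mul_left_comm] at h1
    have h2 := mul_le_mul_of_nonneg_left hflsum hA'0
    have h3 : A' * A * C₁ * s * M ≤ 1 / 2 * M := mul_le_mul_of_nonneg_right hs1 hM0
    have e1 : A' * (A * (J / s + s * (C₁ * M))) = A' * A * (J / s) + A' * A * C₁ * s * M := by ring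
    rw [hm₁]
    change M ≤ _ at h1
    linarith
  have hCM : C₁ * M ≤ C₁ * m₁ := mul_le_mul_of_nonneg_left hMle hC₁.le
  -- There are `N + 1` nodes of weight `1 / N`, and `(N + 1) / N ≤ 2`.
  have h1 : ∑ j, (1 / N : ℝ) * 𝓜.normX σ (μ.G j) ≤ 2 * (C₁ * M) := by
    calc ∑ j, (1 / N : ℝ) * 𝓜.normX σ (μ.G j) ≤ ∑ j : Fin (N + 1), (1 / N : ℝ) * (C₁ * M) :=
          Finset.sum_le_sum fun j _ => mul_le_mul_of_nonneg_left (hGM j) (by positivity)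
      _ = ((N + 1) / N : ℝ) * (C₁ * M) := by
          simp
          ring
      _ ≤ 2 * (C₁ * M) := by
          have hN1 : (1 : ℝ) ≤ N := by exact_mod_cast hN
          apply mul_le_mul_of_nonneg_right _ (by positivity)
          rw [div_le_iff₀ hN']
          linarith
  rw [norm1, add_assoc, ← mul_add, ← Finset.sum_add_distrib]
  refine add_le_add (h1.trans (by linarith)) (hflsum.trans ?_)
  gcongr

end Bound

/-! ### Differentiation and integration by parts in time -/

section TimeDerivative

variable {d n m : ℕ} {Ω : Set (Eu d)} [CompactSpace Ω]

/-- The time derivative of a function on space-time. -/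
noncomputable def tpd (f : ℝ × Eu d → Mat n m) (p : ℝ × Eu d) : Mat n m := fderiv ℝ f p (1, 0)

lemma contDiff_tpd {f : ℝ × Eu d → Mat n m} (hf : ContDiff ℝ (⊤ : ℕ∞) f) :
    ContDiff ℝ (⊤ : ℕ∞) (tpd f) := by
  have h1 : ContDiff ℝ (⊤ : ℕ∞) (fderiv ℝ f) := hf.fderiv_right (by simp)
  exact h1.clm_apply contDiff_const

lemma hasDerivAt_slice {f : ℝ × Eu d → Mat n m} (hf : ContDiff ℝ (⊤ : ℕ∞) f) (t : ℝ) (x : Eu d) :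
    HasDerivAt (fun s => f (s, x)) (tpd f (t, x)) t := by
  have h1 : HasDerivAt (fun s : ℝ => (s, x)) ((1 : ℝ), (0 : Eu d)) t :=
    (hasDerivAt_id t).prodMk (hasDerivAt_const t x)
  exact ((hf.differentiable (by simp)) (t, x)).hasFDerivAt.comp_hasDerivAt t h1

/-- The curve of time slices of a continuous function on space-time. -/
noncomputable def timeCurve {f : ℝ × Eu d → Mat n m} (hf : Continuous f) (t : ℝ) :
    C(Ω, Mat n m) :=
  ⟨fun x => f (t, x), by fun_prop⟩

lemma continuous_timeCurve {f : ℝ × Eu d → Mat n m} (hf : Continuous f) :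
    Continuous (timeCurve (Ω := Ω) hf) :=
  ((⟨fun p : ℝ × Ω => f (p.1, p.2), by fun_prop⟩ : C(ℝ × Ω, Mat n m)).curry).continuous

/-- Differentiability in the sup norm: by the fundamental theorem at each point `x`, the curve of
slices is the integral of a continuous `C(Ω)`-valued curve. Any pairing can then be differentiated
as a continuous linear form. -/
lemma hasDerivAt_timeCurve {f : ℝ × Eu d → Mat n m} (hf : ContDiff ℝ (⊤ : ℕ∞) f) (t : ℝ) :
    HasDerivAt (timeCurve (Ω := Ω) hf.continuous) (timeCurve (contDiff_tpd hf).continuous t) t := by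
  have hc := continuous_timeCurve (Ω := Ω) (contDiff_tpd hf).continuous
  have h1 : timeCurve (Ω := Ω) hf.continuous = fun b => timeCurve hf.continuous 0 +
      ∫ s in (0 : ℝ)..b, timeCurve (contDiff_tpd hf).continuous s := by
    ext1 b
    ext1 x
    have h2 := (ContinuousMap.evalCLM ℝ x :
      C(Ω, Mat n m) →L[ℝ] Mat n m).intervalIntegral_comp_comm (hc.intervalIntegrable 0 b)
        (μ := volume)
    have h3 : ∫ s in (0 : ℝ)..b, tpd f (s, x) = f (b, x) - f (0, x) := by
      apply intervalIntegral.integral_eq_sub_of_hasDerivAt fun s _ => hasDerivAt_slice hf s x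
      apply Continuous.intervalIntegrable
      exact (contDiff_tpd hf).continuous.comp (by fun_prop)
    rw [ContinuousMap.add_apply]
    change f (b, x) = f (0, x) + (ContinuousMap.evalCLM ℝ x :
      C(Ω, Mat n m) →L[ℝ] Mat n m) (∫ s in (0 : ℝ)..b, timeCurve (contDiff_tpd hf).continuous s)
    rw [← h2]
    change f (b, x) = f (0, x) + ∫ s in (0 : ℝ)..b, tpd f (s, x)
    rw [h3]
    abel
  rw [h1]
  exact (hc.integral_hasStrictDerivAt 0 t).hasDerivAt.const_add _

lemma hasDerivAt_pairing (μ : MatMeas Ω n m) {f : ℝ × Eu d → Mat n m}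
    (hf : ContDiff ℝ (⊤ : ℕ∞) f) (t : ℝ) :
    HasDerivAt (fun s => pairing μ fun x : Ω => f (s, x))
      (pairing μ fun x : Ω => tpd f (t, x)) t := by
  have h := (pairingCLM μ).hasFDerivAt.comp_hasDerivAt t (hasDerivAt_timeCurve (Ω := Ω) hf t)
  exact h

lemma continuous_pairing_timeCurve (μ : MatMeas Ω n m) {f : ℝ × Eu d → Mat n m}
    (hf : Continuous f) : Continuous fun s => pairing μ fun x : Ω => f (s, x) := by
  have h := (pairingCLM μ).continuous.comp (continuous_timeCurve hf)
  exact h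

lemma recConst_resQ (N : ℕ) (q : Fin N → MatMeas Ω n m) {f : ℝ × Eu d → Mat n m}
    (hf : Continuous f) :
    recConst N q (resQ hf) = ∑ j : Fin N, ∫ t in ((j : ℝ) * (1 / N))..((j + 1) * (1 / N)),
      pairing (q j) fun x : Ω => f (t, x) := by
  refine Finset.sum_congr rfl fun j _ => intervalIntegral.integral_congr fun t ht => ?_
  rw [uIcc_of_le (step_le j)] at ht
  simp only [slice_resQ hf (Icc_subset_unit j ht)]

/-- Integration by parts in time. -/
lemma recLinear_tpd (N : ℕ) (hN : 0 < N) (G : Fin (N + 1) → MatMeas Ω n m)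
    {f : ℝ × Eu d → Mat n m} (hf : ContDiff ℝ (⊤ : ℕ∞) f) :
    recLinear N G (resQ (contDiff_tpd hf).continuous) =
      (pairing (G (Fin.last N)) fun x : Ω => f (1, x)) - (pairing (G 0) fun x : Ω => f (0, x)) -
      ∑ j : Fin N, ∫ t in ((j : ℝ) * (1 / N))..((j + 1) * (1 / N)),
        ((pairing (G j.succ) fun x : Ω => f (t, x)) -
          pairing (G j.castSucc) fun x : Ω => f (t, x)) / (1 / N) := by
  have hN' : (0 : ℝ) < N := by exact_mod_cast hN
  set τ : ℝ := 1 / N with hτ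
  have hτ0 : 0 < τ := by positivity
  set P : Fin (N + 1) → ℝ → ℝ := fun j t => pairing (G j) fun x : Ω => f (t, x) with hP
  set P' : Fin (N + 1) → ℝ → ℝ := fun j t => pairing (G j) fun x : Ω => tpd f (t, x) with hP'
  have hd : ∀ j t, HasDerivAt (P j) (P' j t) t := fun j t => hasDerivAt_pairing (G j) hf t
  have cP : ∀ j, Continuous (P j) := fun j => continuous_pairing_timeCurve (G j) hf.continuous
  have cP' : ∀ j, Continuous (P' j) := fun j =>
    continuous_pairing_timeCurve (G j) (contDiff_tpd hf).continuous
  have key : ∀ j : Fin N, ∫ t in (j * τ)..((j + 1) * τ),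
      pairing ((((j + 1) * τ - t) / τ) • G j.castSucc + ((t - j * τ) / τ) • G j.succ)
        (slice (resQ (contDiff_tpd hf).continuous) t) =
      (P j.succ ((j + 1 : ℕ) * τ) - P j.castSucc ((j : ℕ) * τ)) -
        ∫ t in (j * τ)..((j + 1) * τ), (P j.succ t - P j.castSucc t) / τ := by
    intro j
    have e1 : ∫ t in (j * τ)..((j + 1) * τ),
        pairing ((((j + 1) * τ - t) / τ) • G j.castSucc + ((t - j * τ) / τ) • G j.succ)
          (slice (resQ (contDiff_tpd hf).continuous) t) =
        ∫ t in (j * τ)..((j + 1) * τ),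
          (((j + 1) * τ - t) / τ * P' j.castSucc t + (t - j * τ) / τ * P' j.succ t) := by
      refine intervalIntegral.integral_congr fun t ht => ?_
      rw [uIcc_of_le (step_le j)] at ht
      have e2 := slice_resQ (Ω := Ω) (contDiff_tpd hf).continuous (Icc_subset_unit j ht)
      rw [← coe_sliceC, pairing_add_measure, pairing_smul_measure, pairing_smul_measure, coe_sliceC,
        e2]
    rw [e1, eq_sub_iff_add_eq, ← intervalIntegral.integral_add
      (by apply Continuous.intervalIntegrable; fun_prop)
      (by apply Continuous.intervalIntegrable; fun_prop)]
    -- The product rule for the interpolated pairing: differentiating the weights produces the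
    -- difference quotient, and at either end of the step a single node remains.
    have hder : ∀ t, HasDerivAt
        (fun t => ((j + 1) * τ - t) / τ * P j.castSucc t + (t - j * τ) / τ * P j.succ t)
        ((((j + 1) * τ - t) / τ * P' j.castSucc t + (t - j * τ) / τ * P' j.succ t) +
          (P j.succ t - P j.castSucc t) / τ) t := by
      intro t
      have h1 : HasDerivAt (fun t : ℝ => ((j + 1) * τ - t) / τ) (-1 / τ) t :=
        ((hasDerivAt_id t).const_sub _).div_const τ
      have h2 : HasDerivAt (fun t : ℝ => (t - j * τ) / τ) (1 / τ) t :=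
        ((hasDerivAt_id t).sub_const _).div_const τ
      refine ((h1.mul (hd j.castSucc t)).add (h2.mul (hd j.succ t))).congr_deriv ?_
      ring
    rw [intervalIntegral.integral_eq_sub_of_hasDerivAt (fun t _ => hder t)
      (by apply Continuous.intervalIntegrable; fun_prop)]
    push_cast
    field_simp
    ring_nf
  have hrec : recLinear N G (resQ (contDiff_tpd hf).continuous) =
      ∑ j : Fin N, ∫ t in (j * τ)..((j + 1) * τ),
        pairing ((((j + 1) * τ - t) / τ) • G j.castSucc + ((t - j * τ) / τ) • G j.succ)
          (slice (resQ (contDiff_tpd hf).continuous) t) := rfl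
  rw [hrec, Finset.sum_congr rfl fun j _ => key j, Finset.sum_sub_distrib]
  congr 1
  -- The boundary terms telescope, since the end of one step and the start of the next involve the
  -- same node at the same time.
  have htel : ∑ j : Fin N, (P j.succ ((j + 1 : ℕ) * τ) - P j.castSucc ((j : ℕ) * τ)) =
      P (Fin.last N) ((N : ℕ) * τ) - P 0 ((0 : ℕ) * τ) := by
    have h1 := Fin.sum_univ_succ fun j : Fin (N + 1) => P j ((j : ℕ) * τ)
    have h2 := Fin.sum_univ_castSucc fun j : Fin (N + 1) => P j ((j : ℕ) * τ)
    rw [Finset.sum_sub_distrib]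
    simp only [Fin.val_succ, Fin.val_castSucc, Fin.val_last, Fin.val_zero] at h1 h2
    linarith
  rw [htel]
  have e3 : (N : ℝ) * τ = 1 := by rw [hτ]; field_simp
  simp [hP, e3]

end TimeDerivative

/-! ### The discrete continuity equation in weak form -/

section WeakForm

variable {d n k : ℕ} {Ω : Set (Eu d)} [CompactSpace Ω]

/-- `D*` applied in space to a function on space-time. -/
noncomputable def FirstOrderOp.spaceTime (D : FirstOrderOp d n k) (f : ℝ × Eu d → Mat n n)
    (p : ℝ × Eu d) : Mat n k :=
  D.zeroth (f p) + ∑ i, D.first i (spd i f p)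

lemma FirstOrderOp.contDiff_spaceTime (D : FirstOrderOp d n k) {f : ℝ × Eu d → Mat n n}
    (hf : ContDiff ℝ (⊤ : ℕ∞) f) : ContDiff ℝ (⊤ : ℕ∞) (D.spaceTime f) := by
  refine ContDiff.add ((LinearMap.toContinuousLinearMap D.zeroth).contDiff.comp hf)
    (ContDiff.sum fun i _ => ?_)
  exact (LinearMap.toContinuousLinearMap (D.first i)).contDiff.comp (contDiff_spd i hf)

lemma FirstOrderOp.apply_slice (D : FirstOrderOp d n k) (hΩ : UniqueDiffOn ℝ Ω)
    {f : ℝ × Eu d → Mat n n} (hf : ContDiff ℝ (⊤ : ℕ∞) f) (t : ℝ) (x : Ω) :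
    D.apply Ω (fun y => f (t, y)) x = D.spaceTime f (t, x) := by
  simp only [FirstOrderOp.apply, FirstOrderOp.spaceTime]
  congr 1
  refine Finset.sum_congr rfl fun i _ => ?_
  rw [pd_slice hΩ (hf.differentiable (by simp)) i t x.2]

variable {Sig : Set ℝ} {Xbar Y : Sig → Type*}
  [∀ σ, NormedAddCommGroup (Xbar σ)] [∀ σ, InnerProductSpace ℝ (Xbar σ)]
  [∀ σ, FiniteDimensional ℝ (Xbar σ)]
  [∀ σ, NormedAddCommGroup (Y σ)] [∀ σ, InnerProductSpace ℝ (Y σ)]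
  [∀ σ, FiniteDimensional ℝ (Y σ)]
  {𝓜 : DiscreteModules Ω n k Sig Xbar Y}

/-- The continuity equation holds for the reconstructions up to a small error. -/
theorem DiscreteModules.exists_weakForm_error (hΩ : UniqueDiffOn ℝ Ω) {D : FirstOrderOp d n k}
    (h : 𝓜.ConsistentD D) :
    ∃ RY, 𝓜.AdmissibleY RY ∧ ∀ (f : ℝ × Eu d → Mat n n) (hf : ContDiff ℝ (⊤ : ℕ∞) f),
      (∀ p, (f p).IsSymm) → ∃ ε : Sig → ℝ, (∀ σ, 0 ≤ ε σ) ∧ Tendsto ε (toZero Sig) (𝓝 0) ∧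
      ∀ (N : ℕ) σ (G₀ G₁ : 𝓜.X σ) (μ : DiscreteTriple N (𝓜.X σ) (Y σ) (Xbar σ)), 0 < N →
        𝓜.IsCE N σ G₀ G₁ μ →
        |recLinear N (fun j => 𝓜.recX σ (μ.G j)) (resQ (contDiff_tpd hf).continuous) +
          recConst N (fun j => RY σ (μ.q j)) (resQ (D.contDiff_spaceTime hf).continuous) +
          recConst N (fun j => 𝓜.recX σ (μ.R j)) (resQ hf.continuous) -
          ((pairing (𝓜.recX σ G₁) fun x : Ω => f (1, x)) -
            pairing (𝓜.recX σ G₀) fun x : Ω => f (0, x))| ≤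
          ε σ * ((1 / N : ℝ) * ∑ j, 𝓜.normY σ (μ.q j)) := by
  obtain ⟨RY, hRY, ε, hε, hlim, hD⟩ := h
  refine ⟨RY, hRY, fun f hf hsymm => ?_⟩
  obtain ⟨r, hr, hfr⟩ := exists_c2Norm_slice_le (isCompact_iff_compactSpace.2 ‹_›) hΩ hf
  refine ⟨fun σ => ε σ * r, fun σ => mul_nonneg (hε σ) hr, by simpa using hlim.mul_const r, ?_⟩
  intro N σ G₀ G₁ μ hN hCE
  have hN' : (0 : ℝ) < N := by exact_mod_cast hN
  rw [recLinear_tpd N hN _ hf, recConst_resQ, recConst_resQ, hCE.2.1, hCE.2.2.1]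
  have e1 : ∀ (j : Fin N) (t : ℝ), ((pairing (𝓜.recX σ (μ.G j.succ)) fun x : Ω => f (t, x)) -
      pairing (𝓜.recX σ (μ.G j.castSucc)) fun x : Ω => f (t, x)) / (1 / N) =
      -(pairing (𝓜.recX σ (𝓜.D σ (μ.q j))) fun x : Ω => f (t, x)) +
        pairing (𝓜.recX σ (μ.R j)) fun x : Ω => f (t, x) := by
    intro j t
    have h1 := 𝓜.pairing_step hN hCE j (φ := timeCurve hf.continuous t) fun x => hsymm _
    rw [div_eq_iff (by positivity), mul_comm]
    exact h1
  simp only [e1]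
  have cc : ∀ {l : ℕ} (ν : MatMeas Ω n l) {g : ℝ × Eu d → Mat n l} (_ : Continuous g) (a b : ℝ),
      IntervalIntegrable (fun t => pairing ν fun x : Ω => g (t, x)) volume a b :=
    fun ν _ hg a b => (continuous_pairing_timeCurve ν hg).intervalIntegrable a b
  -- The reconstructed flux tested with `D* f` is added and subtracted, so that the last integrand
  -- is exactly the consistency defect of `D_σ`.
  have e2 : ∀ j : Fin N, (∫ t in ((j : ℝ) * (1 / N))..((j + 1) * (1 / N)),
      (-(pairing (𝓜.recX σ (𝓜.D σ (μ.q j))) fun x : Ω => f (t, x)) +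
        pairing (𝓜.recX σ (μ.R j)) fun x : Ω => f (t, x))) =
      (∫ t in ((j : ℝ) * (1 / N))..((j + 1) * (1 / N)),
        pairing (RY σ (μ.q j)) fun x : Ω => D.spaceTime f (t, x)) +
      (∫ t in ((j : ℝ) * (1 / N))..((j + 1) * (1 / N)),
        pairing (𝓜.recX σ (μ.R j)) fun x : Ω => f (t, x)) -
      ∫ t in ((j : ℝ) * (1 / N))..((j + 1) * (1 / N)),
        ((pairing (RY σ (μ.q j)) fun x : Ω => D.spaceTime f (t, x)) +
        pairing (𝓜.recX σ (𝓜.D σ (μ.q j))) fun x : Ω => f (t, x)) := by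
    intro j
    simp only [neg_add_eq_sub]
    rw [intervalIntegral.integral_sub (cc _ hf.continuous _ _) (cc _ hf.continuous _ _),
      intervalIntegral.integral_add (cc _ (D.contDiff_spaceTime hf).continuous _ _)
        (cc _ hf.continuous _ _)]
    ring
  simp only [e2]
  rw [Finset.sum_sub_distrib, Finset.sum_add_distrib]
  have e3 : ∀ a b c d e : ℝ, a - b - (c + d - e) + c + d - (a - b) = e := by intros; ring
  rw [e3]
  refine (abs_sum_integral_le (b := fun j => ε σ * r * 𝓜.normY σ (μ.q j)) fun j t ht => ?_).trans
    (le_of_eq (by rw [← Finset.mul_sum]; ring))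
  have ht' := Icc_subset_unit j ht
  have h1 := hD σ (μ.q j) (fun y => f (t, y))
    ((contDiff_infty.1 hf 2).comp (contDiff_prodMk_right t)).contDiffOn
    fun x _ => hsymm _
  have e4 : (fun x : Ω => D.apply Ω (fun y => f (t, y)) x) = fun x : Ω => D.spaceTime f (t, x) := by
    ext1 x
    exact D.apply_slice hΩ hf t x
  rw [e4] at h1
  exact h1.trans (mul_le_mul_of_nonneg_right (mul_le_mul_of_nonneg_left (hfr t ht') (hε σ))
    (apply_nonneg _ _))

end WeakForm

/-! ### From smooth to `C¹` test functions -/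

section Extension

variable {d n k : ℕ} {Ω : Set (Eu d)} [CompactSpace Ω]

/-- The symmetric part of a matrix. -/
noncomputable def symPart (n : ℕ) : Mat n n →L[ℝ] Mat n n :=
  LinearMap.toContinuousLinearMap
    { toFun := fun A => (1 / 2 : ℝ) • (A + Aᵀ)
      map_add' := fun A B => by
        rw [Matrix.transpose_add, ← smul_add]
        congr 1
        abel
      map_smul' := fun c A => by
        rw [Matrix.transpose_smul, ← smul_add, smul_comm]
        rfl }

lemma symPart_apply (A : Mat n n) : symPart n A = (1 / 2 : ℝ) • (A + Aᵀ) := rfl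

lemma isSymm_symPart (A : Mat n n) : (symPart n A).IsSymm := by
  rw [Matrix.IsSymm, symPart_apply, Matrix.transpose_smul, Matrix.transpose_add,
    Matrix.transpose_transpose, add_comm]

lemma symPart_of_isSymm {A : Mat n n} (h : A.IsSymm) : symPart n A = A := by
  rw [symPart_apply, h.eq, ← two_smul ℝ A, smul_smul]
  norm_num

lemma tendsto_continuousMap_of_norm_le {α F : Type*} [TopologicalSpace α] [CompactSpace α]
    [NormedAddCommGroup F] {a : ℕ → C(α, F)} {b : C(α, F)} {c : ℕ → ℝ}
    (hc : Tendsto c atTop (𝓝 0)) (hc0 : ∀ i, 0 ≤ c i) (h : ∀ i p, ‖a i p - b p‖ ≤ c i) :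
    Tendsto a atTop (𝓝 b) := by
  rw [tendsto_iff_norm_sub_tendsto_zero]
  exact squeeze_zero (fun i => norm_nonneg _)
    (fun i => (ContinuousMap.norm_le _ (hc0 i)).2 fun p => h i p) hc

/-- Smooth symmetric functions approximate a `C¹` symmetric function together with its
derivatives. -/
lemma exists_seq_symm_smooth (hsm : HasSmoothBoundary Ω) {Φ : ℝ × Eu d → Mat n n}
    (hΦ : ContDiffOn ℝ 1 Φ (Icc 0 1 ×ˢ Ω)) (hs : ∀ p ∈ Icc (0 : ℝ) 1 ×ˢ Ω, (Φ p).IsSymm) :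
    ∃ f : ℕ → ℝ × Eu d → Mat n n, (∀ i, ContDiff ℝ (⊤ : ℕ∞) (f i)) ∧ (∀ i p, (f i p).IsSymm) ∧
      ∃ c : ℕ → ℝ, Tendsto c atTop (𝓝 0) ∧ (∀ i, 0 ≤ c i) ∧ ∀ i, ∀ p ∈ Icc (0 : ℝ) 1 ×ˢ Ω,
        ‖f i p - Φ p‖ ≤ c i ∧
          ‖fderiv ℝ (f i) p - fderivWithin ℝ Φ (Icc 0 1 ×ˢ Ω) p‖ ≤ c i := by
  have hΩc : IsCompact Ω := isCompact_iff_compactSpace.2 ‹_›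
  have hin : ∀ p : ℝ × Eu d, ∃ v, InwardAt (Icc (0 : ℝ) 1 ×ˢ Ω) p v := by
    rintro ⟨t, x⟩
    obtain ⟨v, hv⟩ := exists_inwardAt_Icc t
    obtain ⟨w, hw⟩ := exists_inwardAt_of_hasSmoothBoundary hΩc.isClosed hsm x
    exact ⟨(v, w), hv.prod hw⟩
  have hu : UniqueDiffOn ℝ (Icc (0 : ℝ) 1 ×ˢ Ω) := uniqueDiffOn_of_inwardAt fun p _ => hin p
  choose ψ hψ hclose using fun i : ℕ => exists_smooth_close (isCompact_Icc.prod hΩc) hin hΦ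
    (ε := 1 / ((i : ℝ) + 1)) (by positivity)
  -- The smooth approximations are symmetrized. This keeps them close to `Φ` in `C¹` because `Φ`,
  -- and hence its derivative, is fixed by `symPart`.
  have hd : ∀ p ∈ Icc (0 : ℝ) 1 ×ˢ Ω, fderivWithin ℝ Φ (Icc 0 1 ×ˢ Ω) p =
      (symPart n).comp (fderivWithin ℝ Φ (Icc 0 1 ×ˢ Ω) p) := by
    intro p hp
    have h1 : HasFDerivWithinAt (fun p => symPart n (Φ p))
        ((symPart n).comp (fderivWithin ℝ Φ (Icc 0 1 ×ˢ Ω) p)) (Icc 0 1 ×ˢ Ω) p :=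
      (symPart n).hasFDerivAt.comp_hasFDerivWithinAt p
        ((hΦ.differentiableOn (by simp)) p hp).hasFDerivWithinAt
    have h2 := h1.congr (f₁ := Φ) (fun q hq => (symPart_of_isSymm (hs q hq)).symm)
      (symPart_of_isSymm (hs p hp)).symm
    exact h2.fderivWithin (hu p hp)
  have hK : 0 ≤ ‖symPart n‖ := by positivity
  refine ⟨fun i p => symPart n (ψ i p), fun i => (symPart n).contDiff.comp (hψ i),
    fun i p => isSymm_symPart _, fun i => ‖symPart n‖ * (1 / ((i : ℝ) + 1)), ?_,
    fun i => by positivity, fun i p hp => ⟨?_, ?_⟩⟩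
  · simpa using (tendsto_one_div_add_atTop_nhds_zero_nat (𝕜 := ℝ)).const_mul ‖symPart n‖
  · have h1 : symPart n (ψ i p) - Φ p = symPart n (ψ i p - Φ p) := by
      rw [map_sub, symPart_of_isSymm (hs p hp)]
    change ‖symPart n (ψ i p) - Φ p‖ ≤ _
    rw [h1]
    exact ((symPart n).le_opNorm _).trans (mul_le_mul_of_nonneg_left (hclose i p hp).1 hK)
  · have h1 : fderiv ℝ (fun p => symPart n (ψ i p)) p = (symPart n).comp (fderiv ℝ (ψ i) p) :=
      ((symPart n).hasFDerivAt.comp p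
        (((hψ i).differentiable (by simp)) p).hasFDerivAt).fderiv
    rw [h1, hd p hp, ← ContinuousLinearMap.comp_sub]
    exact ((symPart n).opNorm_comp_le _).trans (mul_le_mul_of_nonneg_left (hclose i p hp).2 hK)

/-- The partial derivatives in `IsCE` are taken within `[0,1]` and within `Ω` separately. Here and
in `pd_slice_within` they are recognized as values of the one derivative within the product, for
which uniform approximation is known. -/
lemma derivWithin_slice {Φ : ℝ × Eu d → Mat n n}
    (hΦ : ContDiffOn ℝ 1 Φ (Icc 0 1 ×ˢ Ω)) {t : ℝ} (ht : t ∈ Icc (0 : ℝ) 1) {x : Eu d}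
    (hx : x ∈ Ω) :
    derivWithin (fun s => Φ (s, x)) (Icc 0 1) t =
      fderivWithin ℝ Φ (Icc 0 1 ×ˢ Ω) (t, x) (1, 0) := by
  have h1 := ((hΦ.differentiableOn (by simp)) (t, x) ⟨ht, hx⟩).hasFDerivWithinAt
  have h2 : HasDerivWithinAt (fun s : ℝ => (s, x)) ((1 : ℝ), (0 : Eu d)) (Icc 0 1) t :=
    ((hasDerivAt_id t).prodMk (hasDerivAt_const t x)).hasDerivWithinAt
  have hm : MapsTo (fun s : ℝ => (s, x)) (Icc 0 1) (Icc 0 1 ×ˢ Ω) := fun s hs => ⟨hs, hx⟩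
  have h3 := h1.comp_hasDerivWithinAt t h2 hm
  exact h3.derivWithin ((uniqueDiffOn_Icc zero_lt_one) t ht)

lemma pd_slice_within (hu : UniqueDiffOn ℝ Ω) {Φ : ℝ × Eu d → Mat n n}
    (hΦ : ContDiffOn ℝ 1 Φ (Icc 0 1 ×ˢ Ω)) {t : ℝ} (ht : t ∈ Icc (0 : ℝ) 1) {x : Eu d}
    (hx : x ∈ Ω) (i : Fin d) :
    pd Ω i (fun y => Φ (t, y)) x =
      fderivWithin ℝ Φ (Icc 0 1 ×ˢ Ω) (t, x) (0, EuclideanSpace.single i 1) := by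
  have h1 := ((hΦ.differentiableOn (by simp)) (t, x) ⟨ht, hx⟩).hasFDerivWithinAt
  have h2 : HasFDerivWithinAt (fun y : Eu d => (t, y)) (ContinuousLinearMap.inr ℝ ℝ (Eu d)) Ω x :=
    (hasFDerivAt_prodMk_right t x).hasFDerivWithinAt
  have h3 := h1.comp x h2 fun y hy => ⟨ht, hy⟩
  have h4 : pd Ω i (fun y => Φ (t, y)) x = ((fderivWithin ℝ Φ (Icc 0 1 ×ˢ Ω) (t, x)).comp
      (ContinuousLinearMap.inr ℝ ℝ (Eu d))) (EuclideanSpace.single i 1) := by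
    rw [pd, ← h3.fderivWithin (hu x hx)]
    rfl
  rw [h4]
  simp

/-- It suffices to test the continuity equation with smooth functions. -/
theorem TripleMeas.isCE_of_smooth (hsm : HasSmoothBoundary Ω) (D : FirstOrderOp d n k)
    {G₀ G₁ : MatMeas Ω n n} {ν : TripleMeas (unitInterval × Ω) n k} (hν : SymmValued ν.G)
    (h : ∀ (f : ℝ × Eu d → Mat n n) (hf : ContDiff ℝ (⊤ : ℕ∞) f), (∀ p, (f p).IsSymm) →
      pairing ν.G (resQ (contDiff_tpd hf).continuous) +
        pairing ν.q (resQ (D.contDiff_spaceTime hf).continuous) +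
        pairing ν.R (resQ hf.continuous) =
      (pairing G₁ fun x : Ω => f (1, x)) - pairing G₀ fun x : Ω => f (0, x)) :
    IsCE D G₀ G₁ ν := by
  refine ⟨hν, fun Φ hΦ hs => ?_⟩
  have hΩc : IsCompact Ω := isCompact_iff_compactSpace.2 ‹_›
  have hu : UniqueDiffOn ℝ Ω := uniqueDiffOn_of_inwardAt fun x _ =>
    exists_inwardAt_of_hasSmoothBoundary hΩc.isClosed hsm x
  have huK : UniqueDiffOn ℝ (Icc (0 : ℝ) 1 ×ˢ Ω) := (uniqueDiffOn_Icc zero_lt_one).prod hu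
  have hmem : ∀ p : unitInterval × Ω, ((p.1 : ℝ), (p.2 : Eu d)) ∈ Icc (0 : ℝ) 1 ×ˢ Ω := fun p =>
    ⟨p.1.2, p.2.2⟩
  have hcm : Continuous fun p : unitInterval × Ω => ((p.1 : ℝ), (p.2 : Eu d)) := by fun_prop
  obtain ⟨f, hf, hfs, c, hc, hc0, hfc⟩ := exists_seq_symm_smooth hsm hΦ hs
  let a : C(unitInterval × Ω, Mat n n) :=
    ⟨fun p => Φ (p.1, p.2), hΦ.continuousOn.comp_continuous hcm hmem⟩
  let b : C(unitInterval × Ω, (ℝ × Eu d) →L[ℝ] Mat n n) :=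
    ⟨fun p => fderivWithin ℝ Φ (Icc 0 1 ×ˢ Ω) (p.1, p.2),
      (hΦ.continuousOn_fderivWithin huK (by simp)).comp_continuous hcm hmem⟩
  have hdc : ∀ i, Continuous (fderiv ℝ (f i)) := fun i => (hf i).continuous_fderiv (by simp)
  -- Functions and derivatives converge uniformly. Each term of the equation is continuous in the
  -- pair of function and derivative, so the equation passes to the limit.
  have ha : Tendsto (fun i => resQ (Ω := Ω) (hf i).continuous) atTop (𝓝 a) :=
    tendsto_continuousMap_of_norm_le hc hc0 fun i p => (hfc i _ (hmem p)).1
  have hb : Tendsto (fun i => resQ (Ω := Ω) (hdc i)) atTop (𝓝 b) :=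
    tendsto_continuousMap_of_norm_le hc hc0 fun i p => (hfc i _ (hmem p)).2
  let ev : ℝ × Eu d → C((ℝ × Eu d) →L[ℝ] Mat n n, Mat n n) := fun v =>
    ⟨fun B => B v, by fun_prop⟩
  let z : C(Mat n n, Mat n k) := ⟨D.zeroth, (LinearMap.toContinuousLinearMap D.zeroth).continuous⟩
  let g : Fin d → C(Mat n n, Mat n k) := fun i =>
    ⟨D.first i, (LinearMap.toContinuousLinearMap (D.first i)).continuous⟩
  let ι : unitInterval → C(Ω, unitInterval × Ω) := fun t => ⟨fun x => (t, x), by fun_prop⟩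
  let S : C(unitInterval × Ω, Mat n n) → C(unitInterval × Ω, (ℝ × Eu d) →L[ℝ] Mat n n) →
      C(unitInterval × Ω, Mat n k) := fun a b =>
    z.comp a + ∑ i, (g i).comp ((ev (0, EuclideanSpace.single i 1)).comp b)
  have hev : ∀ v, Tendsto (fun i => (ev v).comp (resQ (Ω := Ω) (hdc i))) atTop
      (𝓝 ((ev v).comp b)) := fun v => ((ContinuousMap.continuous_postcomp (ev v)).tendsto b).comp hb
  have hS : Tendsto (fun i => S (resQ (Ω := Ω) (hf i).continuous) (resQ (hdc i))) atTop
      (𝓝 (S a b)) :=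
    (((ContinuousMap.continuous_postcomp z).tendsto a).comp ha).add
      (tendsto_finsetSum _ fun i _ =>
        ((ContinuousMap.continuous_postcomp (g i)).tendsto _).comp (hev _))
  have hι : ∀ t, Tendsto (fun i => (resQ (Ω := Ω) (hf i).continuous).comp (ι t)) atTop
      (𝓝 (a.comp (ι t))) := fun t => ((ContinuousMap.continuous_precomp (ι t)).tendsto a).comp ha
  have lim1 := ((((pairingCLM ν.G).continuous.tendsto _).comp (hev (1, 0))).add
    (((pairingCLM ν.q).continuous.tendsto _).comp hS)).add
    (((pairingCLM ν.R).continuous.tendsto _).comp ha)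
  have lim2 := (((pairingCLM G₁).continuous.tendsto _).comp (hι 1)).sub
    (((pairingCLM G₀).continuous.tendsto _).comp (hι 0))
  have heq : pairingCLM ν.G ((ev (1, 0)).comp b) + pairingCLM ν.q (S a b) + pairingCLM ν.R a =
      pairingCLM G₁ (a.comp (ι 1)) - pairingCLM G₀ (a.comp (ι 0)) := by
    refine tendsto_nhds_unique lim1 (lim2.congr fun i => ?_)
    have h1 := h (f i) (hf i) (hfs i)
    have e1 : resQ (Ω := Ω) (D.contDiff_spaceTime (hf i)).continuous =
        S (resQ (hf i).continuous) (resQ (hdc i)) := by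
      ext1 p
      simp only [S, ContinuousMap.add_apply, ContinuousMap.coe_sum, Finset.sum_apply]
      rfl
    rw [e1] at h1
    exact h1.symm
  have e1 : (fun p : unitInterval × Ω => derivWithin (fun s => Φ (s, p.2)) (Icc 0 1) p.1) =
      (ev (1, 0)).comp b := by
    ext1 p
    exact derivWithin_slice hΦ p.1.2 p.2.2
  have e2 : (fun p : unitInterval × Ω => D.apply Ω (fun y => Φ (p.1, y)) p.2) = S a b := by
    ext1 p
    simp only [S, ContinuousMap.add_apply, ContinuousMap.coe_sum, Finset.sum_apply,
      FirstOrderOp.apply]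
    congr 1
    refine Finset.sum_congr rfl fun i _ => ?_
    rw [pd_slice_within hu hΦ p.1.2 p.2.2 i]
    rfl
  rw [e1, e2]
  exact heq

end Extension

/-! ### The discrete action and the dual functional -/

section Energy

variable {d n k : ℕ} {Ω : Set (Eu d)} [CompactSpace Ω] {Sig : Set ℝ} {Xbar Y : Sig → Type*}
  [∀ σ, NormedAddCommGroup (Xbar σ)] [∀ σ, InnerProductSpace ℝ (Xbar σ)]
  [∀ σ, FiniteDimensional ℝ (Xbar σ)]
  [∀ σ, NormedAddCommGroup (Y σ)] [∀ σ, InnerProductSpace ℝ (Y σ)]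
  [∀ σ, FiniteDimensional ℝ (Y σ)]
  {𝓜 : DiscreteModules Ω n k Sig Xbar Y}

lemma continuous_mul_transpose {n m : ℕ} {f : ℝ × Eu d → Mat n m} (hf : Continuous f) :
    Continuous fun p => f p * (f p)ᵀ :=
  continuous_mul_transpose_self.comp hf

lemma sum_integral_le {N : ℕ} {g : Fin N → ℝ → ℝ} {b : Fin N → ℝ} (hg : ∀ j, Continuous (g j))
    (h : ∀ j : Fin N, ∀ t ∈ Icc ((j : ℝ) * (1 / N)) ((j + 1) * (1 / N)), g j t ≤ b j) :
    ∑ j : Fin N, ∫ t in ((j : ℝ) * (1 / N))..((j + 1) * (1 / N)), g j t ≤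
      (1 / N : ℝ) * ∑ j, b j := by
  rw [Finset.mul_sum]
  refine Finset.sum_le_sum fun j _ => ?_
  have h1 := intervalIntegral.integral_mono_on (step_le j) ((hg j).intervalIntegrable _ _)
    (intervalIntegrable_const (c := b j)) (h j) (μ := volume)
  refine h1.trans (le_of_eq ?_)
  rw [intervalIntegral.integral_const, smul_eq_mul]
  ring

lemma integral_add_sub_half_sub_half {a b c e : ℝ → ℝ} (ha : Continuous a) (hb : Continuous b)
    (hc : Continuous c) (he : Continuous e) (x y : ℝ) :
    ∫ t in x..y, (a t + b t - c t / 2 - e t / 2) =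
      (∫ t in x..y, a t) + (∫ t in x..y, b t) - (∫ t in x..y, c t) / 2 -
        (∫ t in x..y, e t) / 2 := by
  rw [intervalIntegral.integral_sub (by apply Continuous.intervalIntegrable; fun_prop)
      (by apply Continuous.intervalIntegrable; fun_prop),
    intervalIntegral.integral_sub (by apply Continuous.intervalIntegrable; fun_prop)
      (by apply Continuous.intervalIntegrable; fun_prop),
    intervalIntegral.integral_add (ha.intervalIntegrable _ _) (hb.intervalIntegrable _ _),
    intervalIntegral.integral_div, intervalIntegral.integral_div]

lemma sum_integral_add_sub_half_le {N : ℕ} {a b c e : Fin N → ℝ → ℝ} (ha : ∀ j, Continuous (a j))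
    (hb : ∀ j, Continuous (b j)) (hc : ∀ j, Continuous (c j)) (he : ∀ j, Continuous (e j))
    {B : Fin N → ℝ} (h : ∀ j : Fin N, ∀ t ∈ Icc ((j : ℝ) * (1 / N)) ((j + 1) * (1 / N)),
      a j t + b j t - c j t / 2 - e j t / 2 ≤ B j) :
    (∑ j : Fin N, ∫ t in ((j : ℝ) * (1 / N))..((j + 1) * (1 / N)), a j t) +
      (∑ j : Fin N, ∫ t in ((j : ℝ) * (1 / N))..((j + 1) * (1 / N)), b j t) -
      (∑ j : Fin N, ∫ t in ((j : ℝ) * (1 / N))..((j + 1) * (1 / N)), c j t) / 2 -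
      (∑ j : Fin N, ∫ t in ((j : ℝ) * (1 / N))..((j + 1) * (1 / N)), e j t) / 2 ≤
      (1 / N : ℝ) * ∑ j, B j := by
  have h1 := sum_integral_le (g := fun j t => a j t + b j t - c j t / 2 - e j t / 2)
    (fun j => by fun_prop) h
  simp only [fun j => integral_add_sub_half_sub_half (ha j) (hb j) (hc j) (he j)] at h1
  rwa [Finset.sum_sub_distrib, Finset.sum_sub_distrib, Finset.sum_add_distrib, ← Finset.sum_div,
    ← Finset.sum_div] at h1

/-- The midpoints of the densities. -/
noncomputable def DiscreteTriple.mid {N : ℕ} {X Y Z : Type*} [AddCommGroup X] [Module ℝ X]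
    (μ : DiscreteTriple N X Y Z) (j : Fin N) : X :=
  (1 / 2 : ℝ) • (μ.G j.castSucc + μ.G j.succ)

lemma DiscreteModules.recAverage_eq {σ : Sig} {N : ℕ}
    (μ : DiscreteTriple N (𝓜.X σ) (Y σ) (Xbar σ)) (R : Xbar σ →ₗ[ℝ] MatMeas Ω n n) :
    (recAverage N fun j => R (μ.G j)) = recConst N fun j => R (μ.mid j) := by
  rw [recAverage_eq_recConst]
  congr 1
  ext1 j
  simp only [DiscreteTriple.mid, Submodule.coe_smul, Submodule.coe_add, map_smul, map_add, smul_add]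

/-- The discrete action dominates the dual action of the reconstructions up to a small error. -/
theorem DiscreteModules.exists_energy_error (hΩ : UniqueDiffOn ℝ Ω) (h : 𝓜.ConsistentJ) :
    ∃ RX RXbar RY, 𝓜.AdmissibleX RX ∧ 𝓜.AdmissibleX RXbar ∧ 𝓜.AdmissibleY RY ∧
      ∀ (u : ℝ × Eu d → Mat n k) (W : ℝ × Eu d → Mat n n) (hu : ContDiff ℝ (⊤ : ℕ∞) u)
        (hW : ContDiff ℝ (⊤ : ℕ∞) W),
      ∃ ε : Sig → ℝ, (∀ σ, 0 ≤ ε σ) ∧ Tendsto ε (toZero Sig) (𝓝 0) ∧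
      ∀ (N : ℕ) σ (μ : DiscreteTriple N (𝓜.X σ) (Y σ) (Xbar σ)), 0 < N → 𝓜.action N σ μ ≠ ⊤ →
        recConst N (fun j => RY σ (μ.q j)) (resQ hu.continuous) +
          recConst N (fun j => RXbar σ (μ.R j)) (resQ hW.continuous) -
          recConst N (fun j => RX σ (μ.mid j))
            (resQ (continuous_mul_transpose hu.continuous)) / 2 -
          recConst N (fun j => RX σ (μ.mid j))
            (resQ (continuous_mul_transpose hW.continuous)) / 2 ≤
          (𝓜.action N σ μ).toReal + ε σ * ((1 / N : ℝ) * ∑ j, 𝓜.normX σ (μ.mid j)) := by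
  obtain ⟨-, RX, RXbar, RY, hRX, hRXbar, hRY, ε, hε, hlim, hJ⟩ := h
  refine ⟨RX, RXbar, RY, hRX, hRXbar, hRY, fun u W hu hW => ?_⟩
  have hΩc : IsCompact Ω := isCompact_iff_compactSpace.2 ‹_›
  obtain ⟨r, hr, hur⟩ := exists_c1Norm_slice_le hΩc hΩ hu
  obtain ⟨r', hr', hWr⟩ := exists_c1Norm_slice_le hΩc hΩ hW
  -- The slices of `u` and `W` form a bounded set in `C¹`, so a single consistency constant serves
  -- for all times.
  obtain ⟨C, hC, hJ⟩ := hJ (max r r')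
  refine ⟨fun σ => ε σ * C, fun σ => mul_nonneg (hε σ) hC.le, by simpa using hlim.mul_const C, ?_⟩
  intro N σ μ hN hfin
  obtain ⟨hfinj, hsum⟩ := 𝓜.action_le_iff hN hfin le_rfl
  have cc : ∀ {l m : ℕ} (ν : MatMeas Ω l m) {g : ℝ × Eu d → Mat l m} (_ : Continuous g),
      Continuous (fun t => pairing ν fun x : Ω => g (t, x)) :=
    fun ν _ hg => continuous_pairing_timeCurve ν hg
  have c1 := fun j : Fin N => cc (RY σ (μ.q j)) hu.continuous
  have c2 := fun j : Fin N => cc (RXbar σ (μ.R j)) hW.continuous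
  have c3 := fun j : Fin N => cc (RX σ (μ.mid j)) (continuous_mul_transpose hu.continuous)
  have c4 := fun j : Fin N => cc (RX σ (μ.mid j)) (continuous_mul_transpose hW.continuous)
  -- Fenchel–Young at each fixed time, with the upper bound for `J*_σ` given by consistency;
  -- integrating over the steps gives the claim.
  have hpt : ∀ j : Fin N, ∀ t ∈ Icc ((j : ℝ) * (1 / N)) ((j + 1) * (1 / N)),
      (pairing (RY σ (μ.q j)) fun x : Ω => u (t, x)) +
        (pairing (RXbar σ (μ.R j)) fun x : Ω => W (t, x)) -
        (pairing (RX σ (μ.mid j)) fun x : Ω => u (t, x) * (u (t, x))ᵀ) / 2 -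
        (pairing (RX σ (μ.mid j)) fun x : Ω => W (t, x) * (W (t, x))ᵀ) / 2 ≤
      (𝓜.J σ (μ.mid j) (μ.q j) (μ.R j)).toReal + ε σ * C * 𝓜.normX σ (μ.mid j) := by
    intro j t ht
    have ht' := Icc_subset_unit j ht
    have h1 := hJ σ (μ.mid j) (fun y => u (t, y)) (fun y => W (t, y))
      ((contDiff_infty.1 hu 1).comp (contDiff_prodMk_right t)).contDiffOn
      ((contDiff_infty.1 hW 1).comp (contDiff_prodMk_right t)).contDiffOn
      ((hur t ht').trans (le_max_left _ _)) ((hWr t ht').trans (le_max_right _ _))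
    have h2 := 𝓜.inner_add_inner_le (hfinj j) h1
    rw [inner_adj, inner_adj, dualAction] at h2
    have h3 : ∀ a b c e f g : ℝ, a + b ≤ c / 2 + e / 2 + f + g → a + b - c / 2 - e / 2 ≤ g + f := by
      intros; linarith
    exact h3 _ _ _ _ _ _ h2
  have h1 := sum_integral_add_sub_half_le c1 c2 c3 c4 hpt
  rw [Finset.sum_add_distrib, mul_add, ← Finset.mul_sum, mul_left_comm (1 / N : ℝ)] at h1
  rw [recConst_resQ, recConst_resQ, recConst_resQ, recConst_resQ]
  exact h1.trans (add_le_add hsum le_rfl)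

/-- It suffices to test the dual bound with smooth functions. -/
lemma TripleMeas.dual_bound_of_smooth {ν : TripleMeas (unitInterval × Ω) n k} {L : ℝ}
    (h : ∀ (u : ℝ × Eu d → Mat n k) (W : ℝ × Eu d → Mat n n) (hu : ContDiff ℝ (⊤ : ℕ∞) u)
      (hW : ContDiff ℝ (⊤ : ℕ∞) W), pairing ν.q (resQ hu.continuous) +
        pairing ν.R (resQ hW.continuous) -
        pairing ν.G (resQ (continuous_mul_transpose hu.continuous)) / 2 -
        pairing ν.G (resQ (continuous_mul_transpose hW.continuous)) / 2 ≤ L)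
    (u : C(unitInterval × Ω, Mat n k)) (W : C(unitInterval × Ω, Mat n n)) :
    pairing ν.q u + pairing ν.R W - pairing ν.G (fun x => u x * (u x)ᵀ) / 2 -
      pairing ν.G (fun x => W x * (W x)ᵀ) / 2 ≤ L := by
  have hc := tendsto_one_div_add_atTop_nhds_zero_nat (𝕜 := ℝ)
  have hc0 : ∀ i : ℕ, (0 : ℝ) < 1 / (i + 1) := fun i => by positivity
  choose f hf hfu using fun i : ℕ => exists_smooth_near u (hc0 i)
  choose g hg hgW using fun i : ℕ => exists_smooth_near W (hc0 i)
  have lu : Tendsto (fun i => resQ (Ω := Ω) (hf i).continuous) atTop (𝓝 u) :=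
    tendsto_continuousMap_of_norm_le hc (fun i => (hc0 i).le) fun i p => hfu i p
  have lW : Tendsto (fun i => resQ (Ω := Ω) (hg i).continuous) atTop (𝓝 W) :=
    tendsto_continuousMap_of_norm_le hc (fun i => (hc0 i).le) fun i p => hgW i p
  let sq : ∀ l : ℕ, C(Mat n l, Mat n n) := fun l => ⟨_, @continuous_mul_transpose_self n l⟩
  have lim := (((((pairingCLM ν.q).continuous.tendsto _).comp lu).add
    (((pairingCLM ν.R).continuous.tendsto _).comp lW)).sub
    ((((pairingCLM ν.G).continuous.tendsto _).comp
      (((ContinuousMap.continuous_postcomp (sq k)).tendsto _).comp lu)).div_const 2)).sub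
    ((((pairingCLM ν.G).continuous.tendsto _).comp
      (((ContinuousMap.continuous_postcomp (sq n)).tendsto _).comp lW)).div_const 2)
  exact le_of_tendsto' lim fun i => h (f i) (g i) (hf i) (hg i)

end Energy

/-! ### Passage to the limit -/

section Limit

variable {d n k : ℕ} {Ω : Set (Eu d)} [CompactSpace Ω] {Sig : Set ℝ} {Xbar Y : Sig → Type*}
  [∀ σ, NormedAddCommGroup (Xbar σ)] [∀ σ, InnerProductSpace ℝ (Xbar σ)]
  [∀ σ, FiniteDimensional ℝ (Xbar σ)]
  [∀ σ, NormedAddCommGroup (Y σ)] [∀ σ, InnerProductSpace ℝ (Y σ)]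
  [∀ σ, FiniteDimensional ℝ (Y σ)]
  {𝓜 : DiscreteModules Ω n k Sig Xbar Y}

/-- The definition asks for positive errors tending to zero, and the mesh size itself is such a
family. -/
lemma RecEquiv.refl (hSig : ∀ σ ∈ Sig, 0 < σ) {m : ℕ} {M : Sig → Type*}
    [∀ σ, NormedAddCommGroup (M σ)] [∀ σ, InnerProductSpace ℝ (M σ)]
    [∀ σ, FiniteDimensional ℝ (M σ)] (p : ∀ σ, Seminorm ℝ (M σ))
    (R : ∀ σ, M σ →ₗ[ℝ] MatMeas Ω n m) : RecEquiv p R R := by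
  refine ⟨fun σ => σ, fun σ => hSig σ σ.2, tendsto_comap, fun σ φ hφ => ?_⟩
  have h0 : dualNorm (p σ) (0 : M σ) = 0 := by simp [dualNorm]
  rw [sub_self, h0]
  exact mul_nonneg (hSig σ σ.2).le (c1Norm_nonneg _ _)

lemma IsQuasiIsometric.isReconstruction {m : ℕ} {M : Sig → Type*}
    [∀ σ, NormedAddCommGroup (M σ)] [∀ σ, InnerProductSpace ℝ (M σ)] {p : ∀ σ, Seminorm ℝ (M σ)}
    {R : ∀ σ, M σ →ₗ[ℝ] MatMeas Ω n m} (h : IsQuasiIsometric p R) : IsReconstruction p R :=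
  let ⟨C, _, h⟩ := h
  ⟨C, fun σ f => (h σ f).2⟩

lemma DiscreteModules.admissibleX_recX (hSig : ∀ σ ∈ Sig, 0 < σ) : 𝓜.AdmissibleX 𝓜.recX :=
  ⟨𝓜.recX_quasi.isReconstruction, RecEquiv.refl hSig _ _, 𝓜.recX_symm, 𝓜.recX_antisymm,
    𝓜.recX_psd⟩

section NormBounds

variable {N : ℕ} {σ : Sig} (μ : DiscreteTriple N (𝓜.X σ) (Y σ) (Xbar σ))

lemma DiscreteModules.norm1_nonneg_terms :
    0 ≤ ∑ j, (1 / N : ℝ) * 𝓜.normX σ (μ.G j) ∧ 0 ≤ (1 / N : ℝ) * ∑ j, 𝓜.normY σ (μ.q j) ∧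
      0 ≤ (1 / N : ℝ) * ∑ j, 𝓜.normX σ (μ.R j) := by
  have hN : (0 : ℝ) ≤ 1 / N := by positivity
  exact ⟨Finset.sum_nonneg fun j _ => mul_nonneg hN (apply_nonneg _ _),
    mul_nonneg hN (Finset.sum_nonneg fun j _ => apply_nonneg _ _),
    mul_nonneg hN (Finset.sum_nonneg fun j _ => apply_nonneg _ _)⟩

lemma DiscreteModules.sum_normY_le_norm1 :
    (1 / N : ℝ) * ∑ j, 𝓜.normY σ (μ.q j) ≤ 𝓜.norm1 N σ μ := by
  obtain ⟨h1, h2, h3⟩ := 𝓜.norm1_nonneg_terms μ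
  rw [norm1]
  linarith

lemma DiscreteModules.sum_normX_le_norm1 :
    (1 / N : ℝ) * ∑ j, 𝓜.normX σ (μ.R j) ≤ 𝓜.norm1 N σ μ := by
  obtain ⟨h1, h2, h3⟩ := 𝓜.norm1_nonneg_terms μ
  rw [norm1]
  linarith

/-- The factor `2` appears because every interior node belongs to two time steps. -/
lemma DiscreteModules.sum_normX_succ_add_castSucc_le_norm1 :
    (1 / N : ℝ) * ∑ j : Fin N, (𝓜.normX σ (μ.G j.succ) + 𝓜.normX σ (μ.G j.castSucc)) ≤
      2 * 𝓜.norm1 N σ μ := by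
  obtain ⟨h1, h2, h3⟩ := 𝓜.norm1_nonneg_terms μ
  have hN : (0 : ℝ) ≤ 1 / N := by positivity
  have e1 := Fin.sum_univ_succ fun j : Fin (N + 1) => 𝓜.normX σ (μ.G j)
  have e2 := Fin.sum_univ_castSucc fun j : Fin (N + 1) => 𝓜.normX σ (μ.G j)
  have p1 : 0 ≤ 𝓜.normX σ (μ.G 0) := apply_nonneg _ _
  have p2 : 0 ≤ 𝓜.normX σ (μ.G (Fin.last N)) := apply_nonneg _ _
  have h4 : ∑ j : Fin N, (𝓜.normX σ (μ.G j.succ) + 𝓜.normX σ (μ.G j.castSucc)) ≤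
      2 * ∑ j, 𝓜.normX σ (μ.G j) := by
    rw [Finset.sum_add_distrib]
    linarith
  have h5 := mul_le_mul_of_nonneg_left h4 hN
  rw [mul_left_comm] at h5
  rw [norm1, ← Finset.mul_sum]
  linarith

lemma DiscreteModules.sum_normX_mid_le_norm1 :
    (1 / N : ℝ) * ∑ j : Fin N, 𝓜.normX σ (μ.mid j) ≤ 𝓜.norm1 N σ μ := by
  have h1 := 𝓜.sum_normX_succ_add_castSucc_le_norm1 μ
  have h2 : ∑ j : Fin N, 𝓜.normX σ (μ.mid j) ≤
      ∑ j : Fin N, (𝓜.normX σ (μ.G j.succ) + 𝓜.normX σ (μ.G j.castSucc)) / 2 := by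
    refine Finset.sum_le_sum fun j _ => ?_
    rw [DiscreteTriple.mid, Submodule.coe_smul, Submodule.coe_add, map_smul_eq_mul,
      Real.norm_of_nonneg (by norm_num)]
    have := map_add_le_add (𝓜.normX σ) (μ.G j.castSucc : Xbar σ) (μ.G j.succ)
    linarith
  rw [← Finset.sum_div] at h2
  have h3 := mul_le_mul_of_nonneg_left h2 (by positivity : (0 : ℝ) ≤ 1 / N)
  rw [mul_div_assoc'] at h3
  linarith

end NormBounds

lemma toZero_neBot (h : AccPt (0 : ℝ) (𝓟 Sig)) : (toZero Sig).NeBot := by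
  rw [toZero, comap_neBot_iff]
  intro t ht
  obtain ⟨y, ⟨hy, hyS⟩, -⟩ := (accPt_iff_nhds.1 h) t ht
  exact ⟨⟨y, hyS⟩, hy⟩

/-- A sequence along which a function comes close to its lower limit. -/
lemma exists_seq_lt_liminf_add {ι : Type*} {F : Filter ι} [F.NeBot] [F.IsCountablyGenerated]
    {a : ι → ℝ≥0∞} (h : liminf a F ≠ ⊤) {P : ι → Prop} (hP : ∀ᶠ i in F, P i) :
    ∃ p : ℕ → ι, Tendsto p atTop F ∧
      ∀ i, P (p i) ∧ a (p i) < liminf a F + 1 / ((i : ℝ≥0∞) + 1) := by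
  obtain ⟨B, hB⟩ := F.exists_antitone_basis
  have hex : ∀ i : ℕ, ∃ x, x ∈ B i ∧ P x ∧ a x < liminf a F + 1 / ((i : ℝ≥0∞) + 1) := by
    intro i
    have h1 : liminf a F < liminf a F + 1 / ((i : ℝ≥0∞) + 1) := by
      apply ENNReal.lt_add_right h
      simp
    obtain ⟨x, hx, hx1, hx2⟩ :=
      ((frequently_lt_of_liminf_lt (by isBoundedDefault) h1).and_eventually
        ((show ∀ᶠ x in F, x ∈ B i from hB.1.mem_of_mem trivial).and hP)).exists
    exact ⟨x, hx1, hx2, hx⟩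
  choose p hpB hp using hex
  exact ⟨p, hB.tendsto hpB, hp⟩

/-- The bound on the discrete `L¹` norms for small mesh sizes, and on each single mesh. -/
theorem DiscreteModules.exists_norm1_bound_of_action_le (hSig : ∀ σ ∈ Sig, 0 < σ)
    {D : FirstOrderOp d n k} (hcons : 𝓜.Consistent D)
    {G₀ : MatMeas Ω n n} {Gs₀ Gs₁ : ∀ σ, 𝓜.X σ} (hGs₀ : ∀ σ, Gs₀ σ ∈ 𝓜.Xpos σ)
    (hconv₀ : Tendsto (fun σ => pairing (𝓜.recX σ (Gs₀ σ)) (oneC Ω n)) (toZero Sig)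
      (𝓝 (pairing G₀ (oneC Ω n))))
    {μ : ∀ (N : ℕ) (σ : Sig), DiscreteTriple N (𝓜.X σ) (Y σ) (Xbar σ)}
    (hCE : ∀ N, 2 ≤ N → ∀ σ, 𝓜.IsCE N σ (Gs₀ σ) (Gs₁ σ) (μ N σ))
    {J : ℝ≥0} (hJ : ∀ N, 2 ≤ N → ∀ σ, 𝓜.action N σ (μ N σ) ≤ J) :
    (∃ σ₀ > 0, ∃ C : ℝ, ∀ N, 2 ≤ N → ∀ σ : Sig, (σ : ℝ) ≤ σ₀ → 𝓜.norm1 N σ (μ N σ) ≤ C) ∧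
    ∀ σ, ∃ C : ℝ, ∀ N, 2 ≤ N → 𝓜.norm1 N σ (μ N σ) ≤ C := by
  obtain ⟨ε, hε, hbound⟩ := 𝓜.exists_norm1_bound hcons
  constructor
  -- For small `σ` both the consistency error and the initial mass are bounded by constants. On a
  -- single mesh, treated afterwards, they are fixed numbers, and the bound is still uniform in `N`.
  · have h1 : ∀ᶠ σ in toZero Sig, ε σ < 1 := hε.eventually_lt_const zero_lt_one
    have h2 : ∀ᶠ σ in toZero Sig, pairing (𝓜.recX σ (Gs₀ σ)) (oneC Ω n) <
        pairing G₀ (oneC Ω n) + 1 := hconv₀.eventually_lt_const (by linarith)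
    obtain ⟨δ, hδ, hball⟩ := (Metric.nhds_basis_ball.comap _).eventually_iff.1 (h1.and h2)
    obtain ⟨C, hC⟩ := hbound 1 (pairing G₀ (oneC Ω n) + 1) J
    refine ⟨δ / 2, half_pos hδ, C, fun N hN σ hσ => ?_⟩
    have hmem : σ ∈ (fun σ : Sig => (σ : ℝ)) ⁻¹' Metric.ball 0 δ := by
      rw [mem_preimage, mem_ball_zero_iff, Real.norm_of_nonneg (hSig σ σ.2).le]
      linarith
    obtain ⟨h3, h4⟩ := hball hmem
    exact hC N σ _ _ _ (by omega) h3.le (hCE N hN σ) (hGs₀ σ) h4.le (hJ N hN σ)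
  · intro σ
    obtain ⟨C, hC⟩ := hbound (ε σ) (pairing (𝓜.recX σ (Gs₀ σ)) (oneC Ω n)) J
    exact ⟨C, fun N hN => hC N σ _ _ _ (by omega) le_rfl (hCE N hN σ) (hGs₀ σ) le_rfl (hJ N hN σ)⟩

/-- A sequence of discrete triples whose reconstructions converge weak*. -/
structure ConvergesTo (𝓜 : DiscreteModules Ω n k Sig Xbar Y) (N : ℕ → ℕ) (s : ℕ → Sig)
    (m : ∀ i, DiscreteTriple (N i) (𝓜.X (s i)) (Y (s i)) (Xbar (s i)))
    (ν : TripleMeas (unitInterval × Ω) n k) : Prop where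
  linear : ∀ RX, 𝓜.AdmissibleX RX →
    WeakStarTendsto (fun i => recLinear (N i) fun j => RX (s i) ((m i).G j)) ν.G
  average : ∀ RX, 𝓜.AdmissibleX RX →
    WeakStarTendsto (fun i => recAverage (N i) fun j => RX (s i) ((m i).G j)) ν.G
  flux : ∀ RY, 𝓜.AdmissibleY RY →
    WeakStarTendsto (fun i => recConst (N i) fun j => RY (s i) ((m i).q j)) ν.q
  source : ∀ RX, 𝓜.AdmissibleX RX →
    WeakStarTendsto (fun i => recConst (N i) fun j => RX (s i) ((m i).R j)) ν.R

variable {N : ℕ → ℕ} {s : ℕ → Sig}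
  {m : ∀ i, DiscreteTriple (N i) (𝓜.X (s i)) (Y (s i)) (Xbar (s i))}
  {ν : TripleMeas (unitInterval × Ω) n k}

/-- It suffices to consider the convergence of the quasi-isometric reconstructions. -/
theorem DiscreteModules.convergesTo_of_weakStarTendsto (hΩ : UniqueDiffOn ℝ Ω)
    (hN : Tendsto N atTop atTop) (hs : Tendsto s atTop (toZero Sig))
    {B : ℝ} (hB : ∀ i, 𝓜.norm1 (N i) (s i) (m i) ≤ B)
    (hG : WeakStarTendsto (fun i => recConst (N i) fun j => 𝓜.recX (s i) ((m i).mid j)) ν.G)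
    (hq : WeakStarTendsto (fun i => recConst (N i) fun j => 𝓜.recY (s i) ((m i).q j)) ν.q)
    (hR : WeakStarTendsto (fun i => recConst (N i) fun j => 𝓜.recX (s i) ((m i).R j)) ν.R) :
    ConvergesTo 𝓜 N s m ν := by
  have hav : ∀ RX, 𝓜.AdmissibleX RX →
      WeakStarTendsto (fun i => recAverage (N i) fun j => RX (s i) ((m i).G j)) ν.G := by
    intro RX hRX
    simp only [𝓜.recAverage_eq]
    have hb : ∀ i, (1 / N i : ℝ) * ∑ j, 𝓜.normX (s i) ((m i).mid j : Xbar (s i)) ≤ B := fun i =>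
      (𝓜.sum_normX_mid_le_norm1 (m i)).trans (hB i)
    have h := WeakStarTendsto.of_recEquiv (M := Xbar) (R := RX) (R' := 𝓜.recX) hΩ
      𝓜.normX_definite hRX.1 𝓜.recX_quasi.isReconstruction hRX.2.1 hs
      (q := fun i j => ((m i).mid j : Xbar (s i))) hb hG
    exact h
  refine ⟨fun RX hRX => ?_, hav, fun RY hRY => ?_, fun RX hRX => ?_⟩
  · obtain ⟨C, hC⟩ := hRX.1
    have hsum : ∀ i, (1 / N i : ℝ) * ∑ j : Fin (N i), (tvNorm (RX (s i) ((m i).G j.succ)) +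
        tvNorm (RX (s i) ((m i).G j.castSucc))) ≤ max C 0 * (2 * B) := by
      intro i
      refine le_trans ?_ (mul_le_mul_of_nonneg_left
        ((𝓜.sum_normX_succ_add_castSucc_le_norm1 (m i)).trans
          (mul_le_mul_of_nonneg_left (hB i) zero_le_two)) (le_max_right C 0))
      rw [mul_left_comm]
      refine mul_le_mul_of_nonneg_left ?_ (by positivity)
      rw [Finset.mul_sum]
      refine Finset.sum_le_sum fun j _ => ?_
      rw [mul_add]
      have hle : ∀ f, tvNorm (RX (s i) f) ≤ max C 0 * 𝓜.normX (s i) f := fun f => (hC _ f).trans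
        (mul_le_mul_of_nonneg_right (le_max_left _ _) (apply_nonneg _ _))
      exact add_le_add (hle _) (hle _)
    exact WeakStarTendsto.recLinear hN (G := fun i j => RX (s i) ((m i).G j)) hsum (hav RX hRX)
  · have hb : ∀ i, (1 / N i : ℝ) * ∑ j, 𝓜.normY (s i) ((m i).q j) ≤ B := fun i =>
      (𝓜.sum_normY_le_norm1 (m i)).trans (hB i)
    have h := WeakStarTendsto.of_recEquiv (M := Y) (R := RY) (R' := 𝓜.recY) hΩ
      𝓜.normY_definite hRY.1 𝓜.recY_quasi.isReconstruction hRY.2 hs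
      (q := fun i => (m i).q) hb hq
    exact h
  · have hb : ∀ i, (1 / N i : ℝ) * ∑ j, 𝓜.normX (s i) ((m i).R j) ≤ B := fun i =>
      (𝓜.sum_normX_le_norm1 (m i)).trans (hB i)
    have h := WeakStarTendsto.of_recEquiv (M := Xbar) (R := RX) (R' := 𝓜.recX) hΩ
      𝓜.normX_definite hRX.1 𝓜.recX_quasi.isReconstruction hRX.2.1 hs
      (q := fun i => (m i).R) hb hR
    exact h

/-- Weak* compactness of discrete triples with bounded `L¹` norms. -/
theorem DiscreteModules.exists_subseq_convergesTo (hΩ : UniqueDiffOn ℝ Ω)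
    (hN : Tendsto N atTop atTop) (hs : Tendsto s atTop (toZero Sig))
    {B : ℝ} (hB : ∀ i, 𝓜.norm1 (N i) (s i) (m i) ≤ B) :
    ∃ φ : ℕ → ℕ, Tendsto φ atTop atTop ∧ ∃ ν : TripleMeas (unitInterval × Ω) n k,
      SymmValued ν.G ∧
        ConvergesTo 𝓜 (fun i => N (φ i)) (fun i => s (φ i)) (fun i => m (φ i)) ν := by
  obtain ⟨CX, hCX0, hCX⟩ := 𝓜.recX_quasi.isReconstruction.sum_tvNorm_le
  obtain ⟨CY, hCY0, hCY⟩ := 𝓜.recY_quasi.isReconstruction.sum_tvNorm_le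
  have bq := fun i => (hCY _ _ (m i).q).trans
    (mul_le_mul_of_nonneg_left ((𝓜.sum_normY_le_norm1 (m i)).trans (hB i)) hCY0)
  have bR := fun i => (hCX _ _ (m i).R).trans
    (mul_le_mul_of_nonneg_left ((𝓜.sum_normX_le_norm1 (m i)).trans (hB i)) hCX0)
  have bG := fun i => (hCX _ _ fun j => ((m i).mid j : Xbar (s i))).trans
    (mul_le_mul_of_nonneg_left ((𝓜.sum_normX_mid_le_norm1 (m i)).trans (hB i)) hCX0)
  obtain ⟨φ₁, hφ₁, νq, hνq⟩ := exists_subseq_weakStarTendsto bq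
  obtain ⟨φ₂, hφ₂, νR, hνR⟩ := exists_subseq_weakStarTendsto fun i => bR (φ₁ i)
  obtain ⟨φ₃, hφ₃, νG, hνG⟩ := exists_subseq_weakStarTendsto fun i => bG (φ₁ (φ₂ i))
  have h3 := hφ₃.tendsto_atTop
  have h23 := hφ₂.tendsto_atTop.comp h3
  have hφ := hφ₁.tendsto_atTop.comp h23
  have hq := hνq.comp h23
  have hR := hνR.comp h3
  refine ⟨fun i => φ₁ (φ₂ (φ₃ i)), hφ, ⟨νG, νq, νR⟩, ?_, ?_⟩
  · exact symmValued_of_weakStarTendsto (fun i j => 𝓜.recX_symm _ _ (Subtype.coe_prop _)) hνG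
  · exact 𝓜.convergesTo_of_weakStarTendsto hΩ (hN.comp hφ) (hs.comp hφ) (fun i => hB _) hνG hq hR

/-- The limit solves the continuity equation. -/
theorem ConvergesTo.isCE (hν : ConvergesTo 𝓜 N s m ν) (hsm : HasSmoothBoundary Ω)
    (hΩ : UniqueDiffOn ℝ Ω) (hSig : ∀ σ ∈ Sig, 0 < σ) {D : FirstOrderOp d n k}
    (hD : 𝓜.ConsistentD D) (hsymm : SymmValued ν.G) (hN : ∀ i, 0 < N i)
    (hs : Tendsto s atTop (toZero Sig)) {B : ℝ} (hB : ∀ i, 𝓜.norm1 (N i) (s i) (m i) ≤ B)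
    {G₀ G₁ : MatMeas Ω n n} {Gs₀ Gs₁ : ∀ σ, 𝓜.X σ}
    (hconv₀ : ∀ Φ : C(Ω, Mat n n), (∀ x, (Φ x).IsSymm) →
      Tendsto (fun σ => pairing (𝓜.recX σ (Gs₀ σ)) Φ) (toZero Sig) (𝓝 (pairing G₀ Φ)))
    (hconv₁ : ∀ Φ : C(Ω, Mat n n), (∀ x, (Φ x).IsSymm) →
      Tendsto (fun σ => pairing (𝓜.recX σ (Gs₁ σ)) Φ) (toZero Sig) (𝓝 (pairing G₁ Φ)))
    (hCE : ∀ i, 𝓜.IsCE (N i) (s i) (Gs₀ (s i)) (Gs₁ (s i)) (m i)) : IsCE D G₀ G₁ ν := by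
  obtain ⟨RY, hRY, hweak⟩ := 𝓜.exists_weakForm_error hΩ hD
  refine TripleMeas.isCE_of_smooth hsm D hsymm fun f hf hfs => ?_
  obtain ⟨ε, hε, hεlim, herr⟩ := hweak f hf hfs
  have hX := 𝓜.admissibleX_recX hSig
  -- The time derivative is paired with the piecewise linear reconstruction, for which integration
  -- by parts is exact.
  have l1 := hν.linear _ hX (resQ (contDiff_tpd hf).continuous)
  have l2 := hν.flux _ hRY (resQ (D.contDiff_spaceTime hf).continuous)
  have l3 := hν.source _ hX (resQ hf.continuous)
  have l4 := (hconv₁ (timeCurve hf.continuous 1) fun x => hfs _).comp hs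
  have l5 := (hconv₀ (timeCurve hf.continuous 0) fun x => hfs _).comp hs
  have l6 := ((l1.add l2).add l3).sub (l4.sub l5)
  have l7 : Tendsto (fun i => ε (s i) * B) atTop (𝓝 0) := by
    simpa using (hεlim.comp hs).mul_const B
  exact sub_eq_zero.1 (tendsto_nhds_unique l6 (squeeze_zero_norm (a := fun i => ε (s i) * B)
    (fun i => (herr (N i) (s i) _ _ (m i) (hN i) (hCE i)).trans
      (mul_le_mul_of_nonneg_left ((𝓜.sum_normY_le_norm1 (m i)).trans (hB i)) (hε _))) l7))

/-- Lower semicontinuity of the action along the sequence. -/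
theorem ConvergesTo.action_le (hν : ConvergesTo 𝓜 N s m ν) (hΩ : UniqueDiffOn ℝ Ω)
    (hJ : 𝓜.ConsistentJ) (hsymm : SymmValued ν.G) (hN : ∀ i, 0 < N i)
    (hs : Tendsto s atTop (toZero Sig)) {B : ℝ} (hB : ∀ i, 𝓜.norm1 (N i) (s i) (m i) ≤ B)
    {a : ℕ → ℝ} {L : ℝ} (ha : Tendsto a atTop (𝓝 L))
    (hfin : ∀ i, 𝓜.action (N i) (s i) (m i) ≠ ⊤)
    (hle : ∀ i, (𝓜.action (N i) (s i) (m i)).toReal ≤ a i) : ν.action ≤ ENNReal.ofReal L := by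
  obtain ⟨RX, RXbar, RY, hRX, hRXbar, hRY, henergy⟩ := 𝓜.exists_energy_error hΩ hJ
  refine ν.action_le_of_dual_bound hsymm (TripleMeas.dual_bound_of_smooth fun u W hu hW => ?_)
  obtain ⟨ε, hε, hεlim, herr⟩ := henergy u W hu hW
  -- The three families supplied by the consistency of `J` need not be the quasi-isometric ones;
  -- `ConvergesTo` gives the same limit for all of them. Averages are used because the discrete
  -- action is evaluated at the midpoints.
  have hav := hν.average _ hRX
  simp only [𝓜.recAverage_eq] at hav
  have l1 := ((((hν.flux _ hRY (resQ hu.continuous)).add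
    (hν.source _ hRXbar (resQ hW.continuous))).sub
    ((hav (resQ (continuous_mul_transpose hu.continuous))).div_const 2)).sub
    ((hav (resQ (continuous_mul_transpose hW.continuous))).div_const 2))
  have l2 : Tendsto (fun i => a i + ε (s i) * B) atTop (𝓝 L) := by
    simpa using ha.add ((hεlim.comp hs).mul_const B)
  exact le_of_tendsto_of_tendsto' l1 l2 fun i =>
    (herr (N i) (s i) (m i) (hN i) (hfin i)).trans (add_le_add (hle i)
      (mul_le_mul_of_nonneg_left ((𝓜.sum_normX_mid_le_norm1 (m i)).trans (hB i)) (hε _)))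

end Limit

end MatrixOT

/-! ### The asymptotic lower bound -/

theorem mainTheorem5 {d n k : ℕ} (hd : 0 < d) (hn : 0 < n) (hk : 0 < k)
    (Ω : Set (Eu d)) [CompactSpace Ω] (hΩ_int : (interior Ω).Nonempty)
    (hΩ_smooth : HasSmoothBoundary Ω) (D : FirstOrderOp d n k)
    (G₀ G₁ : MatMeas Ω n n) (hG₀ : PSDValued G₀) (hG₁ : PSDValued G₁)
    (Sig : Set ℝ) (hSig_pos : ∀ σ ∈ Sig, 0 < σ) (hSig_acc : AccPt 0 (𝓟 Sig))
    {Xbar Y : Sig → Type*}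
    [∀ σ, NormedAddCommGroup (Xbar σ)] [∀ σ, InnerProductSpace ℝ (Xbar σ)]
    [∀ σ, FiniteDimensional ℝ (Xbar σ)]
    [∀ σ, NormedAddCommGroup (Y σ)] [∀ σ, InnerProductSpace ℝ (Y σ)]
    [∀ σ, FiniteDimensional ℝ (Y σ)]
    (𝓜 : DiscreteModules Ω n k Sig Xbar Y)
    (Gs₀ Gs₁ : ∀ σ, 𝓜.X σ)
    (hGs₀ : ∀ σ, Gs₀ σ ∈ 𝓜.Xpos σ) (hGs₁ : ∀ σ, Gs₁ σ ∈ 𝓜.Xpos σ)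
    (hconv₀ : ∀ Φ : C(Ω, Mat n n), (∀ x, (Φ x).IsSymm) →
      Tendsto (fun σ => pairing (𝓜.recX σ (Gs₀ σ)) Φ) (toZero Sig) (𝓝 (pairing G₀ Φ)))
    (hconv₁ : ∀ Φ : C(Ω, Mat n n), (∀ x, (Φ x).IsSymm) →
      Tendsto (fun σ => pairing (𝓜.recX σ (Gs₁ σ)) Φ) (toZero Sig) (𝓝 (pairing G₁ Φ)))
    (μ : ∀ (N : ℕ) (σ : Sig), DiscreteTriple N (𝓜.X σ) (Y σ) (Xbar σ))
    (hCE : ∀ N, 2 ≤ N → ∀ σ, 𝓜.IsCE N σ (Gs₀ σ) (Gs₁ σ) (μ N σ))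
    (hJ : ∃ J : ℝ≥0, ∀ N, 2 ≤ N → ∀ σ, 𝓜.action N σ (μ N σ) ≤ J)
    (hcons : 𝓜.Consistent D) :
    (∃ σ₀ > 0, ∃ C : ℝ, ∀ N, 2 ≤ N → ∀ σ : Sig, (σ : ℝ) ≤ σ₀ → 𝓜.norm1 N σ (μ N σ) ≤ C) ∧
    (∀ S : Set Sig, (∀ δ : ℝ, 0 < δ → {σ ∈ S | δ ≤ (σ : ℝ)}.Finite) →
      ∃ C : ℝ, ∀ N, 2 ≤ N → ∀ σ ∈ S, 𝓜.norm1 N σ (μ N σ) ≤ C) ∧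
    ∃ (N : ℕ → ℕ) (s : ℕ → Sig) (ν : TripleMeas (unitInterval × Ω) n k),
      (∀ i, 2 ≤ N i) ∧ Tendsto N atTop atTop ∧ Tendsto s atTop (toZero Sig) ∧
      IsCEInfty D G₀ G₁ ν ∧
      (∀ RX RXbar RY, 𝓜.AdmissibleX RX → 𝓜.AdmissibleX RXbar → 𝓜.AdmissibleY RY →
        WeakStarTendsto
          (fun i => recLinear (N i) fun j => RX (s i) ((μ (N i) (s i)).G j)) ν.G ∧
        WeakStarTendsto
          (fun i => recAverage (N i) fun j => RX (s i) ((μ (N i) (s i)).G j)) ν.G ∧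
        WeakStarTendsto
          (fun i => recConst (N i) fun j => RY (s i) ((μ (N i) (s i)).q j)) ν.q ∧
        WeakStarTendsto
          (fun i => recConst (N i) fun j => RXbar (s i) ((μ (N i) (s i)).R j)) ν.R) ∧
      ν.action ≤ liminf (fun p : ℕ × Sig => 𝓜.action p.1 p.2 (μ p.1 p.2))
        (atTop ×ˢ toZero Sig) := by
  have hΩc : IsCompact Ω := isCompact_iff_compactSpace.2 ‹_›
  have hΩ : UniqueDiffOn ℝ Ω := uniqueDiffOn_of_inwardAt fun x _ =>
    exists_inwardAt_of_hasSmoothBoundary hΩc.isClosed hΩ_smooth x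
  obtain ⟨J, hJ⟩ := hJ
  obtain ⟨⟨σ₀, hσ₀, C, hC⟩, hsingle⟩ := 𝓜.exists_norm1_bound_of_action_le hSig_pos hcons hGs₀
    (hconv₀ (oneC Ω n) fun x => Matrix.isSymm_one) hCE hJ
  refine ⟨⟨σ₀, hσ₀, C, hC⟩, fun S hS => ?_, ?_⟩
  -- Only finitely many meshes of `S` have size at least `σ₀`, so the bounds on the single meshes
  -- have a maximum there.
  · choose c hc using hsingle
    obtain ⟨b, hb⟩ := ((hS σ₀ hσ₀).image c).bddAbove
    refine ⟨max C b, fun N hN σ hσ => ?_⟩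
    rcases le_total (σ : ℝ) σ₀ with h | h
    · exact (hC N hN σ h).trans (le_max_left _ _)
    · exact (hc σ N hN).trans ((hb (mem_image_of_mem c ⟨hσ, h⟩)).trans (le_max_right _ _))
  have hne : (toZero Sig).NeBot := toZero_neBot hSig_acc
  have hcg : (toZero Sig).IsCountablyGenerated := by
    unfold toZero
    infer_instance
  have hsmall : ∀ᶠ σ : Sig in toZero Sig, (σ : ℝ) ≤ σ₀ :=
    (tendsto_comap : Tendsto (fun σ : Sig => (σ : ℝ)) (toZero Sig) (𝓝 0)).eventually_le_const hσ₀
  have hev : ∀ᶠ p : ℕ × Sig in atTop ×ˢ toZero Sig, 2 ≤ p.1 ∧ (p.2 : ℝ) ≤ σ₀ :=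
    (eventually_ge_atTop 2).prod_mk hsmall
  set L := liminf (fun p : ℕ × Sig => 𝓜.action p.1 p.2 (μ p.1 p.2)) (atTop ×ˢ toZero Sig) with hL
  have hLJ : L ≤ J := by
    refine liminf_le_of_frequently_le' (Eventually.frequently ?_)
    filter_upwards [hev] with p hp
    exact hJ p.1 hp.1 p.2
  have hLtop : L ≠ ⊤ := ne_top_of_le_ne_top ENNReal.coe_ne_top hLJ
  -- The sequence stays in the range where the uniform bound holds, and its actions exceed the lower
  -- limit by at most `1/(i+1)`. A subsequence therefore gives compactness and the sharp bound at
  -- once.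
  obtain ⟨p, hp, hpP⟩ := exists_seq_lt_liminf_add hLtop hev
  have hN : Tendsto (fun i => (p i).1) atTop atTop := tendsto_fst.comp hp
  have hs : Tendsto (fun i => (p i).2) atTop (toZero Sig) := tendsto_snd.comp hp
  have hB : ∀ i, 𝓜.norm1 (p i).1 (p i).2 (μ (p i).1 (p i).2) ≤ C := fun i =>
    hC _ (hpP i).1.1 _ (hpP i).1.2
  obtain ⟨φ, hφ, ν, hsymm, hν⟩ := 𝓜.exists_subseq_convergesTo hΩ
    (m := fun i => μ (p i).1 (p i).2) hN hs hB
  have hfin : ∀ i, 𝓜.action (p i).1 (p i).2 (μ (p i).1 (p i).2) ≠ ⊤ := fun i =>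
    ne_top_of_le_ne_top ENNReal.coe_ne_top (hJ _ (hpP i).1.1 _)
  have hle : ∀ i, (𝓜.action (p i).1 (p i).2 (μ (p i).1 (p i).2)).toReal ≤
      L.toReal + 1 / ((i : ℝ) + 1) := by
    intro i
    have h1 : (1 / ((i : ℝ≥0∞) + 1)) ≠ ⊤ := by simp
    have h2 := ENNReal.toReal_mono (ENNReal.add_ne_top.2 ⟨hLtop, h1⟩) (hpP i).2.le
    rw [ENNReal.toReal_add hLtop h1] at h2
    refine h2.trans (le_of_eq ?_)
    rw [ENNReal.toReal_div, ENNReal.toReal_add (by simp) (by simp)]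
    simp
  have hlim : Tendsto (fun i : ℕ => L.toReal + 1 / ((i : ℝ) + 1)) atTop (𝓝 L.toReal) := by
    simpa using (tendsto_one_div_add_atTop_nhds_zero_nat (𝕜 := ℝ)).const_add L.toReal
  have haction : ν.action ≤ L := by
    have h1 := hν.action_le hΩ hcons.2 hsymm (fun i => by have := (hpP (φ i)).1.1; omega)
      (hs.comp hφ) (fun i => hB (φ i)) (hlim.comp hφ) (fun i => hfin (φ i)) fun i => hle (φ i)
    rwa [ENNReal.ofReal_toReal hLtop] at h1
  refine ⟨fun i => (p (φ i)).1, fun i => (p (φ i)).2, ν, fun i => (hpP (φ i)).1.1, hN.comp hφ,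
    hs.comp hφ, ⟨?_, haction.trans_lt hLtop.lt_top⟩, ?_, haction⟩
  · exact hν.isCE hΩ_smooth hΩ hSig_pos hcons.1 hsymm
      (fun i => by have := (hpP (φ i)).1.1; omega) (hs.comp hφ) (fun i => hB (φ i)) hconv₀ hconv₁
      fun i => hCE _ (hpP (φ i)).1.1 _
  · exact fun RX RXbar RY hRX hRXbar hRY =>
      ⟨hν.linear RX hRX, hν.average RX hRX, hν.flux RY hRY, hν.source RXbar hRXbar⟩
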